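/- Let $d\ge 1$ and $T\in\mathbb N$, $T\ge 1$. Let $\mathcal L\subset\mathbb R^d$ be such that (L1) there is $r>0$ with $|x-y|\ge r$ for all distinct $x,y\in\mathcal L$, and (L2) $\mathcal L+Tz=\mathcal L$ for all $z\in\mathbb Z^d$. Let $c_{i,j}\in[0,\infty)$, $i,j\in\mathcal L$, be such that (H1) $c_{i+Tz,j+Tz}=c_{i,j}$ for all $i,j\in\mathcal L$, $z\in\mathbb Z^d$, and (H3) there is $R>1$ with $c_{i,j}=0$ whenever $|i-j|\ge R$. For $u\colon\mathcal L\to\mathbb R$ and $A\subset\mathbb R^d$ put $E(u,A)=\sum_{i\in\mathcal L\cap A}\sum_{j\in\mathcal L}c_{i,j}(u(i)-u(j))^+$. Let $Q_\rho=[-\rho/2,\rho/2)^d$; for each unit vector $\nu$ fix a linear isometry $R^\nu$ of $\mathbb R^d$ with $R^\nu e_d=\nu$, and put $Q^\nu_\rho=R^\nu Q_\rho$ and $u_\nu(x)=1$ if $\langle\nu,x\rangle\ge 0$, $u_\nu(x)=0$ otherwise. Then there is exactly one convex, positively one-homogeneous function $\varphi\colon\mathbb R^d\to[0,\infty)$ (the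 homogenized surface energy density) such that for all unit vectors $\nu$ the following limits exist (the inner one for every $\delta\in(0,1)$) and $$\varphi(\nu)=\lim_{\delta\to0^+}\lim_{S\to+\infty}\frac1{S^{d-1}}\inf\{E(u,Q^\nu_S): u\colon\mathcal L\to\{0,1\},\ u=u_\nu\text{ on }\mathcal L\setminus Q^\nu_{(1-\delta)S}\}.$$ Let $W_\varphi=\{\zeta\in\mathbb R^d:\langle\zeta,\nu\rangle\le\varphi(\nu)\text{ for all }|\nu|=1\}$ be its Wulff set and $\mathcal E=\{(i,j)\in(\mathcal L\cap Q_T)\times\mathcal L:c_{i,j}\ne0\}$. Then: 1. $\varphi$ is crystalline, i.e. $W_\varphi$ is a polytope (the convex hull of a finite set). 2. $N=\#\mathcal E$ is finite and $W_\varphi$ has at most $3^N$ extreme points. 3. For all $\nu\in\mathbb R^d$, $\varphi(\nu)=\sup_{\alpha\in\mathcal C}\big\langle\nu,\frac1{T^d}\sum_{i\in\mathcal L\cap Q_T}\sum_{j\in\mathcal L}\alpha_{i,j}(i-j)\big\rangle$, where $\mathcal C$ is the set of all $\alpha\colon\mathcal L\times\mathcal L\to\mathbb R$ with $0\le\alpha_{i,j}\le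 c_{i,j}$ and $\alpha_{i+Tz,j+Tz}=\alpha_{i,j}$ for all $i,j\in\mathcal L$, $z\in\mathbb Z^d$, and $\sum_{j\in\mathcal L}(\alpha_{j,i}-\alpha_{i,j})=0$ for all $i\in\mathcal L\cap Q_T$. 4. $W_\varphi=\Lambda\big(V\cap\prod_{(i,j)\in\mathcal E}[0,c_{i,j}]\big)$, where $\Lambda\colon\mathbb R^{\mathcal E}\to\mathbb R^d$ is the linear map $\Lambda\beta=\frac1{T^d}\sum_{(i,j)\in\mathcal E}\beta_{i,j}(i-j)$ and $V\subset\mathbb R^{\mathcal E}$ is the linear subspace of all $\beta$ whose extension $\alpha$ to $\mathcal L\times\mathcal L$ by $T$-periodicity, and by $0$ where $c$ vanishes, satisfies $\sum_{j\in\mathcal L}(\alpha_{j,i}-\alpha_{i,j})=0$ for all $i\in\mathcal L\cap Q_T$. -/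

import Mathlib

open scoped NNReal ENNReal Topology

noncomputable section

namespace LatticeEnergy

/-- The ambient space `ℝ^d`, written with `d = n + 1 ≥ 1`. -/
abbrev Space (n : ℕ) : Type := EuclideanSpace ℝ (Fin (n + 1))

/-- The vector `T z` for `z ∈ ℤ^d`. -/
def shift {n : ℕ} (T : ℕ) (z : Fin (n + 1) → ℤ) : Space n :=
  WithLp.toLp 2 fun k => (T : ℝ) * (z k : ℝ)

/-- The last standard basis vector `e_d`. -/
def lastBasisVector (n : ℕ) : Space n := EuclideanSpace.single (Fin.last n) (1 : ℝ)

/-- The half-open cube `Q_ρ = [-ρ/2, ρ/2)^d`. -/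
def cube (n : ℕ) (ρ : ℝ) : Set (Space n) :=
  {x | ∀ k, -(ρ / 2) ≤ x k ∧ x k < ρ / 2}

/-- The image of the cube `Q_ρ` under the linear isometry `U`. -/
def rotatedCube {n : ℕ} (U : Space n ≃ₗᵢ[ℝ] Space n) (ρ : ℝ) : Set (Space n) :=
  U '' cube n ρ

/-- (L1): distinct points of `L` have distance at least some `r > 0`. -/
def IsDiscreteSet {n : ℕ} (L : Set (Space n)) : Prop :=
  ∃ r : ℝ, 0 < r ∧ ∀ x ∈ L, ∀ y ∈ L, x ≠ y → r ≤ dist x y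

/-- (L2): `L + T z = L` for all `z ∈ ℤ^d`. -/
def IsPeriodicSet {n : ℕ} (T : ℕ) (L : Set (Space n)) : Prop :=
  ∀ z : Fin (n + 1) → ℤ, (fun x => x + shift T z) '' L = L

/-- (H1): `a (i + T z) (j + T z) = a i j` for all `i, j ∈ L`, `z ∈ ℤ^d`. -/
def IsPeriodicKernel {n : ℕ} {X : Type} (T : ℕ) {L : Set (Space n)} (a : L → L → X) : Prop :=
  ∀ (z : Fin (n + 1) → ℤ) (i j i' j' : L),
    (i' : Space n) = i + shift T z → (j' : Space n) = j + shift T z → a i' j' = a i j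

/-- (H3): finite range of interaction. -/
def HasFiniteRange {n : ℕ} {L : Set (Space n)} (c : L → L → ℝ≥0) : Prop :=
  ∃ R : ℝ, 1 < R ∧ ∀ i j : L, R ≤ dist (i : Space n) (j : Space n) → c i j = 0

/-- `E(u, A) = ∑_{i ∈ L ∩ A} ∑_{j ∈ L} c_{ij} (u i - u j)^+`, with values in `[0, ∞]`;
`ENNReal.ofReal` takes the positive part. -/
def energy {n : ℕ} {L : Set (Space n)} (c : L → L → ℝ≥0) (u : L → ℝ) (A : Set (Space n)) : ℝ≥0∞ :=
  ∑' i : {i : L // (i : Space n) ∈ A}, ∑' j : L, (c i.1 j : ℝ≥0∞) * ENNReal.ofReal (u i.1 - u j)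

open Classical in
/-- The indicator of the half-space `⟨ν, x⟩ ≥ 0`. -/
def halfSpaceIndicator {n : ℕ} (ν x : Space n) : ℝ :=
  if 0 ≤ inner ℝ ν x then 1 else 0

/-- The functions `u : L → {0,1}` that agree with the half-space indicator of `ν`
outside the rotated cube of side-length `(1 - δ) S`. -/
def competitors {n : ℕ} (L : Set (Space n)) (U : Space n ≃ₗᵢ[ℝ] Space n) (ν : Space n)
    (δ S : ℝ) : Set (L → ℝ) :=
  {u | (∀ i, u i = 0 ∨ u i = 1) ∧
    ∀ i : L, (i : Space n) ∉ rotatedCube U ((1 - δ) * S) → u i = halfSpaceIndicator ν i}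

/-- The normalized minimal energy `S^{-(d-1)} inf E(u, Q^ν_S)` over the competitors. -/
def cellEnergy {n : ℕ} {L : Set (Space n)} (c : L → L → ℝ≥0) (U : Space n ≃ₗᵢ[ℝ] Space n)
    (ν : Space n) (δ S : ℝ) : ℝ≥0∞ :=
  (⨅ u ∈ competitors L U ν δ S, energy c u (rotatedCube U S)) / ENNReal.ofReal (S ^ n)

/-- `φ` is the homogenized surface energy density of `c`: it is nonnegative, convex, positively
homogeneous of degree one, and for every unit vector `ν` the iterated limit
`lim_{δ → 0+} lim_{S → ∞}` of the cell energies exists and equals `φ ν`.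
Here `rot ν` is the chosen linear isometry that maps `e_d` to `ν`. -/
structure IsHomogenizedDensity {n : ℕ} {L : Set (Space n)} (c : L → L → ℝ≥0)
    (rot : Space n → Space n ≃ₗᵢ[ℝ] Space n) (φ : Space n → ℝ) : Prop where
  nonneg : ∀ ν, 0 ≤ φ ν
  convex : ConvexOn ℝ Set.univ φ
  homogeneous : ∀ (t : ℝ) (ν : Space n), 0 < t → φ (t • ν) = t * φ ν
  cell_formula : ∀ ν : Space n, ‖ν‖ = 1 → ∃ g : ℝ → ℝ≥0∞,
    (∀ δ : ℝ, 0 < δ → δ < 1 →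
      Filter.Tendsto (fun S : ℝ => cellEnergy c (rot ν) ν δ S) Filter.atTop (𝓝 (g δ))) ∧
    Filter.Tendsto g (𝓝[>] 0) (𝓝 (ENNReal.ofReal (φ ν)))

/-- The Wulff set of `φ`. -/
def wulffSet {n : ℕ} (φ : Space n → ℝ) : Set (Space n) :=
  {ζ | ∀ ν : Space n, ‖ν‖ = 1 → inner ℝ ζ ν ≤ φ ν}

/-- A polytope is the convex hull of a finite set. -/
def IsPolytope {n : ℕ} (W : Set (Space n)) : Prop :=
  ∃ s : Set (Space n), s.Finite ∧ W = convexHull ℝ s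

/-- `φ` is crystalline if its Wulff set is a polytope. -/
def IsCrystalline {n : ℕ} (φ : Space n → ℝ) : Prop := IsPolytope (wulffSet φ)

/-- The edges `{(i, j) ∈ (L ∩ Q_T) × L : c_{ij} ≠ 0}`. -/
def edges {n : ℕ} (T : ℕ) {L : Set (Space n)} (c : L → L → ℝ≥0) : Set (L × L) :=
  {e | (e.1 : Space n) ∈ cube n T ∧ c e.1 e.2 ≠ 0}

/-- `∑_{j ∈ L} (α_{ji} - α_{ij}) = 0` for all `i ∈ L ∩ Q_T`. (Used only for `α` that vanish
where a finite range `c` vanishes, so that the sums are finite.) -/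
def IsDivergenceFree {n : ℕ} (T : ℕ) {L : Set (Space n)} (α : L → L → ℝ) : Prop :=
  ∀ i : L, (i : Space n) ∈ cube n T → ∑' j : L, (α j i - α i j) = 0

/-- The periodic divergence-free fluxes `α` with `0 ≤ α_{ij} ≤ c_{ij}`. -/
def admissibleFluxes {n : ℕ} (T : ℕ) {L : Set (Space n)} (c : L → L → ℝ≥0) :
    Set (L → L → ℝ) :=
  {α | (∀ i j, 0 ≤ α i j ∧ α i j ≤ c i j) ∧ IsPeriodicKernel T α ∧ IsDivergenceFree T α}

/-- `T^{-d} ∑_{i ∈ L ∩ Q_T} ∑_{j ∈ L} α_{ij} (i - j)`. -/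
def meanFlux {n : ℕ} (T : ℕ) {L : Set (Space n)} (α : L → L → ℝ) : Space n :=
  ((T : ℝ) ^ (n + 1))⁻¹ •
    ∑' i : {i : L // (i : Space n) ∈ cube n T}, ∑' j : L, α i.1 j • ((i.1 : Space n) - j)

/-- The vectors `β ∈ ℝ^N`, indexed by the edges, whose `T`-periodic extension to `L × L`
(by zero where `c` vanishes) is divergence-free. -/
def divergenceFreeVectors {n : ℕ} (T : ℕ) {L : Set (Space n)} (c : L → L → ℝ≥0) :
    Set (edges T c → ℝ) :=
  {β | ∃ α : L → L → ℝ, (∀ i j, c i j = 0 → α i j = 0) ∧ IsPeriodicKernel T α ∧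
    (∀ e : edges T c, β e = α e.1.1 e.1.2) ∧ IsDivergenceFree T α}

end LatticeEnergy

end

noncomputable section

namespace LatticeEnergy

variable {n : ℕ}

/-! ### Lattice translations and cells -/

/-! Modulo `T ℤ^d` the interaction is a finite weighted digraph. Let `W` be the set of mean fluxes
`T^{-d} ∑ β_e (i - j)` of its circulations with `0 ≤ β ≤ c`. Then `φ` is the support function of
`W`, hence `W_φ = W`, a linear image of a box cut by a subspace. An extreme point of `W` lifts to
one of the section, and the latter is determined by which of the `2 N` bounds are active: at most
`3^N` patterns, hence a polytope. Uniqueness of `φ` follows from uniqueness of limits and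
homogeneity.

The core is the inner limit. Put `l = 1 - δ` and `n = d - 1`, and let `ψ` be the energy per unit
area of the half-space indicator. By `tendsto_cellEnergy` the limit is `l^n h_W(ν) + (1 - l^n) ψ`,
and the second term disappears as `δ → 0`. That `ψ` exists is a counting fact: lattice points in a
slab have an asymptotic density (`exists_tendsto_slabCount`).

Lower bound (`eventually_le_graphEnergy`): since `β ≤ c`, the energy of `u` is at least `∑ β du`.
Replace `u` by a function of the height `⟨ν, x⟩` that rises linearly from `0` to `1` over `[0, M]`.
The difference, truncated to a cube, has finite support and is annihilated by the circulation; the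
truncation costs only edges in a lateral shell, which are `o(S^n)`. The ramp itself yields `T^{-d} ∑
β_e ⟨ν, i - j⟩` up to `O(1/M)`, since thick slabs have nearly the density predicted by volume.

Upper bound (`eventually_graphEnergy_le`): linear programming duality (`exists_potential`) gives a
periodic potential `q` for which `T^{-d} ∑ c_e (⟨ν, i - j⟩ + dq)^+` almost equals `h_W(ν)`. By a
coarea argument some superlevel set of `⟨ν, x⟩ + q` at a level in `[0, M]` has at most the average
energy. It is glued to the half-space outside the smaller cube, again at the cost of a lateral
shell. -/

theorem shift_apply (T : ℕ) (z : Fin (n + 1) → ℤ) (k : Fin (n + 1)) :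
    shift T z k = (T : ℝ) * (z k : ℝ) := rfl

theorem shift_add (T : ℕ) (z w : Fin (n + 1) → ℤ) : shift T (z + w) = shift T z + shift T w := by
  ext k
  simp [shift_apply, mul_add]

theorem shift_zero (T : ℕ) : shift T (0 : Fin (n + 1) → ℤ) = 0 := by
  ext k
  simp [shift_apply]

theorem shift_neg (T : ℕ) (z : Fin (n + 1) → ℤ) : shift T (-z) = -shift T z := by
  ext k
  simp [shift_apply]

theorem shift_nsmul (T : ℕ) (m : ℕ) (z : Fin (n + 1) → ℤ) :
    shift T (m • z) = (m : ℝ) • shift T z := by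
  ext k
  simp [shift_apply]
  ring

/-- The index of the translated half-open cell that contains `x`. -/
def cellIndex (T : ℕ) (x : Space n) : Fin (n + 1) → ℤ := fun k => ⌊(x k + T / 2) / T⌋

/-- Half-open cells tile the space, so exactly one translate contains `x`; this uniqueness drives
all later computations of `cellIndex`. -/
theorem sub_shift_mem_cube_iff {T : ℕ} (hT : 0 < T) (x : Space n) (z : Fin (n + 1) → ℤ) :
    x - shift T z ∈ cube n T ↔ z = cellIndex T x := by
  have hT' : (0 : ℝ) < T := by positivity
  rw [funext_iff]
  refine forall_congr' fun k => ?_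
  rw [cellIndex, eq_comm, Int.floor_eq_iff, le_div_iff₀ hT', div_lt_iff₀ hT', PiLp.sub_apply,
    shift_apply]
  constructor <;> rintro ⟨h1, h2⟩ <;> constructor <;> linarith

theorem sub_shift_cellIndex_mem {T : ℕ} (hT : 0 < T) (x : Space n) :
    x - shift T (cellIndex T x) ∈ cube n T := (sub_shift_mem_cube_iff hT x _).2 rfl

theorem cellIndex_eq_zero {T : ℕ} (hT : 0 < T) {x : Space n} (hx : x ∈ cube n T) :
    cellIndex T x = 0 := by
  refine ((sub_shift_mem_cube_iff hT x 0).1 ?_).symm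
  simpa [shift_zero] using hx

theorem cellIndex_add_shift {T : ℕ} (hT : 0 < T) (x : Space n) (z : Fin (n + 1) → ℤ) :
    cellIndex T (x + shift T z) = cellIndex T x + z := by
  refine ((sub_shift_mem_cube_iff hT _ _).1 ?_).symm
  have := sub_shift_cellIndex_mem hT x
  rw [shift_add]
  convert this using 1
  abel

/-! ### Rotated boxes -/

/-- The image under `U` of the half-open box with sides `[lo k, hi k)`. -/
def rotatedBox (U : Space n ≃ₗᵢ[ℝ] Space n) (lo hi : Fin (n + 1) → ℝ) : Set (Space n) :=
  {x | ∀ k, lo k ≤ U.symm x k ∧ U.symm x k < hi k}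

/-- The height of `x` in the direction `U e_d`. -/
def height (U : Space n ≃ₗᵢ[ℝ] Space n) (x : Space n) : ℝ := U.symm x (Fin.last n)

/-- The rotated box with lateral side `ρ` and heights in `[a, b)`. -/
def slab (U : Space n ≃ₗᵢ[ℝ] Space n) (a b ρ : ℝ) : Set (Space n) :=
  {x | (∀ k : Fin n, -(ρ / 2) ≤ U.symm x k.castSucc ∧ U.symm x k.castSucc < ρ / 2) ∧
    a ≤ height U x ∧ height U x < b}

theorem slab_eq_rotatedBox (U : Space n ≃ₗᵢ[ℝ] Space n) (a b ρ : ℝ) :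
    slab U a b ρ = rotatedBox U (Fin.snoc (α := fun _ => ℝ) (fun _ => -(ρ / 2)) a)
      (Fin.snoc (α := fun _ => ℝ) (fun _ => ρ / 2) b) := by
  ext x
  simp only [slab, rotatedBox, Set.mem_ofPred_eq, Fin.forall_fin_succ', Fin.snoc_castSucc,
    Fin.snoc_last, height]

theorem rotatedCube_eq_rotatedBox (U : Space n ≃ₗᵢ[ℝ] Space n) (ρ : ℝ) :
    rotatedCube U ρ = rotatedBox U (fun _ => -(ρ / 2)) (fun _ => ρ / 2) := by
  ext x
  constructor
  · rintro ⟨y, hy, rfl⟩ k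
    simpa using hy k
  · intro h
    exact ⟨U.symm x, h, by simp⟩

theorem rotatedCube_eq_slab (U : Space n ≃ₗᵢ[ℝ] Space n) (ρ : ℝ) :
    rotatedCube U ρ = slab U (-(ρ / 2)) (ρ / 2) ρ := by
  ext x
  rw [rotatedCube_eq_rotatedBox]
  simp only [slab, rotatedBox, Set.mem_ofPred_eq, Fin.forall_fin_succ', height]

theorem mem_slab_iff_mem_rotatedCube {U : Space n ≃ₗᵢ[ℝ] Space n} {a b ρ : ℝ} (ha : -(ρ / 2) ≤ a)
    (hb : b ≤ ρ / 2) {x : Space n} :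
    x ∈ slab U a b ρ ↔ x ∈ rotatedCube U ρ ∧ a ≤ height U x ∧ height U x < b := by
  rw [rotatedCube_eq_slab]
  constructor
  · rintro ⟨h, h1, h2⟩
    exact ⟨⟨h, by linarith, by linarith⟩, h1, h2⟩
  · rintro ⟨⟨h, -⟩, h1, h2⟩
    exact ⟨h, h1, h2⟩

theorem abs_coord_le (U : Space n ≃ₗᵢ[ℝ] Space n) (x : Space n) (k : Fin (n + 1)) :
    |U.symm x k| ≤ ‖x‖ := by
  have := PiLp.norm_apply_le (U.symm x) k
  simpa using this

theorem abs_height_le (U : Space n ≃ₗᵢ[ℝ] Space n) (x : Space n) : |height U x| ≤ ‖x‖ :=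
  abs_coord_le U x _

theorem height_add (U : Space n ≃ₗᵢ[ℝ] Space n) (x y : Space n) :
    height U (x + y) = height U x + height U y := by simp [height]

theorem height_sub (U : Space n ≃ₗᵢ[ℝ] Space n) (x y : Space n) :
    height U (x - y) = height U x - height U y := by simp [height]

theorem height_smul (U : Space n ≃ₗᵢ[ℝ] Space n) (r : ℝ) (y : Space n) :
    height U (r • y) = r * height U y := by simp [height]

theorem height_eq_inner {U : Space n ≃ₗᵢ[ℝ] Space n} {ν : Space n}
    (hU : U (lastBasisVector n) = ν) (x : Space n) : height U x = inner ℝ ν x := by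
  rw [← hU, ← U.symm.inner_map_map]
  simp [lastBasisVector, height, EuclideanSpace.inner_single_left]

theorem slab_add_subset {U : Space n ≃ₗᵢ[ℝ] Space n} {a b ρ r : ℝ} {x v : Space n}
    (hx : x ∈ slab U a b ρ) (hv : ‖v‖ ≤ r) :
    x + v ∈ slab U (a + height U v) (b + height U v) (ρ + 2 * r) := by
  refine ⟨fun k => ?_, ?_, ?_⟩
  · have h1 := hx.1 k
    have h2 := abs_le.1 ((abs_coord_le U v k.castSucc).trans hv)
    simp only [map_add, PiLp.add_apply]
    constructor <;> linarith
  · rw [height_add]; linarith [hx.2.1]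
  · rw [height_add]; linarith [hx.2.2]

theorem slab_mono {U : Space n ≃ₗᵢ[ℝ] Space n} {a b ρ a' b' ρ' : ℝ} (ha : a' ≤ a) (hb : b ≤ b')
    (hρ : ρ ≤ ρ') : slab U a b ρ ⊆ slab U a' b' ρ' := by
  rintro x ⟨h, h1, h2⟩
  exact ⟨fun k => ⟨by linarith [(h k).1], by linarith [(h k).2]⟩, by linarith, by linarith⟩

theorem rotatedCube_mono {U : Space n ≃ₗᵢ[ℝ] Space n} {ρ ρ' : ℝ} (h : ρ ≤ ρ') :
    rotatedCube U ρ ⊆ rotatedCube U ρ' := by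
  rw [rotatedCube_eq_slab, rotatedCube_eq_slab]
  exact slab_mono (by linarith) (by linarith) h

theorem mem_rotatedCube_of_dist_le {U : Space n ≃ₗᵢ[ℝ] Space n} {ρ r : ℝ} {x y : Space n}
    (hx : x ∈ rotatedCube U ρ) (h : ‖y - x‖ ≤ r) : y ∈ rotatedCube U (ρ + 2 * r) := by
  rw [rotatedCube_eq_rotatedBox] at hx ⊢
  intro k
  have h1 := hx k
  have h2 := abs_le.1 ((abs_coord_le U (y - x) k).trans h)
  simp only [map_sub, PiLp.sub_apply] at h2
  constructor <;> linarith

/-- The crude factor `n + 1`, in place of its square root, suffices for all error terms. -/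
theorem norm_le_of_mem_rotatedBox {U : Space n ≃ₗᵢ[ℝ] Space n} {lo hi : Fin (n + 1) → ℝ} {r : ℝ}
    (hlo : ∀ k, -r ≤ lo k) (hhi : ∀ k, hi k ≤ r) {x : Space n} (hx : x ∈ rotatedBox U lo hi) :
    ‖x‖ ≤ (n + 1) * r := by
  have hr : ∀ k, |U.symm x k| ≤ r := fun k =>
    abs_le.2 ⟨(hlo k).trans (hx k).1, (hx k).2.le.trans (hhi k)⟩
  have hr0 : 0 ≤ r := (abs_nonneg _).trans (hr 0)
  rw [← U.symm.norm_map, EuclideanSpace.norm_eq]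
  refine Real.sqrt_le_iff.2 ⟨by positivity, ?_⟩
  calc ∑ k, ‖U.symm x k‖ ^ 2 ≤ ∑ _k : Fin (n + 1), r ^ 2 := by
        refine Finset.sum_le_sum fun k _ => ?_
        have := hr k
        rw [Real.norm_eq_abs]
        gcongr
    _ = ((n : ℝ) + 1) * r ^ 2 := by simp
    _ ≤ (((n : ℝ) + 1) * r) ^ 2 := by
        have : (0 : ℝ) ≤ n := by positivity
        nlinarith [mul_nonneg this (sq_nonneg r), mul_nonneg (mul_nonneg this this) (sq_nonneg r)]

theorem isBounded_rotatedBox (U : Space n ≃ₗᵢ[ℝ] Space n) (lo hi : Fin (n + 1) → ℝ) :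
    Bornology.IsBounded (rotatedBox U lo hi) := by
  refine isBounded_iff_forall_norm_le.2 ⟨(n + 1) * ∑ k, (|lo k| + |hi k|), fun x hx => ?_⟩
  have h : ∀ k, |lo k| + |hi k| ≤ ∑ k, (|lo k| + |hi k|) := fun k =>
    Finset.single_le_sum (f := fun k => |lo k| + |hi k|) (fun _ _ => by positivity)
      (Finset.mem_univ k)
  refine norm_le_of_mem_rotatedBox (fun k => ?_) (fun k => ?_) hx
  · linarith [h k, neg_abs_le (lo k), abs_nonneg (hi k)]
  · linarith [h k, le_abs_self (hi k), abs_nonneg (lo k)]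

theorem isBounded_slab (U : Space n ≃ₗᵢ[ℝ] Space n) (a b ρ : ℝ) :
    Bornology.IsBounded (slab U a b ρ) := by
  rw [slab_eq_rotatedBox]
  exact isBounded_rotatedBox _ _ _

theorem isBounded_rotatedCube (U : Space n ≃ₗᵢ[ℝ] Space n) (ρ : ℝ) :
    Bornology.IsBounded (rotatedCube U ρ) := by
  rw [rotatedCube_eq_rotatedBox]
  exact isBounded_rotatedBox _ _ _

theorem rotatedCube_refl (ρ : ℝ) :
    rotatedCube (LinearIsometryEquiv.refl ℝ (Space n)) ρ = cube n ρ := by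
  simp [rotatedCube]

theorem norm_le_of_mem_cube {T : ℝ} {v : Space n} (hv : v ∈ cube n T) :
    ‖v‖ ≤ (n + 1) * T := by
  rw [← rotatedCube_refl, rotatedCube_eq_rotatedBox] at hv
  have hT : 0 ≤ T := by linarith [(hv 0).1, (hv 0).2]
  exact norm_le_of_mem_rotatedBox (fun k => by linarith) (fun k => by linarith) hv

theorem rotatedBox_eq_preimage (U : Space n ≃ₗᵢ[ℝ] Space n) (lo hi : Fin (n + 1) → ℝ) :
    rotatedBox U lo hi = U.symm ⁻¹' ((MeasurableEquiv.toLp 2 (Fin (n + 1) → ℝ)).symm ⁻¹'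
      (Set.univ.pi fun k => Set.Ico (lo k) (hi k))) := by
  ext x
  simp [rotatedBox, Set.mem_pi]

theorem measurableSet_rotatedBox (U : Space n ≃ₗᵢ[ℝ] Space n) (lo hi : Fin (n + 1) → ℝ) :
    MeasurableSet (rotatedBox U lo hi) := by
  rw [rotatedBox_eq_preimage]
  exact ((MeasurableSet.univ_pi fun k => measurableSet_Ico).preimage
    (MeasurableEquiv.measurable _)).preimage U.symm.continuous.measurable

theorem volume_rotatedBox (U : Space n ≃ₗᵢ[ℝ] Space n) (lo hi : Fin (n + 1) → ℝ) :
    MeasureTheory.volume (rotatedBox U lo hi) = ∏ k, ENNReal.ofReal (hi k - lo k) := by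
  have h1 : MeasurableSet (Set.univ.pi fun k => Set.Ico (lo k) (hi k)) :=
    MeasurableSet.univ_pi fun k => measurableSet_Ico
  rw [rotatedBox_eq_preimage, U.symm.measurePreserving.measure_preimage
    (h1.preimage (MeasurableEquiv.measurable _)).nullMeasurableSet,
    (EuclideanSpace.volume_preserving_symm_measurableEquiv_toLp _).measure_preimage
    h1.nullMeasurableSet, Real.volume_pi_Ico]

theorem volume_slab (U : Space n ≃ₗᵢ[ℝ] Space n) {a b ρ : ℝ} (hρ : 0 ≤ ρ) :
    MeasureTheory.volume (slab U a b ρ) = ENNReal.ofReal (ρ ^ n * (b - a)) := by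
  rw [slab_eq_rotatedBox, volume_rotatedBox, Fin.prod_univ_castSucc]
  simp [ENNReal.ofReal_mul (pow_nonneg hρ n), ENNReal.ofReal_pow hρ]

/-! ### Counting lattice points -/

open Classical in
/-- The indices `z` such that `x + T z` lies in the bounded set `A`. -/
def latticePoints (T : ℕ) (A : Set (Space n)) (x : Space n) : Finset (Fin (n + 1) → ℤ) :=
  if h : {z | x + shift T z ∈ A}.Finite then h.toFinset else ∅

theorem finite_latticePoints {T : ℕ} (hT : 0 < T) {A : Set (Space n)} (hA : Bornology.IsBounded A)
    (x : Space n) : {z | x + shift T z ∈ A}.Finite := by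
  obtain ⟨C, hC⟩ := isBounded_iff_forall_norm_le.1 hA
  refine (Set.finite_Icc (fun _ : Fin (n + 1) => -⌈C + ‖x‖⌉) (fun _ => ⌈C + ‖x‖⌉)).subset ?_
  intro z hz
  have h1 : ‖shift T z‖ ≤ C + ‖x‖ := by
    have h2 := hC _ hz
    have h3 := norm_sub_le (x + shift T z) x
    rw [add_sub_cancel_left] at h3
    linarith
  have h2 : ∀ k, |z k| ≤ ⌈C + ‖x‖⌉ := by
    intro k
    have h3 := (PiLp.norm_apply_le (shift T z) k).trans h1
    rw [shift_apply, Real.norm_eq_abs, abs_mul, Nat.abs_cast] at h3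
    have h4 : (1 : ℝ) ≤ T := by exact_mod_cast hT
    have h5 : |(z k : ℝ)| ≤ ⌈C + ‖x‖⌉ := by
      nlinarith [abs_nonneg (z k : ℝ), Int.le_ceil (C + ‖x‖)]
    exact_mod_cast h5
  exact ⟨fun k => (abs_le.1 (h2 k)).1, fun k => (abs_le.1 (h2 k)).2⟩

theorem mem_latticePoints {T : ℕ} (hT : 0 < T) {A : Set (Space n)} (hA : Bornology.IsBounded A)
    {x : Space n} {z : Fin (n + 1) → ℤ} : z ∈ latticePoints T A x ↔ x + shift T z ∈ A := by
  rw [latticePoints, dif_pos (finite_latticePoints hT hA x)]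
  simp

theorem mem_latticePoints_slab {T : ℕ} (hT : 0 < T) {U : Space n ≃ₗᵢ[ℝ] Space n} {a b ρ : ℝ}
    {x : Space n} {z : Fin (n + 1) → ℤ} :
    z ∈ latticePoints T (slab U a b ρ) x ↔ x + shift T z ∈ slab U a b ρ :=
  mem_latticePoints hT (isBounded_slab U a b ρ)

theorem mem_latticePoints_rotatedCube {T : ℕ} (hT : 0 < T) {U : Space n ≃ₗᵢ[ℝ] Space n} {ρ : ℝ}
    {x : Space n} {z : Fin (n + 1) → ℤ} :
    z ∈ latticePoints T (rotatedCube U ρ) x ↔ x + shift T z ∈ rotatedCube U ρ :=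
  mem_latticePoints hT (isBounded_rotatedCube U ρ)

/-- The number of points of `x + T ℤ^d` in the slab. -/
def slabCount (T : ℕ) (U : Space n ≃ₗᵢ[ℝ] Space n) (x : Space n) (a b ρ : ℝ) : ℝ :=
  (latticePoints T (slab U a b ρ) x).card

theorem slabCount_nonneg (T : ℕ) (U : Space n ≃ₗᵢ[ℝ] Space n) (x : Space n) (a b ρ : ℝ) :
    0 ≤ slabCount T U x a b ρ := Nat.cast_nonneg _

/-- The translate of the cell of side `T` based at `x + T z`. -/
def latticeCell (T : ℕ) (x : Space n) (z : Fin (n + 1) → ℤ) : Set (Space n) :=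
  {y | y - x - shift T z ∈ cube n T}

theorem measurableSet_latticeCell (T : ℕ) (x : Space n) (z : Fin (n + 1) → ℤ) :
    MeasurableSet (latticeCell T x z) := by
  have h : MeasurableSet (cube n T) := by
    rw [← rotatedCube_refl, rotatedCube_eq_rotatedBox]
    exact measurableSet_rotatedBox _ _ _
  exact h.preimage (by fun_prop : Measurable fun y : Space n => y - x - shift T z)

theorem volume_latticeCell (T : ℕ) (x : Space n) (z : Fin (n + 1) → ℤ) :
    MeasureTheory.volume (latticeCell T x z) = ENNReal.ofReal ((T : ℝ) ^ (n + 1)) := by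
  have h : MeasurableSet (cube n T) := by
    rw [← rotatedCube_refl, rotatedCube_eq_rotatedBox]
    exact measurableSet_rotatedBox _ _ _
  have h1 : latticeCell T x z = (fun y => y + (-x - shift T z)) ⁻¹' cube n T := by
    ext y
    simp only [latticeCell, Set.mem_ofPred_eq, Set.mem_preimage]
    rw [show y - x - shift T z = y + (-x - shift T z) by abel]
  rw [h1, (MeasureTheory.measurePreserving_add_right _ _).measure_preimage h.nullMeasurableSet,
    ← rotatedCube_refl, rotatedCube_eq_rotatedBox, volume_rotatedBox]
  simp [ENNReal.ofReal_pow]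

/-- The cells based at the counted points are disjoint, have volume `T^d`, and lie in the slab
enlarged by the cell radius bound `(n + 1) T` on every side. -/
theorem slabCount_le {T : ℕ} (hT : 0 < T) (U : Space n ≃ₗᵢ[ℝ] Space n) (x : Space n)
    {a b ρ : ℝ} (hab : a ≤ b) (hρ : 0 ≤ ρ) :
    slabCount T U x a b ρ * (T : ℝ) ^ (n + 1) ≤
      (ρ + 2 * ((n + 1) * T)) ^ n * (b - a + 2 * ((n + 1) * T)) := by
  set K : ℝ := (n + 1) * T with hK
  have hK0 : 0 ≤ K := by positivity
  set Z := latticePoints T (slab U a b ρ) x with hZ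
  have hsub : (⋃ z ∈ Z, latticeCell T x z) ⊆ slab U (a - K) (b + K) (ρ + 2 * K) := by
    intro y hy
    obtain ⟨z, hz, hy⟩ := Set.mem_iUnion₂.1 hy
    have h1 := (mem_latticePoints_slab hT).1 hz
    have hv : ‖y - x - shift T z‖ ≤ K := norm_le_of_mem_cube hy
    have h2 := slab_add_subset h1 hv
    rw [show x + shift T z + (y - x - shift T z) = y by abel] at h2
    have h3 := abs_le.1 ((abs_height_le U _).trans hv)
    exact slab_mono (by linarith) (by linarith) le_rfl h2
  have hdisj : (Z : Set (Fin (n + 1) → ℤ)).PairwiseDisjoint (latticeCell T x) := by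
    intro z _ w _ hzw
    refine Set.disjoint_left.2 fun y hy hy' => hzw ?_
    rw [(sub_shift_mem_cube_iff hT _ _).1 hy, (sub_shift_mem_cube_iff hT _ _).1 hy']
  have hvol := MeasureTheory.measure_mono (μ := MeasureTheory.volume) hsub
  rw [MeasureTheory.measure_biUnion_finset hdisj fun z _ => measurableSet_latticeCell T x z,
    volume_slab U (by positivity), Finset.sum_congr rfl fun z _ => volume_latticeCell T x z,
    Finset.sum_const, nsmul_eq_mul, ← ENNReal.ofReal_natCast,
    ← ENNReal.ofReal_mul (Nat.cast_nonneg _)] at hvol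
  have h0 : 0 ≤ b + K - (a - K) := by linarith
  have := (ENNReal.ofReal_le_ofReal_iff (by positivity)).1 hvol
  calc _ ≤ _ := this
    _ = _ := by ring

/-- Dual to the upper bound: the cells based at the counted points cover the slab shrunk by `(n + 1)
T` on every side. -/
theorem le_slabCount {T : ℕ} (hT : 0 < T) (U : Space n ≃ₗᵢ[ℝ] Space n) (x : Space n)
    {a b ρ : ℝ} (hρ : 2 * ((n + 1) * T) ≤ ρ) :
    (ρ - 2 * ((n + 1) * T)) ^ n * (b - a - 2 * ((n + 1) * T)) ≤
      slabCount T U x a b ρ * (T : ℝ) ^ (n + 1) := by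
  set K : ℝ := (n + 1) * T with hK
  have hK0 : 0 ≤ K := by positivity
  set Z := latticePoints T (slab U a b ρ) x with hZ
  have hsub : slab U (a + K) (b - K) (ρ - 2 * K) ⊆ ⋃ z ∈ Z, latticeCell T x z := by
    intro y hy
    have hc := sub_shift_cellIndex_mem hT (y - x)
    set z := cellIndex T (y - x) with hz
    have hv : ‖-(y - x - shift T z)‖ ≤ K := by
      rw [norm_neg]
      exact norm_le_of_mem_cube hc
    have h2 := slab_add_subset hy hv
    rw [show y + -(y - x - shift T z) = x + shift T z by abel] at h2
    have h3 := abs_le.1 ((abs_height_le U _).trans hv)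
    exact Set.mem_iUnion₂.2 ⟨z, (mem_latticePoints_slab hT).2
      (slab_mono (by linarith) (by linarith) (by linarith) h2), hc⟩
  have hvol := (MeasureTheory.measure_mono (μ := MeasureTheory.volume) hsub).trans
    (MeasureTheory.measure_biUnion_finset_le _ _)
  rw [volume_slab U (by linarith), Finset.sum_congr rfl fun z _ => volume_latticeCell T x z,
    Finset.sum_const, nsmul_eq_mul, ← ENNReal.ofReal_natCast,
    ← ENNReal.ofReal_mul (Nat.cast_nonneg _)] at hvol
  -- The shrunk thickness may be negative; comparing through `ENNReal.ofReal` needs only the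
  -- right-hand side to be nonnegative.
  have := (ENNReal.ofReal_le_ofReal_iff (by positivity)).1 hvol
  calc _ = _ := by ring
    _ ≤ _ := this

end LatticeEnergy

namespace LatticeEnergy

variable {n : ℕ}

/-! ### Asymptotic density of lattice points in slabs -/

/-- A lattice translation permutes the points `x + T ℤ^d`; its lateral component is absorbed by
widening the slab. -/
theorem slabCount_le_slabCount_shift {T : ℕ} (hT : 0 < T) (U : Space n ≃ₗᵢ[ℝ] Space n)
    (x : Space n) (a b ρ : ℝ) (w : Fin (n + 1) → ℤ) :
    slabCount T U x a b ρ ≤ slabCount T U x (a + height U (shift T w))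
      (b + height U (shift T w)) (ρ + 2 * ‖shift T w‖) := by
  unfold slabCount
  refine Nat.cast_le.2 (Finset.card_le_card_of_injOn (fun z => z + w) ?_ ?_)
  · intro z hz
    have h1 := slab_add_subset ((mem_latticePoints_slab hT).1 hz) (le_refl ‖shift T w‖)
    refine (mem_latticePoints_slab hT).2 ?_
    rwa [shift_add, ← add_assoc]
  · intro z _ z' _ h
    exact add_right_cancel h

theorem slabCount_mono {T : ℕ} (hT : 0 < T) (U : Space n ≃ₗᵢ[ℝ] Space n) (x : Space n)
    {a b ρ a' b' ρ' : ℝ} (ha : a' ≤ a) (hb : b ≤ b') (hρ : ρ ≤ ρ') :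
    slabCount T U x a b ρ ≤ slabCount T U x a' b' ρ' := by
  unfold slabCount
  refine Nat.cast_le.2 (Finset.card_le_card fun z hz => ?_)
  exact (mem_latticePoints_slab hT).2 (slab_mono ha hb hρ ((mem_latticePoints_slab hT).1 hz))

theorem slabCount_eq_zero {T : ℕ} (hT : 0 < T) (U : Space n ≃ₗᵢ[ℝ] Space n) (x : Space n)
    {a b ρ : ℝ} (hab : b ≤ a) : slabCount T U x a b ρ = 0 := by
  unfold slabCount
  rw [Nat.cast_eq_zero, Finset.card_eq_zero, Finset.eq_empty_iff_forall_notMem]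
  intro z hz
  have := ((mem_latticePoints_slab hT).1 hz).2
  linarith [this.1, this.2]

theorem mem_Ioc_floor_iff {s a b h : ℝ} (hs : 0 < s) (j : ℤ) :
    j ∈ Finset.Ioc ⌊(h - b) / s⌋ ⌊(h - a) / s⌋ ↔ a + j * s ≤ h ∧ h < b + j * s := by
  rw [Finset.mem_Ioc, Int.floor_lt, Int.le_floor, div_lt_iff₀ hs, le_div_iff₀ hs]
  constructor <;> rintro ⟨h1, h2⟩ <;> constructor <;> linarith

theorem card_Ioc_floor {s a b h : ℝ} (hs : 0 < s) (hab : a ≤ b) :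
    ((Finset.Ioc ⌊(h - b) / s⌋ ⌊(h - a) / s⌋).card : ℝ) =
      (⌊(h - a) / s⌋ : ℝ) - ⌊(h - b) / s⌋ := by
  have h1 : ⌊(h - b) / s⌋ ≤ ⌊(h - a) / s⌋ := by
    gcongr
  have h2 : ((Finset.Ioc ⌊(h - b) / s⌋ ⌊(h - a) / s⌋).card : ℤ) =
      ⌊(h - a) / s⌋ - ⌊(h - b) / s⌋ := by
    rw [Int.card_Ioc, Int.toNat_of_nonneg (by linarith)]
  exact_mod_cast h2

open Classical in
/-- The translates of the slab `[a, b)` by `0, s, …, (M - 1) s` that contain a given height. -/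
def slabTranslates (s a b h : ℝ) (M : ℕ) : Finset ℕ :=
  (Finset.range M).filter fun j => a + j * s ≤ h ∧ h < b + j * s

theorem card_slabTranslates_le {s a b h : ℝ} (hs : 0 < s) (hab : a ≤ b) (M : ℕ) :
    ((slabTranslates s a b h M).card : ℝ) ≤ (⌊(h - a) / s⌋ : ℝ) - ⌊(h - b) / s⌋ := by
  rw [← card_Ioc_floor hs hab]
  refine Nat.cast_le.2 (Finset.card_le_card_of_injOn (fun j : ℕ => (j : ℤ)) ?_ ?_)
  · intro j hj
    have := (Finset.mem_filter.1 hj).2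
    exact (mem_Ioc_floor_iff hs _).2 (by simpa using this)
  · intro i _ j _ hij
    exact Nat.cast_injective hij

/-- For heights in `[b, a + M s)` no translate is lost at either end: every integer index whose
interval contains `h` already lies between `0` and `M`. -/
theorem le_card_slabTranslates {s a b h : ℝ} (hs : 0 < s) (hab : a ≤ b) {M : ℕ} (h1 : b ≤ h)
    (h2 : h < a + M * s) :
    (⌊(h - a) / s⌋ : ℝ) - ⌊(h - b) / s⌋ ≤ ((slabTranslates s a b h M).card : ℝ) := by
  have key : ∀ j ∈ Finset.Ioc ⌊(h - b) / s⌋ ⌊(h - a) / s⌋, 0 ≤ j ∧ j < M := by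
    intro j hj
    have h3 := (mem_Ioc_floor_iff hs j).1 hj
    constructor
    · have : (0 : ℝ) < j := by
        by_contra hneg
        nlinarith [h3.2]
      exact_mod_cast this.le
    · have : (j : ℝ) < M := by
        by_contra hneg
        push Not at hneg
        nlinarith [h3.1]
      exact_mod_cast this
  rw [← card_Ioc_floor hs hab]
  refine Nat.cast_le.2 (Finset.card_le_card_of_injOn Int.toNat ?_ ?_)
  · intro j hj
    obtain ⟨h4, h5⟩ := key j hj
    have h6 : ((j.toNat : ℕ) : ℝ) = (j : ℝ) := by
      exact_mod_cast Int.toNat_of_nonneg h4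
    refine Finset.mem_coe.2 (Finset.mem_filter.2 ⟨Finset.mem_range.2 (by omega), ?_⟩)
    rw [h6]
    exact (mem_Ioc_floor_iff hs j).1 hj
  · intro i hi j hj hij
    have := (key i hi).1
    have := (key j hj).1
    omega

open Classical in
theorem sum_slabCount_eq {T : ℕ} (hT : 0 < T) (U : Space n ≃ₗᵢ[ℝ] Space n) (x : Space n)
    {a b ρ s : ℝ} (hs : 0 < s) (M : ℕ) :
    ∑ j ∈ Finset.range M, slabCount T U x (a + j * s) (b + j * s) ρ =
      ∑ z ∈ latticePoints T (slab U a (b + M * s) ρ) x,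
        ((slabTranslates s a b (height U (x + shift T z)) M).card : ℝ) := by
  have h1 : ∀ j ∈ Finset.range M, slabCount T U x (a + j * s) (b + j * s) ρ =
      ∑ z ∈ latticePoints T (slab U a (b + M * s) ρ) x,
        if a + j * s ≤ height U (x + shift T z) ∧ height U (x + shift T z) < b + j * s
          then (1 : ℝ) else 0 := by
    intro j hj
    have hj' : (j : ℝ) * s ≤ M * s := by
      have : (j : ℝ) ≤ M := by exact_mod_cast (Finset.mem_range.1 hj).le
      gcongr
    have hj0 : 0 ≤ (j : ℝ) * s := by positivity
    rw [Finset.sum_boole, slabCount]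
    congr 2
    ext z
    rw [Finset.mem_filter, mem_latticePoints_slab hT, mem_latticePoints_slab hT]
    constructor
    · intro h
      exact ⟨slab_mono (by linarith) (by linarith) le_rfl h, h.2⟩
    · rintro ⟨h, h'⟩
      exact ⟨h.1, h'⟩
  rw [Finset.sum_congr rfl h1, Finset.sum_comm]
  refine Finset.sum_congr rfl fun z _ => ?_
  rw [Finset.sum_boole, slabTranslates]

/-- Averaging reduces thin slabs to thick ones. The `M` translates by multiples of `w` hold at least
as many points each, once widened, and cover any point of the thick slab at most `m` times. -/
theorem mul_slabCount_le {T : ℕ} (hT : 0 < T) (U : Space n ≃ₗᵢ[ℝ] Space n) (x : Space n)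
    {a b ρ m : ℝ} (hab : a ≤ b) (w : Fin (n + 1) → ℤ) (hs : 0 < height U (shift T w))
    (hm : ∀ z, (⌊(height U (x + shift T z) - a) / height U (shift T w)⌋ : ℝ) -
      ⌊(height U (x + shift T z) - b) / height U (shift T w)⌋ ≤ m) (M : ℕ) :
    M * slabCount T U x a b ρ ≤ m * slabCount T U x a (b + M * height U (shift T w))
      (ρ + 2 * (M * ‖shift T w‖)) := by
  set s := height U (shift T w) with hsdef
  calc M * slabCount T U x a b ρ = ∑ j ∈ Finset.range M, slabCount T U x a b ρ := by simp
    _ ≤ ∑ j ∈ Finset.range M, slabCount T U x (a + j * s) (b + j * s)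
          (ρ + 2 * (M * ‖shift T w‖)) := by
        refine Finset.sum_le_sum fun j hj => ?_
        have h1 := slabCount_le_slabCount_shift hT U x a b ρ (j • w)
        rw [shift_nsmul, height_smul, ← hsdef, norm_smul, Real.norm_eq_abs, Nat.abs_cast] at h1
        refine h1.trans (slabCount_mono hT U x le_rfl le_rfl ?_)
        have : (j : ℝ) ≤ M := by exact_mod_cast (Finset.mem_range.1 hj).le
        gcongr
    _ ≤ _ := by
        rw [sum_slabCount_eq hT U x hs M]
        calc _ ≤ ∑ z ∈ latticePoints T (slab U a (b + M * s) (ρ + 2 * (M * ‖shift T w‖))) x, m :=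
              Finset.sum_le_sum fun z _ => (card_slabTranslates_le hs hab M).trans (hm z)
          _ = _ := by rw [Finset.sum_const, nsmul_eq_mul, mul_comm, slabCount]

/-- The reverse averaging: points with heights in `[b, a + M s)` are covered at least `m` times, and
each translate is moved back into the original, wider slab. -/
theorem le_mul_slabCount {T : ℕ} (hT : 0 < T) (U : Space n ≃ₗᵢ[ℝ] Space n) (x : Space n)
    {a b ρ m : ℝ} (hab : a ≤ b) (w : Fin (n + 1) → ℤ) (hs : 0 < height U (shift T w))
    (hm : ∀ z, m ≤ (⌊(height U (x + shift T z) - a) / height U (shift T w)⌋ : ℝ) -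
      ⌊(height U (x + shift T z) - b) / height U (shift T w)⌋) (M : ℕ) :
    m * slabCount T U x b (a + M * height U (shift T w)) (ρ - 2 * (M * ‖shift T w‖)) ≤
      M * slabCount T U x a b ρ := by
  set s := height U (shift T w) with hsdef
  set r := ρ - 2 * (M * ‖shift T w‖) with hr
  calc m * slabCount T U x b (a + M * s) r
      ≤ ∑ j ∈ Finset.range M, slabCount T U x (a + j * s) (b + j * s) r := by
        rw [sum_slabCount_eq hT U x hs M]
        calc _ = ∑ z ∈ latticePoints T (slab U b (a + M * s) r) x, m := by
              rw [Finset.sum_const, nsmul_eq_mul, mul_comm, slabCount]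
          _ ≤ ∑ z ∈ latticePoints T (slab U b (a + M * s) r) x,
              ((slabTranslates s a b (height U (x + shift T z)) M).card : ℝ) := by
              refine Finset.sum_le_sum fun z hz => (hm z).trans ?_
              have := ((mem_latticePoints_slab hT).1 hz).2
              exact le_card_slabTranslates hs hab this.1 this.2
          _ ≤ _ := by
              refine Finset.sum_le_sum_of_subset_of_nonneg (fun z hz => ?_)
                fun _ _ _ => Nat.cast_nonneg _
              exact (mem_latticePoints_slab hT).2
                (slab_mono hab (by linarith) le_rfl ((mem_latticePoints_slab hT).1 hz))
    _ ≤ ∑ j ∈ Finset.range M, slabCount T U x a b ρ := by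
        refine Finset.sum_le_sum fun j hj => ?_
        have h1 := slabCount_le_slabCount_shift hT U x (a + j * s) (b + j * s) r (-(j • w))
        rw [shift_neg, shift_nsmul, norm_neg, ← zero_sub, height_sub, height_smul, ← hsdef,
          norm_smul, Real.norm_eq_abs, Nat.abs_cast] at h1
        have h0 : height U (0 : Space n) = 0 := by simp [height]
        refine h1.trans (slabCount_mono hT U x (by rw [h0]; linarith) (by rw [h0]; linarith) ?_)
        have : (j : ℝ) * ‖shift T w‖ ≤ M * ‖shift T w‖ := by
          have : (j : ℝ) ≤ M := by exact_mod_cast (Finset.mem_range.1 hj).le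
          gcongr
        rw [hr]
        linarith
    _ = _ := by simp

theorem tendsto_affine_pow_div_pow (l k : ℝ) (n : ℕ) :
    Filter.Tendsto (fun ρ : ℝ => (l * ρ + k) ^ n / ρ ^ n) Filter.atTop (𝓝 (l ^ n)) := by
  have h1 : Filter.Tendsto (fun ρ : ℝ => (l + k * ρ⁻¹) ^ n) Filter.atTop (𝓝 ((l + k * 0) ^ n)) :=
    ((tendsto_inv_atTop_zero.const_mul k).const_add l).pow n
  rw [mul_zero, add_zero] at h1
  refine h1.congr' ?_
  filter_upwards [Filter.eventually_gt_atTop 0] with ρ hρ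
  rw [← div_pow]
  congr 1
  field_simp

/-- Per unit area the thick slab holds at most `(M s + O(1)) / T^d` points; multiplying by `m / M`
leaves `m s / T^d` up to `O(1/M)`. -/
theorem eventually_slabCount_le {T : ℕ} (hT : 0 < T) (U : Space n ≃ₗᵢ[ℝ] Space n) (x : Space n)
    {a b m ε : ℝ} (hε : 0 < ε) (hab : a ≤ b) (w : Fin (n + 1) → ℤ)
    (hs : 0 < height U (shift T w))
    (hm : ∀ z, (⌊(height U (x + shift T z) - a) / height U (shift T w)⌋ : ℝ) -
      ⌊(height U (x + shift T z) - b) / height U (shift T w)⌋ ≤ m) :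
    ∀ᶠ ρ in Filter.atTop, slabCount T U x a b ρ / ρ ^ n ≤
      m * height U (shift T w) / (T : ℝ) ^ (n + 1) + ε := by
  set s := height U (shift T w) with hsdef
  set K : ℝ := (n + 1) * T with hK
  set D : ℝ := (T : ℝ) ^ (n + 1) with hD
  have hD0 : 0 < D := by positivity
  have hm0 : 0 ≤ m := (sub_nonneg.2 (by
    have : ⌊(height U (x + shift T 0) - b) / s⌋ ≤ ⌊(height U (x + shift T 0) - a) / s⌋ := by
      gcongr
    exact_mod_cast this)).trans (hm 0)
  -- This choice makes the remainder `m (b - a + 2 K) / (D M)` smaller than `ε`.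
  obtain ⟨M, hM⟩ := exists_nat_gt (max 1 (m * (b - a + 2 * K) / D / ε))
  have hM1 : (1 : ℝ) < M := (le_max_left _ _).trans_lt hM
  have hM2 : m * (b - a + 2 * K) / D / ε < M := (le_max_right _ _).trans_lt hM
  have hM0 : (0 : ℝ) < M := by linarith
  have hlim := (tendsto_affine_pow_div_pow 1 (2 * (M * ‖shift T w‖) + 2 * K) n).const_mul
    (m * (b + M * s - a + 2 * K) / (M * D))
  have hlt : m * (b + M * s - a + 2 * K) / (M * D) * 1 ^ n < m * s / D + ε := by
    rw [div_lt_iff₀ hε] at hM2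
    have : m * (b + M * s - a + 2 * K) / (M * D) * 1 ^ n =
        m * s / D + (m * (b - a + 2 * K) / D) / M := by
      rw [one_pow]
      field_simp
      ring
    rw [this]
    have : (m * (b - a + 2 * K) / D) / M < ε := by
      rw [div_lt_iff₀ hM0]
      linarith
    linarith
  filter_upwards [hlim.eventually_lt_const hlt, Filter.eventually_gt_atTop 0] with ρ h1 hρ
  refine le_trans ?_ h1.le
  have h2 := mul_slabCount_le (ρ := ρ) hT U x hab w hs hm M
  have h3 := slabCount_le hT U x (a := a) (b := b + M * s) (ρ := ρ + 2 * (M * ‖shift T w‖))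
    (by nlinarith) (by positivity)
  rw [← hsdef] at h2
  rw [← hK, ← hD] at h3
  have hρn : 0 < ρ ^ n := by positivity
  rw [div_mul_div_comm, div_le_div_iff₀ hρn (by positivity)]
  have h4 : slabCount T U x a b ρ * (M * D) ≤ m * (b + M * s - a + 2 * K) *
      (1 * ρ + (2 * (M * ‖shift T w‖) + 2 * K)) ^ n := by
    calc slabCount T U x a b ρ * (M * D) = (M * slabCount T U x a b ρ) * D := by ring
      _ ≤ (m * slabCount T U x a (b + M * s) (ρ + 2 * (M * ‖shift T w‖))) * D := by gcongr
      _ = m * (slabCount T U x a (b + M * s) (ρ + 2 * (M * ‖shift T w‖)) * D) := by ring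
      _ ≤ m * ((ρ + 2 * (M * ‖shift T w‖) + 2 * K) ^ n * (b + M * s - a + 2 * K)) := by gcongr
      _ = _ := by ring
  calc _ = slabCount T U x a b ρ * (M * D) * ρ ^ n := by ring
    _ ≤ _ := by gcongr

theorem eventually_le_slabCount {T : ℕ} (hT : 0 < T) (U : Space n ≃ₗᵢ[ℝ] Space n) (x : Space n)
    {a b m ε : ℝ} (hε : 0 < ε) (hab : a ≤ b) (hm0 : 0 ≤ m) (w : Fin (n + 1) → ℤ)
    (hs : 0 < height U (shift T w))
    (hm : ∀ z, m ≤ (⌊(height U (x + shift T z) - a) / height U (shift T w)⌋ : ℝ) -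
      ⌊(height U (x + shift T z) - b) / height U (shift T w)⌋) :
    ∀ᶠ ρ in Filter.atTop, m * height U (shift T w) / (T : ℝ) ^ (n + 1) - ε ≤
      slabCount T U x a b ρ / ρ ^ n := by
  set s := height U (shift T w) with hsdef
  set K : ℝ := (n + 1) * T with hK
  set D : ℝ := (T : ℝ) ^ (n + 1) with hD
  have hD0 : 0 < D := by positivity
  obtain ⟨M, hM⟩ := exists_nat_gt (max 1 (m * (b - a + 2 * K) / D / ε))
  have hM1 : (1 : ℝ) < M := (le_max_left _ _).trans_lt hM
  have hM2 : m * (b - a + 2 * K) / D / ε < M := (le_max_right _ _).trans_lt hM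
  have hM0 : (0 : ℝ) < M := by linarith
  have hlim := (tendsto_affine_pow_div_pow 1 (-(2 * (M * ‖shift T w‖) + 2 * K)) n).const_mul
    (m * (a + M * s - b - 2 * K) / (M * D))
  have hlt : m * s / D - ε < m * (a + M * s - b - 2 * K) / (M * D) * 1 ^ n := by
    rw [div_lt_iff₀ hε] at hM2
    have : m * (a + M * s - b - 2 * K) / (M * D) * 1 ^ n =
        m * s / D - (m * (b - a + 2 * K) / D) / M := by
      rw [one_pow]
      field_simp
      ring
    rw [this]
    have : (m * (b - a + 2 * K) / D) / M < ε := by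
      rw [div_lt_iff₀ hM0]
      linarith
    linarith
  filter_upwards [hlim.eventually_const_lt hlt, Filter.eventually_gt_atTop 0,
    Filter.eventually_ge_atTop (2 * (M * ‖shift T w‖) + 2 * K)] with ρ h1 hρ hρ'
  refine h1.le.trans ?_
  have h2 := le_mul_slabCount (ρ := ρ) hT U x hab w hs hm M
  have h3 := le_slabCount hT U x (a := b) (b := a + M * s) (ρ := ρ - 2 * (M * ‖shift T w‖))
    (by rw [← hK]; linarith)
  rw [← hsdef] at h2
  rw [← hK, ← hD] at h3
  have hρn : 0 < ρ ^ n := by positivity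
  rw [div_mul_div_comm, div_le_div_iff₀ (by positivity) hρn]
  have h4 : m * (a + M * s - b - 2 * K) * (1 * ρ + -(2 * (M * ‖shift T w‖) + 2 * K)) ^ n ≤
      slabCount T U x a b ρ * (M * D) := by
    calc _ = m * ((ρ - 2 * (M * ‖shift T w‖) - 2 * K) ^ n * (a + M * s - b - 2 * K)) := by ring
      _ ≤ m * (slabCount T U x b (a + M * s) (ρ - 2 * (M * ‖shift T w‖)) * D) := by gcongr
      _ = (m * slabCount T U x b (a + M * s) (ρ - 2 * (M * ‖shift T w‖))) * D := by ring
      _ ≤ (M * slabCount T U x a b ρ) * D := by gcongr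
      _ = _ := by ring
  calc _ ≤ slabCount T U x a b ρ * (M * D) * ρ ^ n := by gcongr
    _ = _ := by ring

theorem exists_tendsto_of_eventually_close {f : ℝ → ℝ}
    (h : ∀ ε > 0, ∃ l, ∀ᶠ ρ in Filter.atTop, |f ρ - l| ≤ ε) :
    ∃ l, Filter.Tendsto f Filter.atTop (𝓝 l) := by
  refine cauchySeq_tendsto_of_complete (Metric.cauchySeq_iff.2 fun ε hε => ?_)
  obtain ⟨l, hl⟩ := h (ε / 3) (by positivity)
  obtain ⟨N, hN⟩ := Filter.eventually_atTop.1 hl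
  refine ⟨N, fun p hp q hq => ?_⟩
  have h1 := abs_le.1 (hN p hp)
  have h2 := abs_le.1 (hN q hq)
  rw [Real.dist_eq, abs_lt]
  constructor <;> linarith [h1.1, h1.2, h2.1, h2.2]

/-- The group of heights of the lattice translations. -/
def heightGroup (T : ℕ) (U : Space n ≃ₗᵢ[ℝ] Space n) : AddSubgroup ℝ :=
  (AddMonoidHom.mk' (fun z : Fin (n + 1) → ℤ => height U (shift T z)) fun z w => by
    simp only [shift_add, height_add]).range

theorem mem_heightGroup {T : ℕ} {U : Space n ≃ₗᵢ[ℝ] Space n} {r : ℝ} :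
    r ∈ heightGroup T U ↔ ∃ z, height U (shift T z) = r := Iff.rfl

/-- The thickness and side are chosen so that the volume bound is `1`, which forces a lattice point
at height at least `1`. -/
theorem exists_pos_height {T : ℕ} (hT : 0 < T) (U : Space n ≃ₗᵢ[ℝ] Space n) :
    ∃ z, 0 < height U (shift T z) := by
  have h := le_slabCount hT U 0 (a := 1) (b := 2 + 2 * ((n + 1) * T))
    (ρ := 1 + 2 * ((n + 1) * T)) (by linarith)
  have h1 : (0 : ℝ) < slabCount T U 0 1 (2 + 2 * ((n + 1) * T)) (1 + 2 * ((n + 1) * T)) := by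
    by_contra h0
    have h2 := le_antisymm (not_lt.1 h0) (slabCount_nonneg T U _ _ _ _)
    rw [h2] at h
    ring_nf at h
    norm_num at h
  rw [slabCount, Nat.cast_pos, Finset.card_pos] at h1
  obtain ⟨z, hz⟩ := h1
  have := ((mem_latticePoints_slab hT).1 hz).2.1
  rw [zero_add] at this
  exact ⟨z, by linarith⟩

/-- The heights of the lattice form a subgroup of `ℝ`. If it is dense, translations of arbitrarily
small height `s` exist; the covering multiplicity is `(b - a) / s ± 1`, so the density is `(b - a) /
T^d`. If it is cyclic, a translation by a generator gives a multiplicity that is the same at every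
point, hence an exact density. -/
theorem exists_tendsto_slabCount {T : ℕ} (hT : 0 < T) (U : Space n ≃ₗᵢ[ℝ] Space n) (x : Space n)
    (a b : ℝ) : ∃ l, Filter.Tendsto (fun ρ => slabCount T U x a b ρ / ρ ^ n) Filter.atTop (𝓝 l) := by
  rcases le_or_gt b a with hba | hab
  · refine ⟨0, ?_⟩
    simp [slabCount_eq_zero hT U x hba]
  have hT1 : (1 : ℝ) ≤ (T : ℝ) ^ (n + 1) := one_le_pow₀ (by exact_mod_cast hT)
  refine exists_tendsto_of_eventually_close fun ε hε => ?_
  rcases AddSubgroup.dense_or_cyclic (heightGroup T U) with hdense | ⟨g, hg⟩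
  -- The bound `ε / 2` controls the error `s / T^d ≤ s`; the bound `b - a` keeps the lower
  -- multiplicity `(b - a) / s - 1` nonnegative.
  · obtain ⟨s, ⟨w, hw⟩, hs0, hs1⟩ := hdense.exists_between
      (show (0 : ℝ) < min (ε / 2) (b - a) by exact lt_min (by positivity) (by linarith))
    replace hw : height U (shift T w) = s := hw
    have hs2 := hs1.trans_le (min_le_left _ _)
    have hs3 := hs1.trans_le (min_le_right _ _)
    refine ⟨(b - a) / (T : ℝ) ^ (n + 1), ?_⟩
    have e1 : ∀ z, (height U (x + shift T z) - a) / s =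
        (height U (x + shift T z) - b) / s + (b - a) / s := fun z => by
      field_simp
      ring
    have hle : s / (T : ℝ) ^ (n + 1) ≤ ε / 2 := (div_le_self hs0.le hT1).trans hs2.le
    filter_upwards [eventually_slabCount_le hT U x (m := (b - a) / s + 1) (half_pos hε) hab.le w
        (by rw [hw]; exact hs0) (fun z => by
          rw [hw]
          have h1 := Int.floor_le ((height U (x + shift T z) - a) / s)
          have h2 := Int.lt_floor_add_one ((height U (x + shift T z) - b) / s)
          linarith [e1 z]),
      eventually_le_slabCount hT U x (m := (b - a) / s - 1) (half_pos hε) hab.le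
        (by rw [sub_nonneg, le_div_iff₀ hs0]; linarith) w
        (by rw [hw]; exact hs0) (fun z => by
          rw [hw]
          have h1 := Int.lt_floor_add_one ((height U (x + shift T z) - a) / s)
          have h2 := Int.floor_le ((height U (x + shift T z) - b) / s)
          linarith [e1 z])] with ρ h1 h2
    rw [hw] at h1 h2
    have e2 : ((b - a) / s + 1) * s / (T : ℝ) ^ (n + 1) =
        (b - a) / (T : ℝ) ^ (n + 1) + s / (T : ℝ) ^ (n + 1) := by
      field_simp
    have e3 : ((b - a) / s - 1) * s / (T : ℝ) ^ (n + 1) =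
        (b - a) / (T : ℝ) ^ (n + 1) - s / (T : ℝ) ^ (n + 1) := by
      field_simp
    rw [abs_le]
    constructor <;> linarith
  · obtain ⟨z₀, hz₀⟩ := exists_pos_height hT U
    have hmem : ∀ z, ∃ j : ℤ, height U (shift T z) = j * |g| := by
      intro z
      have : height U (shift T z) ∈ heightGroup T U := ⟨z, rfl⟩
      rw [hg, AddSubgroup.mem_closure_singleton] at this
      obtain ⟨j, hj⟩ := this
      rw [zsmul_eq_mul] at hj
      rcases abs_choice g with h | h
      · exact ⟨j, by rw [h, hj]⟩
      · exact ⟨-j, by rw [h, ← hj]; push_cast; ring⟩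
    have hg0 : 0 < |g| := by
      rw [abs_pos]
      rintro rfl
      obtain ⟨j, hj⟩ := hmem z₀
      simp at hj
      linarith
    obtain ⟨w, hw⟩ : ∃ w, height U (shift T w) = |g| := by
      rw [← mem_heightGroup, abs_mem_iff, hg]
      exact AddSubgroup.mem_closure_singleton_self g
    -- A translation changes both quotients by the same integer, so the difference of the floors
    -- does not depend on `z`.
    have hconst : ∀ z, (⌊(height U (x + shift T z) - a) / |g|⌋ : ℝ) -
        ⌊(height U (x + shift T z) - b) / |g|⌋ =
        (⌊(height U x - a) / |g|⌋ : ℝ) - ⌊(height U x - b) / |g|⌋ := by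
      intro z
      obtain ⟨j, hj⟩ := hmem z
      have e : ∀ r, (height U (x + shift T z) - r) / |g| = (height U x - r) / |g| + j := by
        intro r
        rw [height_add, hj]
        field_simp
        ring
      rw [e, e, Int.floor_add_intCast, Int.floor_add_intCast]
      push_cast
      ring
    set m : ℝ := (⌊(height U x - a) / |g|⌋ : ℝ) - ⌊(height U x - b) / |g|⌋ with hm
    have hm0 : 0 ≤ m := by
      rw [hm, ← card_Ioc_floor hg0 hab.le]
      positivity
    refine ⟨m * |g| / (T : ℝ) ^ (n + 1), ?_⟩
    filter_upwards [eventually_slabCount_le hT U x (m := m) hε hab.le w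
        (by rw [hw]; exact hg0) (fun z => by rw [hw]; exact (hconst z).le),
      eventually_le_slabCount hT U x (m := m) hε hab.le hm0 w
        (by rw [hw]; exact hg0) (fun z => by rw [hw]; exact (hconst z).ge)] with ρ h1 h2
    rw [hw] at h1 h2
    rw [abs_le]
    constructor <;> linarith

/-- The asymptotic number per unit area of points of `x + T ℤ^d` with heights in `[a, b)`. -/
def slabDensity (T : ℕ) (U : Space n ≃ₗᵢ[ℝ] Space n) (x : Space n) (a b : ℝ) : ℝ :=
  Filter.limUnder Filter.atTop fun ρ => slabCount T U x a b ρ / ρ ^ n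

theorem tendsto_slabCount {T : ℕ} (hT : 0 < T) (U : Space n ≃ₗᵢ[ℝ] Space n) (x : Space n)
    (a b : ℝ) : Filter.Tendsto (fun ρ => slabCount T U x a b ρ / ρ ^ n) Filter.atTop
      (𝓝 (slabDensity T U x a b)) :=
  tendsto_nhds_limUnder (exists_tendsto_slabCount hT U x a b)

theorem tendsto_slabCount_affine {T : ℕ} (hT : 0 < T) (U : Space n ≃ₗᵢ[ℝ] Space n) (x : Space n)
    (a b : ℝ) {l : ℝ} (hl : 0 < l) (k : ℝ) :
    Filter.Tendsto (fun ρ => slabCount T U x a b (l * ρ + k) / ρ ^ n) Filter.atTop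
      (𝓝 (l ^ n * slabDensity T U x a b)) := by
  have h1 : Filter.Tendsto (fun ρ : ℝ => l * ρ + k) Filter.atTop Filter.atTop :=
    Filter.tendsto_atTop_add_const_right _ _ (Filter.tendsto_id.const_mul_atTop hl)
  refine (((tendsto_affine_pow_div_pow l k n)).mul
    ((tendsto_slabCount hT U x a b).comp h1)).congr' ?_
  filter_upwards [h1.eventually_gt_atTop 0] with ρ hρ
  have : (l * ρ + k) ^ n ≠ 0 := by positivity
  simp only [Function.comp]
  field_simp

/-- With its companion `le_slabDensity`: the density is `(b - a) / T^d` up to a constant independent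
of the thickness. For thin slabs it depends on the arithmetic of the direction; for thick ones the
relative error vanishes. -/
theorem slabDensity_le {T : ℕ} (hT : 0 < T) (U : Space n ≃ₗᵢ[ℝ] Space n) (x : Space n)
    {a b : ℝ} (hab : a ≤ b) :
    slabDensity T U x a b * (T : ℝ) ^ (n + 1) ≤ b - a + 2 * ((n + 1) * T) := by
  have h1 := (tendsto_affine_pow_div_pow 1 (2 * ((n + 1) * T)) n).mul_const
    (b - a + 2 * ((n + 1) * T))
  rw [one_pow, one_mul] at h1
  refine le_of_tendsto_of_tendsto ((tendsto_slabCount hT U x a b).mul_const _) h1 ?_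
  filter_upwards [Filter.eventually_gt_atTop 0] with ρ hρ
  have h2 := slabCount_le hT U x hab hρ.le
  rw [div_mul_eq_mul_div, div_mul_eq_mul_div, one_mul]
  gcongr

theorem le_slabDensity {T : ℕ} (hT : 0 < T) (U : Space n ≃ₗᵢ[ℝ] Space n) (x : Space n)
    (a b : ℝ) :
    b - a - 2 * ((n + 1) * T) ≤ slabDensity T U x a b * (T : ℝ) ^ (n + 1) := by
  have h1 := (tendsto_affine_pow_div_pow 1 (-(2 * ((n + 1) * T))) n).mul_const
    (b - a - 2 * ((n + 1) * T))
  rw [one_pow, one_mul] at h1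
  refine le_of_tendsto_of_tendsto h1 ((tendsto_slabCount hT U x a b).mul_const _) ?_
  filter_upwards [Filter.eventually_gt_atTop 0,
    Filter.eventually_ge_atTop (2 * (((n : ℝ) + 1) * T))] with ρ hρ hρ'
  have h2 := le_slabCount hT U x (a := a) (b := b) hρ'
  rw [div_mul_eq_mul_div, div_mul_eq_mul_div, one_mul, ← sub_eq_add_neg]
  gcongr

end LatticeEnergy

namespace LatticeEnergy

variable {n : ℕ}

/-! ### Slabs inside cubes and sums over lattice points -/

theorem slab_subset_rotatedCube {U : Space n ≃ₗᵢ[ℝ] Space n} {a b ρ ρ' : ℝ} (ha : -(ρ' / 2) ≤ a)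
    (hb : b ≤ ρ' / 2) (h : ρ ≤ ρ') : slab U a b ρ ⊆ rotatedCube U ρ' := by
  rw [rotatedCube_eq_slab]
  exact slab_mono ha hb h

theorem mem_slab_of_mem_rotatedCube {U : Space n ≃ₗᵢ[ℝ] Space n} {a b ρ : ℝ} {x : Space n}
    (hx : x ∈ rotatedCube U ρ) (ha : a ≤ height U x) (hb : height U x < b) :
    x ∈ slab U a b ρ := by
  rw [rotatedCube_eq_slab] at hx
  exact ⟨hx.1, ha, hb⟩

open Classical in
theorem sum_latticePoints_subset {T : ℕ} (hT : 0 < T) {A B : Set (Space n)} (hAB : A ⊆ B)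
    (hB : Bornology.IsBounded B) (x : Space n) (F : (Fin (n + 1) → ℤ) → ℝ) :
    ∑ z ∈ latticePoints T A x, F z =
      ∑ z ∈ latticePoints T B x, if x + shift T z ∈ A then F z else 0 := by
  rw [← Finset.sum_filter]
  congr 1
  ext z
  rw [Finset.mem_filter, mem_latticePoints hT hB, mem_latticePoints hT (hB.subset hAB)]
  exact ⟨fun h => ⟨hAB h, h⟩, fun h => h.2⟩

/-! ### Energies on periodic graphs -/

/-- A finite quotient description of a `T ℤ^d`-periodic weighted directed graph in `ℝ^d`: the
nodes are `pos p + T z`, and each `e : E` stands for the edges from `pos (src e) + T z` to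
`pos (tgt e) + T (z + off e)` with capacity `cap e`. -/
structure PeriodicGraph (n : ℕ) (P E : Type*) where
  pos : P → Space n
  src : E → P
  tgt : E → P
  off : E → Fin (n + 1) → ℤ
  cap : E → ℝ
  cap_nonneg : ∀ e, 0 ≤ cap e

namespace PeriodicGraph

variable {P E : Type*} (G : PeriodicGraph n P E) (T : ℕ)

/-- The position of a node. -/
def loc (p : P) (z : Fin (n + 1) → ℤ) : Space n := G.pos p + shift T z

/-- The difference of a function along an edge. -/
def diff (u : P → (Fin (n + 1) → ℤ) → ℝ) (e : E) (z : Fin (n + 1) → ℤ) : ℝ :=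
  u (G.src e) z - u (G.tgt e) (z + G.off e)

/-- The vector from the end point of an edge to its starting point. -/
def disp (e : E) : Space n := G.pos (G.src e) - G.pos (G.tgt e) - shift T (G.off e)

theorem loc_tgt (e : E) (z : Fin (n + 1) → ℤ) :
    G.loc T (G.tgt e) (z + G.off e) = G.loc T (G.src e) z - G.disp T e := by
  simp only [loc, disp, shift_add]
  abel

/-- The energy of the edges that start in `A`. -/
def graphEnergy [Fintype E] (u : P → (Fin (n + 1) → ℤ) → ℝ) (A : Set (Space n)) : ℝ :=
  ∑ e, G.cap e * ∑ z ∈ latticePoints T A (G.pos (G.src e)), max (G.diff u e z) 0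

open Classical in
/-- The indicator of the half-space of points of nonnegative height. -/
def half (U : Space n ≃ₗᵢ[ℝ] Space n) (p : P) (z : Fin (n + 1) → ℤ) : ℝ :=
  if 0 ≤ height U (G.loc T p z) then 1 else 0

/-- The number of edges of type `e` that start in a slab. -/
def edgeCount (U : Space n ≃ₗᵢ[ℝ] Space n) (e : E) (a b ρ : ℝ) : ℝ :=
  slabCount T U (G.pos (G.src e)) a b ρ

/-- The number of edges of type `e` per unit area that start in a slab. -/
def edgeDensity (U : Space n ≃ₗᵢ[ℝ] Space n) (e : E) (a b : ℝ) : ℝ :=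
  slabDensity T U (G.pos (G.src e)) a b

/-- A circulation: a function on the edges without divergence in the quotient graph. -/
def IsCirculation [Fintype E] (β : E → ℝ) : Prop :=
  ∀ q : P → ℝ, ∑ e, β e * (q (G.src e) - q (G.tgt e)) = 0

variable {T}

open Classical in
theorem edgeCount_eq_sum (hT : 0 < T) (U : Space n ≃ₗᵢ[ℝ] Space n) (e : E) {a b ρ : ℝ}
    {B : Set (Space n)} (hAB : slab U a b ρ ⊆ B) (hB : Bornology.IsBounded B) :
    G.edgeCount T U e a b ρ = ∑ z ∈ latticePoints T B (G.pos (G.src e)),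
      if G.loc T (G.src e) z ∈ slab U a b ρ then 1 else 0 := by
  have h := sum_latticePoints_subset hT hAB hB (G.pos (G.src e)) fun _ => 1
  rw [Finset.sum_const, nsmul_eq_mul, mul_one] at h
  exact h

theorem height_loc_tgt (U : Space n ≃ₗᵢ[ℝ] Space n) (e : E) (z : Fin (n + 1) → ℤ) :
    height U (G.loc T (G.tgt e) (z + G.off e)) =
      height U (G.loc T (G.src e) z) - height U (G.disp T e) := by
  rw [loc_tgt, height_sub]

theorem loc_tgt_mem {U : Space n ≃ₗᵢ[ℝ] Space n} {R ρ : ℝ} {e : E} (hR : ‖G.disp T e‖ ≤ R)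
    {z : Fin (n + 1) → ℤ} (h : G.loc T (G.src e) z ∈ rotatedCube U ρ) :
    G.loc T (G.tgt e) (z + G.off e) ∈ rotatedCube U (ρ + 2 * R) := by
  refine mem_rotatedCube_of_dist_le h ?_
  rw [loc_tgt]
  simpa using hR

theorem loc_src_mem {U : Space n ≃ₗᵢ[ℝ] Space n} {R ρ : ℝ} {e : E} (hR : ‖G.disp T e‖ ≤ R)
    {z : Fin (n + 1) → ℤ} (h : G.loc T (G.tgt e) (z + G.off e) ∈ rotatedCube U ρ) :
    G.loc T (G.src e) z ∈ rotatedCube U (ρ + 2 * R) := by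
  refine mem_rotatedCube_of_dist_le h ?_
  rw [loc_tgt]
  simpa using hR

theorem max_diff_half (U : Space n ≃ₗᵢ[ℝ] Space n) (e : E) (z : Fin (n + 1) → ℤ) :
    max (G.diff (G.half T U) e z) 0 =
      if 0 ≤ height U (G.loc T (G.src e) z) ∧
        height U (G.loc T (G.src e) z) < height U (G.disp T e) then 1 else 0 := by
  have h := G.height_loc_tgt (T := T) U e z
  simp only [diff, half]
  split_ifs <;> grind

/-- The half-space cuts exactly the edges that start at a height in `[0, η)`, where `η` is the
height of the edge vector; `2 R ≤ S` keeps these heights inside the cube. -/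
theorem graphEnergy_half [Fintype E] (hT : 0 < T) (U : Space n ≃ₗᵢ[ℝ] Space n) {R : ℝ}
    (hR : ∀ e, ‖G.disp T e‖ ≤ R) {S : ℝ} (hS0 : 0 ≤ S) (hS : 2 * R ≤ S) :
    G.graphEnergy T (G.half T U) (rotatedCube U S) =
      ∑ e, G.cap e * G.edgeCount T U e 0 (height U (G.disp T e)) S := by
  classical
  refine Finset.sum_congr rfl fun e _ => ?_
  have h1 := abs_le.1 ((abs_height_le U (G.disp T e)).trans (hR e))
  congr 1
  rw [edgeCount_eq_sum G hT U e (slab_subset_rotatedCube (by linarith) (by linarith [h1.2]) le_rfl)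
    (isBounded_rotatedCube U S)]
  refine Finset.sum_congr rfl fun z hz => ?_
  have h2 := (mem_latticePoints_rotatedCube hT).1 hz
  rw [max_diff_half]
  congr 1
  rw [mem_slab_iff_mem_rotatedCube (by linarith) (by linarith [h1.2])]
  exact propext ⟨fun h => ⟨h2, h⟩, fun h => h.2⟩

/-- The energy of a function that agrees with the half-space indicator outside a cube. -/
theorem graphEnergy_eq_add [Fintype E] (hT : 0 < T) (U : Space n ≃ₗᵢ[ℝ] Space n) {R : ℝ}
    (hR0 : 0 ≤ R) (hR : ∀ e, ‖G.disp T e‖ ≤ R) {ρ S : ℝ} (hS : ρ + 2 * R ≤ S)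
    {u : P → (Fin (n + 1) → ℤ) → ℝ}
    (hu : ∀ p z, G.loc T p z ∉ rotatedCube U ρ → u p z = G.half T U p z) :
    G.graphEnergy T u (rotatedCube U S) = G.graphEnergy T u (rotatedCube U (ρ + 2 * R)) +
      (G.graphEnergy T (G.half T U) (rotatedCube U S) -
        G.graphEnergy T (G.half T U) (rotatedCube U (ρ + 2 * R))) := by
  classical
  simp only [graphEnergy]
  rw [← Finset.sum_sub_distrib, ← Finset.sum_add_distrib]
  refine Finset.sum_congr rfl fun e _ => ?_
  rw [← mul_sub, ← mul_add]
  congr 1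
  rw [sum_latticePoints_subset hT (rotatedCube_mono hS) (isBounded_rotatedCube U S),
    sum_latticePoints_subset hT (rotatedCube_mono hS) (isBounded_rotatedCube U S),
    ← Finset.sum_sub_distrib, ← Finset.sum_add_distrib]
  refine Finset.sum_congr rfl fun z _ => ?_
  split_ifs with h
  · ring
  -- An edge that starts outside the cube of side `ρ + 2 R` has both ends outside the cube of side
  -- `ρ`, where `u` is the half-space indicator.
  · have h1 : G.loc T (G.src e) z ∉ rotatedCube U ρ := fun h' =>
      h (rotatedCube_mono (by linarith) h')
    have h2 : G.loc T (G.tgt e) (z + G.off e) ∉ rotatedCube U ρ := fun h' =>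
      h (G.loc_src_mem (hR e) h')
    simp [diff, hu _ _ h1, hu _ _ h2]

/-- Summation over all translations turns `w` into a function on the quotient nodes, because the
offset of an edge only reindexes the sum; a circulation annihilates its differences. -/
theorem IsCirculation.sum_tsum_diff [Fintype E] {G : PeriodicGraph n P E} {β : E → ℝ} (hβ : G.IsCirculation β)
    {w : P → (Fin (n + 1) → ℤ) → ℝ} (hw : ∀ p, (Function.support (w p)).Finite) :
    ∑ e, β e * ∑' z, G.diff w e z = 0 := by
  rw [← hβ fun p => ∑' z, w p z]
  refine Finset.sum_congr rfl fun e _ => ?_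
  congr 1
  have h1 : Summable (w (G.src e)) := summable_of_hasFiniteSupport (hw _)
  have h2 : Summable (w (G.tgt e)) := summable_of_hasFiniteSupport (hw _)
  have h3 : Summable fun z => w (G.tgt e) (z + G.off e) :=
    (Equiv.addRight (G.off e)).summable_iff.2 h2
  simp only [diff]
  rw [h1.tsum_sub h3]
  congr 1
  exact (Equiv.addRight (G.off e)).tsum_eq (w (G.tgt e))

/-! ### The lower bound -/

/-- The continuous piecewise affine function of the height that rises from `0` to `1`
over the heights in `[0, M]`. -/
def ramp (U : Space n ≃ₗᵢ[ℝ] Space n) (M : ℝ) (p : P) (z : Fin (n + 1) → ℤ) : ℝ :=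
  max 0 (min 1 (height U (G.loc T p z) / M))


theorem ramp_mem (U : Space n ≃ₗᵢ[ℝ] Space n) (M : ℝ) (p : P) (z : Fin (n + 1) → ℤ) :
    0 ≤ G.ramp (T := T) U M p z ∧ G.ramp (T := T) U M p z ≤ 1 :=
  ⟨le_max_left _ _, max_le zero_le_one (min_le_left _ _)⟩

theorem ramp_eq_zero (U : Space n ≃ₗᵢ[ℝ] Space n) {M : ℝ} (hM : 0 < M) {p : P}
    {z : Fin (n + 1) → ℤ} (h : height U (G.loc T p z) ≤ 0) : G.ramp (T := T) U M p z = 0 :=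
  max_eq_left ((min_le_right _ _).trans (div_nonpos_of_nonpos_of_nonneg h hM.le))

theorem ramp_eq_one (U : Space n ≃ₗᵢ[ℝ] Space n) {M : ℝ} (hM : 0 < M) {p : P}
    {z : Fin (n + 1) → ℤ} (h : M ≤ height U (G.loc T p z)) : G.ramp (T := T) U M p z = 1 := by
  rw [ramp, min_eq_left ((one_le_div hM).2 h), max_eq_right zero_le_one]

theorem ramp_eq_div (U : Space n ≃ₗᵢ[ℝ] Space n) {M : ℝ} (hM : 0 < M) {p : P}
    {z : Fin (n + 1) → ℤ} (h0 : 0 ≤ height U (G.loc T p z)) (h : height U (G.loc T p z) ≤ M) :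
    G.ramp (T := T) U M p z = height U (G.loc T p z) / M := by
  rw [ramp, min_eq_right ((div_le_one hM).2 h), max_eq_right (div_nonneg h0 hM.le)]

theorem abs_clamp_sub_clamp_le (a b : ℝ) :
    |max 0 (min 1 a) - max 0 (min 1 b)| ≤ |a - b| := by
  refine (abs_max_sub_max_le_max 0 (min 1 a) 0 (min 1 b)).trans ?_
  refine max_le (by simp) ((abs_min_sub_min_le_max 1 a 1 b).trans ?_)
  exact max_le (by simp) le_rfl

theorem abs_diff_ramp_le (U : Space n ≃ₗᵢ[ℝ] Space n) {M : ℝ} (hM : 0 < M) (e : E)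
    (z : Fin (n + 1) → ℤ) :
    |G.diff (G.ramp (T := T) U M) e z| ≤ |height U (G.disp T e)| / M := by
  refine (abs_clamp_sub_clamp_le _ _).trans ?_
  rw [height_loc_tgt, ← sub_div, sub_sub_cancel, abs_div, abs_of_pos hM]

-- Away from the kinks at heights `0` and `M` the ramp is affine or constant along an edge. Near a
-- kink its difference is at most `R / M` in modulus, so subtracting `2 R / M` pays both for it and
-- for the spurious leading term.
open Classical in
theorem le_diff_ramp (U : Space n ≃ₗᵢ[ℝ] Space n) {R M : ℝ} (hM : 0 < M)
    {e : E} (hR : |height U (G.disp T e)| ≤ R) (z : Fin (n + 1) → ℤ) :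
    height U (G.disp T e) / M * (if 0 ≤ height U (G.loc T (G.src e) z) ∧
        height U (G.loc T (G.src e) z) < M then 1 else 0)
      - 2 * R / M * (if -R ≤ height U (G.loc T (G.src e) z) ∧
        height U (G.loc T (G.src e) z) < R then 1 else 0)
      - 2 * R / M * (if M - R ≤ height U (G.loc T (G.src e) z) ∧
        height U (G.loc T (G.src e) z) < M + R then 1 else 0) ≤
      G.diff (G.ramp (T := T) U M) e z := by
  have hη := abs_le.1 hR
  have hR0 : 0 ≤ R := (abs_nonneg _).trans hR
  have h1 := abs_le.1 (G.abs_diff_ramp_le (T := T) U hM e z)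
  have ht := G.height_loc_tgt (T := T) U e z
  set h := height U (G.loc T (G.src e) z) with hh
  set η := height U (G.disp T e) with hηdef
  have h2 : |η| / M ≤ R / M := by gcongr
  have h3 : η / M ≤ R / M := by gcongr; exact hη.2
  have h4 : 0 ≤ R / M := by positivity
  have e1 : 2 * R / M = R / M + R / M := by ring
  rw [e1]
  by_cases c1 : -R ≤ h ∧ h < R
  · rw [if_pos c1]
    split_ifs <;> linarith
  by_cases c2 : M - R ≤ h ∧ h < M + R
  · rw [if_pos c2]
    split_ifs <;> linarith
  rw [if_neg c1, if_neg c2, mul_zero, sub_zero, sub_zero]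
  rcases lt_or_ge h (-R) with c3 | c3
  · rw [if_neg (by intro h'; linarith [h'.1]), diff, G.ramp_eq_zero U hM (by linarith),
      G.ramp_eq_zero U hM (by linarith)]
    simp
  have c4 : R ≤ h := by
    by_contra hlt
    exact c1 ⟨c3, not_le.1 hlt⟩
  rcases lt_or_ge h (M - R) with c5 | c5
  · rw [diff, G.ramp_eq_div U hM (by linarith) (by linarith),
      G.ramp_eq_div U hM (by linarith) (by linarith), ht, ← hh, if_pos ⟨by linarith, by linarith⟩,
      ← sub_div, sub_sub_cancel, mul_one]
  · have c6 : M + R ≤ h := by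
      by_contra hlt
      exact c2 ⟨c5, not_le.1 hlt⟩
    rw [if_neg (by intro h'; linarith [h'.2]), diff, G.ramp_eq_one U hM (by linarith),
      G.ramp_eq_one U hM (by linarith)]
    simp

theorem le_sum_diff_ramp (hT : 0 < T) (U : Space n ≃ₗᵢ[ℝ] Space n) {R M ρ : ℝ} (hM : 0 < M)
    {e : E} (hR : |height U (G.disp T e)| ≤ R) (hρ : 2 * (M + R) ≤ ρ) :
    height U (G.disp T e) / M * G.edgeCount T U e 0 M ρ
      - 2 * R / M * G.edgeCount T U e (-R) R ρ
      - 2 * R / M * G.edgeCount T U e (M - R) (M + R) ρ ≤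
      ∑ z ∈ latticePoints T (rotatedCube U ρ) (G.pos (G.src e)),
        G.diff (G.ramp (T := T) U M) e z := by
  classical
  have hR0 : 0 ≤ R := (abs_nonneg _).trans hR
  have hb := isBounded_rotatedCube U ρ
  rw [G.edgeCount_eq_sum hT U e (slab_subset_rotatedCube (by linarith) (by linarith) le_rfl) hb,
    G.edgeCount_eq_sum hT U e (slab_subset_rotatedCube (by linarith) (by linarith) le_rfl) hb,
    G.edgeCount_eq_sum hT U e (slab_subset_rotatedCube (by linarith) (by linarith) le_rfl) hb,
    Finset.mul_sum, Finset.mul_sum, Finset.mul_sum, ← Finset.sum_sub_distrib,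
    ← Finset.sum_sub_distrib]
  refine Finset.sum_le_sum fun z hz => le_trans (le_of_eq ?_) (G.le_diff_ramp U hM hR z)
  have hz' : G.loc T (G.src e) z ∈ rotatedCube U ρ := (mem_latticePoints_rotatedCube hT).1 hz
  have key : ∀ a b, -(ρ / 2) ≤ a → b ≤ ρ / 2 → (G.loc T (G.src e) z ∈ slab U a b ρ ↔
      a ≤ height U (G.loc T (G.src e) z) ∧ height U (G.loc T (G.src e) z) < b) := by
    intro a b ha hb
    rw [mem_slab_iff_mem_rotatedCube ha hb]
    exact ⟨fun h => h.2, fun h => ⟨hz', h⟩⟩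
  simp only [key 0 M (by linarith) (by linarith), key (-R) R (by linarith) (by linarith),
    key (M - R) (M + R) (by linarith) (by linarith)]

/-- A circulation below the capacities bounds the energy from below, up to a boundary term. -/
theorem sum_diff_ramp_le_graphEnergy [Fintype E] (hT : 0 < T) (U : Space n ≃ₗᵢ[ℝ] Space n)
    {R M ρ : ℝ} (hR0 : 0 < R) (hR : ∀ e, ‖G.disp T e‖ ≤ R) (hM : 0 < M)
    (hρ : 2 * (M + 2 * R) ≤ ρ) {β : E → ℝ} (hβ : G.IsCirculation β) (hβ0 : ∀ e, 0 ≤ β e)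
    (hβc : ∀ e, β e ≤ G.cap e) {u : P → (Fin (n + 1) → ℤ) → ℝ}
    (hu01 : ∀ p z, 0 ≤ u p z ∧ u p z ≤ 1)
    (hu : ∀ p z, G.loc T p z ∉ rotatedCube U ρ → u p z = G.half T U p z) :
    ∑ e, β e * ∑ z ∈ latticePoints T (rotatedCube U (ρ + 2 * R)) (G.pos (G.src e)),
        G.diff (G.ramp (T := T) U M) e z ≤
      G.graphEnergy T u (rotatedCube U (ρ + 2 * R)) +
      ∑ e, β e * (G.edgeCount T U e (-(2 * R)) (M + 2 * R) (ρ + 2 * R + 2 * R) -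
        G.edgeCount T U e (-(2 * R)) (M + 2 * R) ρ) := by
  classical
  set r := ρ + 2 * R with hr
  set v := G.ramp (T := T) U M with hv
  -- Outside the cube of side `ρ` the error `w` lives only at heights in `[0, M)`. Its truncation
  -- `w'` has finite support, so the circulation annihilates it.
  set w : P → (Fin (n + 1) → ℤ) → ℝ := fun p z => u p z - v p z with hw
  set w' : P → (Fin (n + 1) → ℤ) → ℝ := fun p z =>
    if G.loc T p z ∈ rotatedCube U r then w p z else 0 with hw'
  have hw1 : ∀ p z, -1 ≤ w p z ∧ w p z ≤ 1 := by
    intro p z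
    have h1 := hu01 p z
    have h2 := G.ramp_mem (T := T) U M p z
    simp only [hw, hv]
    constructor <;> linarith [h1.1, h1.2, h2.1, h2.2]
  have hw2 : ∀ p z, G.loc T p z ∉ rotatedCube U ρ → w p z ≠ 0 →
      0 ≤ height U (G.loc T p z) ∧ height U (G.loc T p z) < M := by
    intro p z hz hne
    by_contra hcon
    refine hne ?_
    simp only [hw, hv, hu p z hz, half]
    by_cases h0 : 0 ≤ height U (G.loc T p z)
    · have h1 : M ≤ height U (G.loc T p z) := by
        by_contra h1
        exact hcon ⟨h0, not_le.1 h1⟩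
      rw [if_pos h0, G.ramp_eq_one U hM h1, sub_self]
    · rw [if_neg h0, G.ramp_eq_zero U hM (not_le.1 h0).le, sub_self]
  have hpt : ∀ e z, G.diff w' e z -
      ((if G.loc T (G.src e) z ∈ slab U (-(2 * R)) (M + 2 * R) (r + 2 * R) then 1 else 0) -
        (if G.loc T (G.src e) z ∈ slab U (-(2 * R)) (M + 2 * R) ρ then 1 else 0)) ≤
      if G.loc T (G.src e) z ∈ rotatedCube U r then G.diff w e z else 0 := by
    intro e z
    have hmono : G.loc T (G.src e) z ∈ slab U (-(2 * R)) (M + 2 * R) ρ →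
        G.loc T (G.src e) z ∈ slab U (-(2 * R)) (M + 2 * R) (r + 2 * R) :=
      fun h => slab_mono le_rfl le_rfl (by linarith) h
    -- Only edges crossing the boundary of the cube of side `r` feel the truncation, and in both
    -- crossing directions the discrepancy is `±w` at the target. If that is nonzero, the source
    -- lies in the lateral shell at a bounded height.
    have hbd : ((G.loc T (G.src e) z ∈ rotatedCube U r ∧
          G.loc T (G.tgt e) (z + G.off e) ∉ rotatedCube U r) ∨
        (G.loc T (G.src e) z ∉ rotatedCube U r ∧
          G.loc T (G.tgt e) (z + G.off e) ∈ rotatedCube U r)) →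
        w (G.tgt e) (z + G.off e) ≠ 0 →
        G.loc T (G.src e) z ∈ slab U (-(2 * R)) (M + 2 * R) (r + 2 * R) ∧
        G.loc T (G.src e) z ∉ slab U (-(2 * R)) (M + 2 * R) ρ := by
      intro hc hne
      have hη := abs_le.1 ((abs_height_le U (G.disp T e)).trans (hR e))
      have ht := G.height_loc_tgt (T := T) U e z
      have hmem : G.loc T (G.src e) z ∈ rotatedCube U (r + 2 * R) := by
        rcases hc with hc | hc
        · exact rotatedCube_mono (by linarith) hc.1
        · exact G.loc_src_mem (hR e) hc.2
      have hnot : G.loc T (G.tgt e) (z + G.off e) ∉ rotatedCube U ρ := by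
        intro h
        rcases hc with hc | hc
        · exact hc.2 (rotatedCube_mono (by linarith) h)
        · exact hc.1 (G.loc_src_mem (hR e) h)
      obtain ⟨h1, h2⟩ := hw2 _ _ hnot hne
      refine ⟨mem_slab_of_mem_rotatedCube hmem (by linarith) (by linarith), fun h => ?_⟩
      have h3 := slab_subset_rotatedCube (by linarith) (by linarith) le_rfl h
      rcases hc with hc | hc
      · exact hc.2 (G.loc_tgt_mem (hR e) h3)
      · exact hc.1 (rotatedCube_mono (by linarith) h3)
    have h1 := hw1 (G.tgt e) (z + G.off e)
    simp only [diff, hw']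
    by_cases hne : w (G.tgt e) (z + G.off e) = 0
    · rw [hne]
      split_ifs <;> simp_all
    · by_cases ha : G.loc T (G.src e) z ∈ rotatedCube U r <;>
      by_cases hb : G.loc T (G.tgt e) (z + G.off e) ∈ rotatedCube U r
      · simp only [ha, hb, if_true]
        split_ifs <;> simp_all
      · obtain ⟨h2, h3⟩ := hbd (Or.inl ⟨ha, hb⟩) hne
        simp only [ha, hb, h2, h3, if_true, if_false]
        linarith [h1.1, h1.2]
      · obtain ⟨h2, h3⟩ := hbd (Or.inr ⟨ha, hb⟩) hne
        simp only [ha, hb, h2, h3, if_true, if_false]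
        linarith [h1.1, h1.2]
      · simp only [ha, hb, if_false]
        split_ifs <;> simp_all
  have hsupp : ∀ e, ∑' z, G.diff w' e z =
      ∑ z ∈ latticePoints T (rotatedCube U (r + 2 * R)) (G.pos (G.src e)), G.diff w' e z := by
    intro e
    refine tsum_eq_sum fun z hz => ?_
    rw [mem_latticePoints_rotatedCube hT] at hz
    have h1 : G.loc T (G.src e) z ∉ rotatedCube U r := fun h =>
      hz (rotatedCube_mono (by linarith) h)
    have h2 : G.loc T (G.tgt e) (z + G.off e) ∉ rotatedCube U r := fun h =>
      hz (G.loc_src_mem (hR e) h)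
    simp [diff, hw', h1, h2]
  have hzero := hβ.sum_tsum_diff (w := w') fun p =>
    (finite_latticePoints hT (isBounded_rotatedCube U r) (G.pos p)).subset fun z hz => by
      by_contra hz'
      exact hz (if_neg hz')
  have hb := isBounded_rotatedCube U (r + 2 * R)
  have hsum : ∀ e, ∑' z, G.diff w' e z -
      (G.edgeCount T U e (-(2 * R)) (M + 2 * R) (r + 2 * R) -
        G.edgeCount T U e (-(2 * R)) (M + 2 * R) ρ) ≤
      ∑ z ∈ latticePoints T (rotatedCube U r) (G.pos (G.src e)), G.diff w e z := by
    intro e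
    rw [hsupp, G.edgeCount_eq_sum hT U e (slab_subset_rotatedCube (by linarith) (by linarith)
      le_rfl) hb, G.edgeCount_eq_sum hT U e (slab_subset_rotatedCube (by linarith) (by linarith)
      (by linarith)) hb, sum_latticePoints_subset hT
      (rotatedCube_mono (U := U) (by linarith : r ≤ r + 2 * R)) hb, ← Finset.sum_sub_distrib,
      ← Finset.sum_sub_distrib]
    exact Finset.sum_le_sum fun z _ => hpt e z
  have hmain : ∀ e, β e * ∑' z, G.diff w' e z +
      β e * ∑ z ∈ latticePoints T (rotatedCube U r) (G.pos (G.src e)), G.diff v e z ≤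
      G.cap e * ∑ z ∈ latticePoints T (rotatedCube U r) (G.pos (G.src e)), max (G.diff u e z) 0 +
      β e * (G.edgeCount T U e (-(2 * R)) (M + 2 * R) (r + 2 * R) -
        G.edgeCount T U e (-(2 * R)) (M + 2 * R) ρ) := by
    intro e
    have h1 := mul_le_mul_of_nonneg_left (hsum e) (hβ0 e)
    have h2 : ∑ z ∈ latticePoints T (rotatedCube U r) (G.pos (G.src e)), G.diff w e z =
        ∑ z ∈ latticePoints T (rotatedCube U r) (G.pos (G.src e)), G.diff u e z -
        ∑ z ∈ latticePoints T (rotatedCube U r) (G.pos (G.src e)), G.diff v e z := by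
      rw [← Finset.sum_sub_distrib]
      refine Finset.sum_congr rfl fun z _ => ?_
      simp only [diff, hw]
      ring
    -- The only place where the capacity enters: `β t ≤ β t^+ ≤ c t^+`.
    have h3 : β e * ∑ z ∈ latticePoints T (rotatedCube U r) (G.pos (G.src e)), G.diff u e z ≤
        G.cap e * ∑ z ∈ latticePoints T (rotatedCube U r) (G.pos (G.src e)),
          max (G.diff u e z) 0 := by
      refine (mul_le_mul_of_nonneg_left (Finset.sum_le_sum fun z _ => le_max_left _ 0)
        (hβ0 e)).trans ?_
      exact mul_le_mul_of_nonneg_right (hβc e) (Finset.sum_nonneg fun z _ => le_max_right _ _)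
    rw [h2] at h1
    linarith
  have := Finset.sum_le_sum fun e (_ : e ∈ Finset.univ) => hmain e
  rw [Finset.sum_add_distrib, Finset.sum_add_distrib, hzero, zero_add] at this
  exact this

end PeriodicGraph

end LatticeEnergy

namespace LatticeEnergy

namespace PeriodicGraph

variable {n : ℕ} {P E : Type*} (G : PeriodicGraph n P E) {T : ℕ}

variable (T) in
/-- The asymptotic energy per unit area of the half-space indicator. -/
def halfDensity [Fintype E] (U : Space n ≃ₗᵢ[ℝ] Space n) : ℝ :=
  ∑ e, G.cap e * G.edgeDensity T U e 0 (height U (G.disp T e))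

theorem tendsto_edgeCount (hT : 0 < T) (U : Space n ≃ₗᵢ[ℝ] Space n) (e : E) (a b : ℝ) :
    Filter.Tendsto (fun S => G.edgeCount T U e a b S / S ^ n) Filter.atTop
      (𝓝 (G.edgeDensity T U e a b)) :=
  tendsto_slabCount hT U _ a b

theorem tendsto_edgeCount_affine (hT : 0 < T) (U : Space n ≃ₗᵢ[ℝ] Space n) (e : E) (a b : ℝ)
    {l : ℝ} (hl : 0 < l) (k : ℝ) :
    Filter.Tendsto (fun S => G.edgeCount T U e a b (l * S + k) / S ^ n) Filter.atTop
      (𝓝 (l ^ n * G.edgeDensity T U e a b)) :=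
  tendsto_slabCount_affine hT U _ a b hl k

theorem tendsto_edgeCount_mul (hT : 0 < T) (U : Space n ≃ₗᵢ[ℝ] Space n) (e : E) (a b : ℝ)
    {l : ℝ} (hl : 0 < l) :
    Filter.Tendsto (fun S => G.edgeCount T U e a b (l * S) / S ^ n) Filter.atTop
      (𝓝 (l ^ n * G.edgeDensity T U e a b)) := by
  simpa using G.tendsto_edgeCount_affine hT U e a b hl 0

/-- The ramp width `M` is fixed first, making the kink errors at most `ε`; then `S → ∞` replaces
edge counts by densities. The shell terms cancel in the limit, since both sides are `l S + O(1)`.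
Between the cubes `u` is the half-space indicator, which gives the `halfDensity` term. -/
theorem eventually_le_graphEnergy [Fintype E] (hT : 0 < T) (U : Space n ≃ₗᵢ[ℝ] Space n) {R : ℝ}
    (hR0 : 0 < R) (hR : ∀ e, ‖G.disp T e‖ ≤ R) {β : E → ℝ} (hβ : G.IsCirculation β)
    (hβ0 : ∀ e, 0 ≤ β e) (hβc : ∀ e, β e ≤ G.cap e) {l ε : ℝ} (hl0 : 0 < l) (hl1 : l < 1)
    (hε : 0 < ε) :
    ∀ᶠ S in Filter.atTop, ∀ u : P → (Fin (n + 1) → ℤ) → ℝ,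
      (∀ p z, 0 ≤ u p z ∧ u p z ≤ 1) →
      (∀ p z, G.loc T p z ∉ rotatedCube U (l * S) → u p z = G.half T U p z) →
      (l ^ n * (((T : ℝ) ^ (n + 1))⁻¹ * ∑ e, β e * height U (G.disp T e)) +
        (1 - l ^ n) * G.halfDensity T U - ε) * S ^ n ≤ G.graphEnergy T u (rotatedCube U S) := by
  set D : ℝ := (T : ℝ) ^ (n + 1) with hD
  have hD0 : 0 < D := by positivity
  set K : ℝ := (n + 1) * T with hK
  have hK0 : 0 ≤ K := by positivity
  set η : E → ℝ := fun e => height U (G.disp T e) with hη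
  have hηR : ∀ e, |η e| ≤ R := fun e => (abs_height_le U _).trans (hR e)
  -- The constant is `2 K R` from the density of the main slab, plus `2 R (2 R + 2 K)` from each of
  -- the two kinks.
  set Q : ℝ := ∑ e, β e * ((8 * R ^ 2 + 10 * K * R) / D) with hQ
  have hQ0 : 0 ≤ Q := Finset.sum_nonneg fun e _ => mul_nonneg (hβ0 e) (by positivity)
  obtain ⟨M, hM⟩ := exists_gt (max 1 (Q / ε))
  have hM0 : 0 < M := by linarith [(le_max_left _ _).trans_lt hM]
  have hMQ : Q / M < ε := by
    have := (le_max_right _ _).trans_lt hM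
    rw [div_lt_iff₀ hε] at this
    rw [div_lt_iff₀ hM0]
    linarith
  set F : E → ℝ → ℝ := fun e S =>
    β e * (η e / M * G.edgeCount T U e 0 M (l * S + 2 * R)
      - 2 * R / M * G.edgeCount T U e (-R) R (l * S + 2 * R)
      - 2 * R / M * G.edgeCount T U e (M - R) (M + R) (l * S + 2 * R))
    - β e * (G.edgeCount T U e (-(2 * R)) (M + 2 * R) (l * S + (2 * R + 2 * R)) -
        G.edgeCount T U e (-(2 * R)) (M + 2 * R) (l * S))
    + G.cap e * (G.edgeCount T U e 0 (η e) S - G.edgeCount T U e 0 (η e) (l * S + 2 * R)) with hF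
  set f : E → ℝ := fun e =>
    β e * (η e / M * (l ^ n * G.edgeDensity T U e 0 M)
      - 2 * R / M * (l ^ n * G.edgeDensity T U e (-R) R)
      - 2 * R / M * (l ^ n * G.edgeDensity T U e (M - R) (M + R)))
    - β e * (l ^ n * G.edgeDensity T U e (-(2 * R)) (M + 2 * R) -
        l ^ n * G.edgeDensity T U e (-(2 * R)) (M + 2 * R))
    + G.cap e * (G.edgeDensity T U e 0 (η e) - l ^ n * G.edgeDensity T U e 0 (η e)) with hf
  have hlim : Filter.Tendsto (fun S => (∑ e, F e S) / S ^ n) Filter.atTop (𝓝 (∑ e, f e)) := by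
    simp_rw [Finset.sum_div]
    refine tendsto_finsetSum _ fun e _ => ?_
    have h1 := (((((G.tendsto_edgeCount_affine hT U e 0 M hl0 (2 * R)).const_mul (η e / M)).sub
      ((G.tendsto_edgeCount_affine hT U e (-R) R hl0 (2 * R)).const_mul (2 * R / M))).sub
      ((G.tendsto_edgeCount_affine hT U e (M - R) (M + R) hl0 (2 * R)).const_mul
        (2 * R / M))).const_mul (β e)).sub
      (((G.tendsto_edgeCount_affine hT U e (-(2 * R)) (M + 2 * R) hl0 (2 * R + 2 * R)).sub
        (G.tendsto_edgeCount_mul hT U e (-(2 * R)) (M + 2 * R) hl0)).const_mul (β e))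
    refine (h1.add (((G.tendsto_edgeCount hT U e 0 (η e)).sub
      (G.tendsto_edgeCount_affine hT U e 0 (η e) hl0 (2 * R))).const_mul (G.cap e))).congr
      fun S => ?_
    simp only [hF]
    ring
  have hbound : l ^ n * (D⁻¹ * ∑ e, β e * η e) + (1 - l ^ n) * G.halfDensity T U - ε <
      ∑ e, f e := by
    have hfe : ∀ e, l ^ n * (D⁻¹ * (β e * η e)) +
        (1 - l ^ n) * (G.cap e * G.edgeDensity T U e 0 (η e)) -
        l ^ n * (β e * ((8 * R ^ 2 + 10 * K * R) / D) / M) ≤ f e := by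
      intro e
      have h1 : G.edgeDensity T U e 0 M * D ≤ M - 0 + 2 * K := slabDensity_le hT U _ hM0.le
      have h2 : M - 0 - 2 * K ≤ G.edgeDensity T U e 0 M * D := le_slabDensity hT U _ _ _
      have h3 : G.edgeDensity T U e (-R) R * D ≤ R - -R + 2 * K :=
        slabDensity_le hT U _ (by linarith)
      have h4 : G.edgeDensity T U e (M - R) (M + R) * D ≤ M + R - (M - R) + 2 * K :=
        slabDensity_le hT U _ (by linarith)
      have h5 : η e * M - 2 * K * R ≤ η e * (G.edgeDensity T U e 0 M * D) := by
        have h6 : |η e * (G.edgeDensity T U e 0 M * D - M)| ≤ R * (2 * K) := by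
          rw [abs_mul]
          refine mul_le_mul (hηR e) (abs_le.2 ⟨by linarith, by linarith⟩) (abs_nonneg _) hR0.le
        have := (abs_le.1 h6).1
        linarith
      have h6 : η e / D - (8 * R ^ 2 + 10 * K * R) / D / M ≤
          η e / M * G.edgeDensity T U e 0 M - 2 * R / M * G.edgeDensity T U e (-R) R
          - 2 * R / M * G.edgeDensity T U e (M - R) (M + R) := by
        have h7 : 2 * R * (G.edgeDensity T U e (-R) R * D) ≤ 2 * R * (R - -R + 2 * K) := by gcongr
        have h8 : 2 * R * (G.edgeDensity T U e (M - R) (M + R) * D) ≤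
          2 * R * (M + R - (M - R) + 2 * K) := by gcongr
        rw [← mul_le_mul_iff_left₀ (mul_pos hD0 hM0)]
        have e1 : (η e / D - (8 * R ^ 2 + 10 * K * R) / D / M) * (D * M) =
          η e * M - (8 * R ^ 2 + 10 * K * R) := by field_simp
        have e2 : (η e / M * G.edgeDensity T U e 0 M - 2 * R / M * G.edgeDensity T U e (-R) R
          - 2 * R / M * G.edgeDensity T U e (M - R) (M + R)) * (D * M) =
          η e * (G.edgeDensity T U e 0 M * D) - 2 * R * (G.edgeDensity T U e (-R) R * D)
          - 2 * R * (G.edgeDensity T U e (M - R) (M + R) * D) := by field_simp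
        rw [e1, e2]
        nlinarith
      have h7 := mul_le_mul_of_nonneg_left h6 (mul_nonneg (pow_nonneg hl0.le n) (hβ0 e))
      simp only [hf]
      have e3 : l ^ n * β e * (η e / D - (8 * R ^ 2 + 10 * K * R) / D / M) =
        l ^ n * (D⁻¹ * (β e * η e)) - l ^ n * (β e * ((8 * R ^ 2 + 10 * K * R) / D) / M) := by
        ring
      rw [e3] at h7
      linarith
    have hs := Finset.sum_le_sum fun e (_ : e ∈ Finset.univ) => hfe e
    rw [Finset.sum_sub_distrib, Finset.sum_add_distrib, ← Finset.mul_sum, ← Finset.mul_sum,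
      ← Finset.mul_sum, ← Finset.mul_sum, ← Finset.sum_div] at hs
    have hln : l ^ n ≤ 1 := pow_le_one₀ hl0.le hl1.le
    have : l ^ n * (Q / M) ≤ 1 * (Q / M) := by gcongr
    have e0 : G.halfDensity T U = ∑ e, G.cap e * G.edgeDensity T U e 0 (η e) := rfl
    rw [e0]
    linarith
  filter_upwards [hlim.eventually_const_lt hbound, Filter.eventually_gt_atTop 0,
    Filter.eventually_ge_atTop (2 * (M + 2 * R) / l),
    Filter.eventually_ge_atTop (2 * R / (1 - l))] with S hS1 hS0 hS2 hS3
  intro u hu01 hu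
  rw [div_le_iff₀ hl0] at hS2
  rw [div_le_iff₀ (by linarith)] at hS3
  have h1 := G.graphEnergy_eq_add hT U hR0.le hR (ρ := l * S) (S := S) (by linarith) hu
  have h2 := G.sum_diff_ramp_le_graphEnergy hT U hR0 hR hM0 (ρ := l * S) (by linarith) hβ hβ0 hβc
    hu01 hu
  rw [G.graphEnergy_half hT U hR (by linarith) (by linarith),
    G.graphEnergy_half hT U hR (by linarith) (by linarith)] at h1
  have h3 : ∑ e, β e * (η e / M * G.edgeCount T U e 0 M (l * S + 2 * R)
      - 2 * R / M * G.edgeCount T U e (-R) R (l * S + 2 * R)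
      - 2 * R / M * G.edgeCount T U e (M - R) (M + R) (l * S + 2 * R)) ≤
      ∑ e, β e * ∑ z ∈ latticePoints T (rotatedCube U (l * S + 2 * R)) (G.pos (G.src e)),
        G.diff (G.ramp (T := T) U M) e z := by
    refine Finset.sum_le_sum fun e _ => mul_le_mul_of_nonneg_left ?_ (hβ0 e)
    exact G.le_sum_diff_ramp hT U hM0 (hηR e) (by linarith)
  have h4 : ∑ e, F e S ≤ G.graphEnergy T u (rotatedCube U S) := by
    simp only [hF, Finset.sum_add_distrib, Finset.sum_sub_distrib, mul_sub, ← add_assoc] at h2 h3 ⊢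
    linarith
  refine le_trans ?_ h4
  rw [← le_div_iff₀ (by positivity)]
  exact hS1.le

/-! ### The upper bound -/

/-- A discrete coarea inequality: integrating over `τ ∈ [0, M]`, each indicator contributes at most
the length of its interval, and nothing if the interval misses `[0, M]`; some `τ` does not exceed
the average. -/
theorem exists_average_le {ι : Type*} (s : Finset ι) {c a b : ι → ℝ} (hc : ∀ i, 0 ≤ c i) {M : ℝ}
    (hM : 0 < M) :
    ∃ τ, 0 ≤ τ ∧ τ ≤ M ∧ M * ∑ i ∈ s, c i * (Set.Ioc (a i) (b i)).indicator 1 τ ≤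
      ∑ i ∈ s, c i * (if a i < M ∧ 0 ≤ b i then max (b i - a i) 0 else 0) := by
  have hint : ∀ i, MeasureTheory.IntegrableOn (fun τ => c i * (Set.Ioc (a i) (b i)).indicator 1 τ)
      (Set.Icc 0 M) := by
    intro i
    refine MeasureTheory.Integrable.const_mul ?_ _
    exact (MeasureTheory.integrable_const (1 : ℝ)).indicator measurableSet_Ioc
  obtain ⟨τ, hτ, hle⟩ := MeasureTheory.exists_le_setAverage
    (μ := MeasureTheory.volume) (s := Set.Icc 0 M)
    (f := fun τ => ∑ i ∈ s, c i * (Set.Ioc (a i) (b i)).indicator 1 τ)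
    (by simp [hM]) (by simp) (MeasureTheory.integrable_finsetSum _ fun i _ => hint i)
  refine ⟨τ, hτ.1, hτ.2, ?_⟩
  rw [MeasureTheory.setAverage_eq, MeasureTheory.integral_finsetSum _ fun i _ => hint i,
    smul_eq_mul] at hle
  simp only [Real.volume_real_Icc_of_le hM.le, sub_zero] at hle
  rw [← div_eq_inv_mul, le_div_iff₀ hM, mul_comm] at hle
  refine hle.trans (Finset.sum_le_sum fun i _ => ?_)
  rw [MeasureTheory.integral_const_mul]
  refine mul_le_mul_of_nonneg_left ?_ (hc i)
  rw [MeasureTheory.integral_indicator_one measurableSet_Ioc,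
    MeasureTheory.measureReal_restrict_apply measurableSet_Ioc]
  split_ifs with h
  · refine (MeasureTheory.measureReal_mono Set.inter_subset_left (by simp)).trans ?_
    rw [Real.volume_real_Ioc]
  · have : Set.Ioc (a i) (b i) ∩ Set.Icc 0 M = ∅ := by
      ext t
      simp only [Set.mem_inter_iff, Set.mem_Ioc, Set.mem_Icc, Set.mem_empty_iff_false, iff_false]
      rintro ⟨⟨h1, h2⟩, h3, h4⟩
      exact h ⟨by linarith, by linarith⟩
    simp [this]

/-- The height perturbed by a periodic function. -/
def tilt (U : Space n ≃ₗᵢ[ℝ] Space n) (q : P → ℝ) (p : P) (z : Fin (n + 1) → ℤ) : ℝ :=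
  height U (G.loc T p z) + q p

open Classical in
/-- The indicator of a superlevel set of the perturbed height. -/
def level (U : Space n ≃ₗᵢ[ℝ] Space n) (q : P → ℝ) (τ : ℝ) (p : P) (z : Fin (n + 1) → ℤ) : ℝ :=
  if τ ≤ G.tilt (T := T) U q p z then 1 else 0

theorem max_diff_level (U : Space n ≃ₗᵢ[ℝ] Space n) (q : P → ℝ) (τ : ℝ) (e : E)
    (z : Fin (n + 1) → ℤ) :
    max (G.diff (G.level (T := T) U q τ) e z) 0 =
      (Set.Ioc (G.tilt (T := T) U q (G.tgt e) (z + G.off e))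
        (G.tilt (T := T) U q (G.src e) z)).indicator 1 τ := by
  simp only [diff, level, Set.indicator, Set.mem_Ioc, Pi.one_apply]
  split_ifs <;> grind

theorem tilt_src_sub_tilt_tgt (U : Space n ≃ₗᵢ[ℝ] Space n) (q : P → ℝ) (e : E)
    (z : Fin (n + 1) → ℤ) :
    G.tilt (T := T) U q (G.src e) z - G.tilt (T := T) U q (G.tgt e) (z + G.off e) =
      height U (G.disp T e) + (q (G.src e) - q (G.tgt e)) := by
  rw [tilt, tilt, height_loc_tgt]
  ring

/-- Some superlevel set of the perturbed height has at most the average energy. -/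
theorem exists_graphEnergy_level_le [Fintype E] (hT : 0 < T) (U : Space n ≃ₗᵢ[ℝ] Space n)
    {R C M ρ : ℝ} (hR : ∀ e, ‖G.disp T e‖ ≤ R) {q : P → ℝ} (hq : ∀ p, |q p| ≤ C) (hM : 0 < M) :
    ∃ τ, 0 ≤ τ ∧ τ ≤ M ∧ M * G.graphEnergy T (G.level (T := T) U q τ) (rotatedCube U ρ) ≤
      ∑ e, G.cap e * (max (height U (G.disp T e) + (q (G.src e) - q (G.tgt e))) 0 *
        G.edgeCount T U e (-C) (M + C + R) ρ) := by
  classical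
  obtain ⟨τ, h0, h1, h2⟩ := exists_average_le
    (Finset.univ.sigma fun e : E => latticePoints T (rotatedCube U ρ) (G.pos (G.src e)))
    (c := fun i => G.cap i.1)
    (a := fun i => G.tilt (T := T) U q (G.tgt i.1) (i.2 + G.off i.1))
    (b := fun i => G.tilt (T := T) U q (G.src i.1) i.2) (fun i => G.cap_nonneg i.1) hM
  refine ⟨τ, h0, h1, ?_⟩
  rw [Finset.sum_sigma, Finset.sum_sigma] at h2
  simp only [← max_diff_level, tilt_src_sub_tilt_tgt, ← Finset.mul_sum] at h2
  refine h2.trans (Finset.sum_le_sum fun e _ => mul_le_mul_of_nonneg_left ?_ (G.cap_nonneg e))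
  rw [← Finset.sum_filter, Finset.sum_const, nsmul_eq_mul, mul_comm]
  refine mul_le_mul_of_nonneg_left ?_ (le_max_right _ _)
  rw [edgeCount, slabCount]
  refine Nat.cast_le.2 (Finset.card_le_card fun z hz => ?_)
  -- Tilted height at least `0` at the source and below `M` at the target; as the tilt changes
  -- heights by at most `C`, the source height lies in `[-C, M + C + R)`.
  obtain ⟨hz1, hz2, hz3⟩ := Finset.mem_filter.1 hz
  rw [mem_latticePoints_rotatedCube hT] at hz1
  rw [mem_latticePoints_slab hT]
  have hη := abs_le.1 ((abs_height_le U (G.disp T e)).trans (hR e))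
  have hq1 := abs_le.1 (hq (G.src e))
  have hq2 := abs_le.1 (hq (G.tgt e))
  rw [tilt, height_loc_tgt] at hz2
  rw [tilt] at hz3
  refine mem_slab_of_mem_rotatedCube hz1 ?_ ?_
  · change -C ≤ height U (G.loc T (G.src e) z)
    linarith
  · change height U (G.loc T (G.src e) z) < _
    linarith

open Classical in
/-- The function that agrees with `g` in a cube and with the half-space indicator outside. -/
def glue (U : Space n ≃ₗᵢ[ℝ] Space n) (g : P → (Fin (n + 1) → ℤ) → ℝ) (ρ : ℝ) (p : P)
    (z : Fin (n + 1) → ℤ) : ℝ :=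
  if G.loc T p z ∈ rotatedCube U ρ then g p z else G.half T U p z

/-- The superlevel set and the half-space agree outside the heights `[-C, M + C)`. Gluing therefore
adds cut edges only near the lateral boundary of the cube and at bounded heights; the last sum
counts that shell. -/
theorem graphEnergy_glue_level_le [Fintype E] (hT : 0 < T) (U : Space n ≃ₗᵢ[ℝ] Space n)
    {R C M ρ S τ : ℝ} (hR0 : 0 < R) (hR : ∀ e, ‖G.disp T e‖ ≤ R) {q : P → ℝ}
    (hC : 0 ≤ C) (hq : ∀ p, |q p| ≤ C) (hM : 0 < M) (hτ0 : 0 ≤ τ) (hτ : τ ≤ M)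
    (hρ : 2 * (M + C + 2 * R) ≤ ρ - 2 * R) (hS : ρ + 2 * R ≤ S) :
    G.graphEnergy T (G.glue (T := T) U (G.level (T := T) U q τ) ρ) (rotatedCube U S) ≤
      G.graphEnergy T (G.level (T := T) U q τ) (rotatedCube U ρ) +
      (G.graphEnergy T (G.half T U) (rotatedCube U S) -
        G.graphEnergy T (G.half T U) (rotatedCube U ρ)) +
      ∑ e, G.cap e * (G.edgeCount T U e (-(M + C + 2 * R)) (M + C + 2 * R) (ρ + 2 * R) -
        G.edgeCount T U e (-(M + C + 2 * R)) (M + C + 2 * R) (ρ - 2 * R)) := by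
  classical
  set C' := M + C + 2 * R with hC'
  set g := G.level (T := T) U q τ with hg
  set u := G.glue (T := T) U g ρ with hu
  have hb := isBounded_rotatedCube U S
  have hg01 : ∀ p z, g p z = 0 ∨ g p z = 1 := by
    intro p z
    simp only [hg, level]
    split_ifs <;> simp
  have hh01 : ∀ p z, G.half T U p z = 0 ∨ G.half T U p z = 1 := by
    intro p z
    simp only [half]
    split_ifs <;> simp
  have hu01 : ∀ p z, 0 ≤ u p z ∧ u p z ≤ 1 := by
    intro p z
    simp only [hu, glue]
    split_ifs
    · rcases hg01 p z with h | h <;> rw [h] <;> norm_num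
    · rcases hh01 p z with h | h <;> rw [h] <;> norm_num
  have hhigh : ∀ p z, M + C ≤ height U (G.loc T p z) → u p z = 1 := by
    intro p z h
    have hq1 := abs_le.1 (hq p)
    have h1 : τ ≤ G.tilt (T := T) U q p z := by rw [tilt]; linarith
    have h2 : 0 ≤ height U (G.loc T p z) := by linarith
    simp only [hu, glue, hg, level, half, if_pos h1, if_pos h2, ite_self]
  have hlow : ∀ p z, height U (G.loc T p z) < -C → u p z = 0 := by
    intro p z h
    have hq1 := abs_le.1 (hq p)
    have h1 : ¬ τ ≤ G.tilt (T := T) U q p z := by rw [tilt]; linarith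
    have h2 : ¬ 0 ≤ height U (G.loc T p z) := by linarith
    simp only [hu, glue, hg, level, half, if_neg h1, if_neg h2, ite_self]
  have hpt : ∀ e z, max (G.diff u e z) 0 ≤
      (if G.loc T (G.src e) z ∈ rotatedCube U ρ then max (G.diff g e z) 0 else 0) +
      (max (G.diff (G.half T U) e z) 0 - if G.loc T (G.src e) z ∈ rotatedCube U ρ then
        max (G.diff (G.half T U) e z) 0 else 0) +
      ((if G.loc T (G.src e) z ∈ slab U (-C') C' (ρ + 2 * R) then 1 else 0) -
        if G.loc T (G.src e) z ∈ slab U (-C') C' (ρ - 2 * R) then 1 else 0) := by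
    intro e z
    have hmono : G.loc T (G.src e) z ∈ slab U (-C') C' (ρ - 2 * R) →
        G.loc T (G.src e) z ∈ slab U (-C') C' (ρ + 2 * R) :=
      fun h => slab_mono le_rfl le_rfl (by linarith) h
    have hnn : (0 : ℝ) ≤ (if G.loc T (G.src e) z ∈ slab U (-C') C' (ρ + 2 * R) then 1 else 0) -
        if G.loc T (G.src e) z ∈ slab U (-C') C' (ρ - 2 * R) then 1 else 0 := by
      split_ifs <;> simp_all
    have hη := abs_le.1 ((abs_height_le U (G.disp T e)).trans (hR e))
    have ht := G.height_loc_tgt (T := T) U e z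
    -- In the shell an edge costs at most `1` and is counted once if its height is below `C'` in
    -- modulus; otherwise `u` has the same value at both ends.
    have hmixed : G.loc T (G.src e) z ∈ rotatedCube U (ρ + 2 * R) →
        ¬ G.loc T (G.src e) z ∈ rotatedCube U (ρ - 2 * R) →
        max (G.diff u e z) 0 ≤
        (if G.loc T (G.src e) z ∈ slab U (-C') C' (ρ + 2 * R) then 1 else 0) -
        if G.loc T (G.src e) z ∈ slab U (-C') C' (ρ - 2 * R) then 1 else 0 := by
      intro h1 h2
      by_cases hs : -C' ≤ height U (G.loc T (G.src e) z) ∧ height U (G.loc T (G.src e) z) < C'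
      · rw [if_pos (mem_slab_of_mem_rotatedCube h1 hs.1 hs.2), if_neg fun h => h2
          (slab_subset_rotatedCube (by linarith) (by linarith) le_rfl h), sub_zero]
        refine max_le ?_ zero_le_one
        have h3 := hu01 (G.src e) z
        have h4 := hu01 (G.tgt e) (z + G.off e)
        simp only [diff]
        linarith [h3.2, h4.1]
      · refine le_trans (le_of_eq ?_) hnn
        rcases lt_or_ge (height U (G.loc T (G.src e) z)) (-C') with h3 | h3
        · rw [diff, hlow _ _ (by linarith), hlow _ _ (by linarith)]
          simp
        · have h4 : C' ≤ height U (G.loc T (G.src e) z) := by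
            by_contra h4
            exact hs ⟨h3, not_le.1 h4⟩
          rw [diff, hhigh _ _ (by linarith), hhigh _ _ (by linarith)]
          simp
    have hhalf : 0 ≤ max (G.diff (G.half T U) e z) 0 := le_max_right _ _
    have hgg : 0 ≤ max (G.diff g e z) 0 := le_max_right _ _
    by_cases ha : G.loc T (G.src e) z ∈ rotatedCube U ρ <;>
      by_cases hb : G.loc T (G.tgt e) (z + G.off e) ∈ rotatedCube U ρ
    · rw [if_pos ha, if_pos ha]
      have : G.diff u e z = G.diff g e z := by simp [diff, hu, glue, ha, hb]
      rw [this]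
      linarith
    · rw [if_pos ha, if_pos ha]
      have := hmixed (rotatedCube_mono (by linarith) ha) fun h => hb (by
        have := G.loc_tgt_mem (hR e) h
        rwa [sub_add_cancel] at this)
      linarith
    · rw [if_neg ha, if_neg ha]
      have := hmixed (G.loc_src_mem (hR e) hb) fun h => ha (rotatedCube_mono (by linarith) h)
      linarith
    · rw [if_neg ha, if_neg ha]
      have : G.diff u e z = G.diff (G.half T U) e z := by simp [diff, hu, glue, ha, hb]
      rw [this]
      linarith
  simp only [graphEnergy]
  rw [← Finset.sum_sub_distrib, ← Finset.sum_add_distrib, ← Finset.sum_add_distrib]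
  refine Finset.sum_le_sum fun e _ => ?_
  rw [← mul_sub, ← mul_add, ← mul_add]
  refine mul_le_mul_of_nonneg_left ?_ (G.cap_nonneg e)
  rw [sum_latticePoints_subset hT (rotatedCube_mono (U := U) (by linarith : ρ ≤ S)) hb,
    sum_latticePoints_subset hT (rotatedCube_mono (U := U) (by linarith : ρ ≤ S)) hb,
    G.edgeCount_eq_sum hT U e (slab_subset_rotatedCube (by linarith) (by linarith) hS) hb,
    G.edgeCount_eq_sum hT U e (slab_subset_rotatedCube (by linarith) (by linarith)
      (by linarith)) hb, ← Finset.sum_sub_distrib, ← Finset.sum_sub_distrib,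
    ← Finset.sum_add_distrib, ← Finset.sum_add_distrib]
  exact Finset.sum_le_sum fun z _ => hpt e z

/-- As in the lower bound, `M` is fixed before `S → ∞`. Averaging over `M` levels a slab of
thickness `M + O(1)` gives `T^{-d}` per edge type up to `O(1/M)`, weighted by the tilted difference.
-/
theorem eventually_graphEnergy_le [Fintype E] (hT : 0 < T) (U : Space n ≃ₗᵢ[ℝ] Space n) {R C : ℝ}
    (hR0 : 0 < R) (hR : ∀ e, ‖G.disp T e‖ ≤ R) {q : P → ℝ} (hC : 0 ≤ C) (hq : ∀ p, |q p| ≤ C)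
    {l ε : ℝ} (hl0 : 0 < l) (hl1 : l < 1) (hε : 0 < ε) :
    ∀ᶠ S in Filter.atTop, ∃ u : P → (Fin (n + 1) → ℤ) → ℝ,
      (∀ p z, u p z = 0 ∨ u p z = 1) ∧
      (∀ p z, G.loc T p z ∉ rotatedCube U (l * S) → u p z = G.half T U p z) ∧
      G.graphEnergy T u (rotatedCube U S) ≤
      (l ^ n * (((T : ℝ) ^ (n + 1))⁻¹ * ∑ e, G.cap e *
        max (height U (G.disp T e) + (q (G.src e) - q (G.tgt e))) 0) +
        (1 - l ^ n) * G.halfDensity T U + ε) * S ^ n := by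
  set D : ℝ := (T : ℝ) ^ (n + 1) with hD
  have hD0 : 0 < D := by positivity
  set K : ℝ := (n + 1) * T with hK
  have hK0 : 0 ≤ K := by positivity
  set η : E → ℝ := fun e => height U (G.disp T e) with hη
  set θ : E → ℝ := fun e => max (η e + (q (G.src e) - q (G.tgt e))) 0 with hθ
  have hθ0 : ∀ e, 0 ≤ θ e := fun e => le_max_right _ _
  -- The slab `[-C, M + C + R)` exceeds thickness `M` by `2 C + R`; the density bound adds `2 K`.
  set Q : ℝ := ∑ e, G.cap e * (θ e * ((2 * C + R + 2 * K) / D)) with hQ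
  have hQ0 : 0 ≤ Q := Finset.sum_nonneg fun e _ => mul_nonneg (G.cap_nonneg e)
    (mul_nonneg (hθ0 e) (by positivity))
  obtain ⟨M, hM⟩ := exists_gt (max 1 (Q / ε))
  have hM0 : 0 < M := by linarith [(le_max_left _ _).trans_lt hM]
  have hMQ : Q / M < ε := by
    have := (le_max_right _ _).trans_lt hM
    rw [div_lt_iff₀ hε] at this
    rw [div_lt_iff₀ hM0]
    linarith
  set C' := M + C + 2 * R with hC'
  set F : E → ℝ → ℝ := fun e S =>
    G.cap e * (θ e * G.edgeCount T U e (-C) (M + C + R) (l * S)) / M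
    + G.cap e * (G.edgeCount T U e 0 (η e) S - G.edgeCount T U e 0 (η e) (l * S))
    + G.cap e * (G.edgeCount T U e (-C') C' (l * S + 2 * R) -
        G.edgeCount T U e (-C') C' (l * S + -(2 * R))) with hF
  set f : E → ℝ := fun e =>
    G.cap e * (θ e * (l ^ n * G.edgeDensity T U e (-C) (M + C + R))) / M
    + G.cap e * (G.edgeDensity T U e 0 (η e) - l ^ n * G.edgeDensity T U e 0 (η e))
    + G.cap e * (l ^ n * G.edgeDensity T U e (-C') C' -
        l ^ n * G.edgeDensity T U e (-C') C') with hf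
  have hlim : Filter.Tendsto (fun S => (∑ e, F e S) / S ^ n) Filter.atTop (𝓝 (∑ e, f e)) := by
    simp_rw [Finset.sum_div]
    refine tendsto_finsetSum _ fun e _ => ?_
    have h1 := ((((G.tendsto_edgeCount_mul hT U e (-C) (M + C + R) hl0).const_mul
      (θ e)).const_mul (G.cap e)).div_const M).add
      (((G.tendsto_edgeCount hT U e 0 (η e)).sub
      (G.tendsto_edgeCount_mul hT U e 0 (η e) hl0)).const_mul (G.cap e))
    refine (h1.add (((G.tendsto_edgeCount_affine hT U e (-C') C' hl0 (2 * R)).sub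
        (G.tendsto_edgeCount_affine hT U e (-C') C' hl0 (-(2 * R)))).const_mul (G.cap e))).congr
      fun S => ?_
    simp only [hF]
    ring
  have hbound : ∑ e, f e < l ^ n * (D⁻¹ * ∑ e, G.cap e * θ e) + (1 - l ^ n) * G.halfDensity T U
      + ε := by
    have hfe : ∀ e, f e ≤ l ^ n * (D⁻¹ * (G.cap e * θ e)) +
        (1 - l ^ n) * (G.cap e * G.edgeDensity T U e 0 (η e)) +
        l ^ n * (G.cap e * (θ e * ((2 * C + R + 2 * K) / D)) / M) := by
      intro e
      have h1 : G.edgeDensity T U e (-C) (M + C + R) * D ≤ M + C + R - -C + 2 * K :=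
        slabDensity_le hT U _ (by linarith)
      have h2 : G.edgeDensity T U e (-C) (M + C + R) / M ≤
          D⁻¹ + (2 * C + R + 2 * K) / D / M := by
        rw [← mul_le_mul_iff_left₀ (mul_pos hD0 hM0)]
        have e1 : (D⁻¹ + (2 * C + R + 2 * K) / D / M) * (D * M) = M + (2 * C + R + 2 * K) := by
          field_simp
        have e2 : G.edgeDensity T U e (-C) (M + C + R) / M * (D * M) =
          G.edgeDensity T U e (-C) (M + C + R) * D := by field_simp
        rw [e1, e2]
        linarith
      have h3 := mul_le_mul_of_nonneg_left h2 (mul_nonneg (mul_nonneg (pow_nonneg hl0.le n)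
        (G.cap_nonneg e)) (hθ0 e))
      simp only [hf]
      linear_combination h3
    have hs := Finset.sum_le_sum fun e (_ : e ∈ Finset.univ) => hfe e
    refine hs.trans_lt ?_
    rw [Finset.sum_add_distrib, Finset.sum_add_distrib, ← Finset.mul_sum, ← Finset.mul_sum,
      ← Finset.mul_sum, ← Finset.mul_sum, ← Finset.sum_div]
    have hln : l ^ n ≤ 1 := pow_le_one₀ hl0.le hl1.le
    have : l ^ n * (Q / M) ≤ 1 * (Q / M) := by gcongr
    have e0 : G.halfDensity T U = ∑ e, G.cap e * G.edgeDensity T U e 0 (η e) := rfl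
    rw [e0]
    linarith
  filter_upwards [hlim.eventually_lt_const hbound, Filter.eventually_gt_atTop 0,
    Filter.eventually_ge_atTop ((2 * C' + 2 * R) / l),
    Filter.eventually_ge_atTop (2 * R / (1 - l))] with S hS1 hS0 hS2 hS3
  rw [div_le_iff₀ hl0] at hS2
  rw [div_le_iff₀ (by linarith)] at hS3
  obtain ⟨τ, hτ0, hτ1, hτ⟩ := G.exists_graphEnergy_level_le (ρ := l * S) hT U hR hq hM0
  have h1 := G.graphEnergy_glue_level_le (ρ := l * S) (S := S) hT U hR0 hR hC hq hM0 hτ0 hτ1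
    (by linarith) (by linarith)
  refine ⟨G.glue (T := T) U (G.level (T := T) U q τ) (l * S), fun p z => ?_,
    fun p z hz => if_neg hz, h1.trans ?_⟩
  · simp only [glue, level, half]
    split_ifs <;> simp
  rw [G.graphEnergy_half hT U hR (by linarith) (by linarith),
    G.graphEnergy_half hT U hR (by linarith) (by linarith)]
  have h2 : G.graphEnergy T (G.level (T := T) U q τ) (rotatedCube U (l * S)) ≤
      (∑ e, G.cap e * (θ e * G.edgeCount T U e (-C) (M + C + R) (l * S))) / M := by
    rw [le_div_iff₀ hM0, mul_comm]
    exact hτ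
  have h3 : ∑ e, F e S ≤ (l ^ n * (D⁻¹ * ∑ e, G.cap e * θ e) +
      (1 - l ^ n) * G.halfDensity T U + ε) * S ^ n := by
    rw [← div_le_iff₀ (by positivity)]
    exact hS1.le
  refine le_trans ?_ h3
  rw [sub_eq_add_neg (l * S) (2 * R)]
  simp only [hF, Finset.sum_add_distrib, Finset.sum_sub_distrib, mul_sub, ← Finset.sum_div]
  linarith

end PeriodicGraph

end LatticeEnergy

namespace LatticeEnergy

variable {n : ℕ}

/-! ### Duality between circulations and potentials -/

namespace PeriodicGraph

variable {P E : Type*} (G : PeriodicGraph n P E)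

open Classical in
/-- The net flow out of the nodes of the quotient graph. -/
def netFlow [Fintype E] : (E → ℝ) →ₗ[ℝ] (P → ℝ) where
  toFun β p := ∑ e, β e * ((if G.src e = p then 1 else 0) - if G.tgt e = p then 1 else 0)
  map_add' β γ := by
    funext p
    simp only [Pi.add_apply, add_mul, Finset.sum_add_distrib]
  map_smul' r β := by
    funext p
    simp only [Pi.smul_apply, smul_eq_mul, mul_assoc, Finset.mul_sum, RingHom.id_apply]

theorem sum_mul_netFlow [Fintype E] [Fintype P] (β : E → ℝ) (q : P → ℝ) :
    ∑ p, q p * G.netFlow β p = ∑ e, β e * (q (G.src e) - q (G.tgt e)) := by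
  classical
  simp only [netFlow, LinearMap.coe_mk, AddHom.coe_mk, Finset.mul_sum]
  rw [Finset.sum_comm]
  refine Finset.sum_congr rfl fun e _ => ?_
  calc _ = ∑ p, β e * ((if G.src e = p then q p else 0) - if G.tgt e = p then q p else 0) := by
        refine Finset.sum_congr rfl fun p _ => ?_
        split_ifs <;> ring
    _ = _ := by
        rw [← Finset.mul_sum, Finset.sum_sub_distrib]
        simp

theorem isCirculation_iff [Fintype E] [Fintype P] {β : E → ℝ} :
    G.IsCirculation β ↔ G.netFlow β = 0 := by
  classical
  constructor
  · intro h
    funext p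
    have := h (Pi.single p 1)
    rw [← G.sum_mul_netFlow] at this
    simpa [Pi.single_apply] using this
  · intro h q
    rw [← G.sum_mul_netFlow, h]
    simp

/-- Linear programming duality by separation. The compact convex set of pairs (net flow, gain) of
box vectors misses `{0} × [m + ε, ∞)`; a separating functional `(g, s)` has `s > 0`, and `g / s` is
the potential. -/
theorem exists_potential [Fintype E] [Fintype P] (η : E → ℝ) {m ε : ℝ} (hε : 0 < ε)
    (hm : ∀ β : E → ℝ, G.IsCirculation β → (∀ e, 0 ≤ β e) → (∀ e, β e ≤ G.cap e) →
      ∑ e, β e * η e ≤ m) :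
    ∃ q : P → ℝ, ∑ e, G.cap e * max (η e + (q (G.src e) - q (G.tgt e))) 0 ≤ m + ε := by
  classical
  have hm0 : 0 ≤ m := by
    have := hm 0 (fun q => by simp) (fun e => le_rfl) (fun e => G.cap_nonneg e)
    simpa using this
  let A : (E → ℝ) →ₗ[ℝ] (P → ℝ) × ℝ :=
    G.netFlow.prod (∑ e, (LinearMap.proj e : (E → ℝ) →ₗ[ℝ] ℝ).smulRight (η e))
  have hA : ∀ β, A β = (G.netFlow β, ∑ e, β e * η e) := by
    intro β
    simp [A]
  have hconv : Convex ℝ (A '' Set.Icc 0 G.cap) := (convex_Icc 0 G.cap).linear_image A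
  have hcomp : IsCompact (A '' Set.Icc 0 G.cap) :=
    isCompact_Icc.image (LinearMap.continuous_of_finiteDimensional A)
  have hdisj : Disjoint (A '' Set.Icc 0 G.cap) (({0} : Set (P → ℝ)) ×ˢ Set.Ici (m + ε)) := by
    refine Set.disjoint_left.2 ?_
    rintro _ ⟨β, hβ, rfl⟩ h
    rw [hA] at h
    obtain ⟨h1, h2⟩ := h
    have h3 := hm β (G.isCirculation_iff.2 h1) (fun e => hβ.1 e) (fun e => hβ.2 e)
    have h4 : m + ε ≤ ∑ e, β e * η e := h2
    linarith
  obtain ⟨f, a, b, hfa, hab, hfb⟩ := geometric_hahn_banach_compact_closed hconv hcomp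
    ((convex_singleton 0).prod (convex_Ici (m + ε))) (isClosed_singleton.prod isClosed_Ici) hdisj
  set s : ℝ := f (0, 1) with hs
  set g : P → ℝ := fun p => f (Pi.single p 1, 0) with hg
  have hf : ∀ x y, f (x, y) = ∑ p, g p * x p + s * y := by
    intro x y
    have h1 : ((x, y) : (P → ℝ) × ℝ) =
        ∑ p, x p • ((Pi.single p 1, 0) : (P → ℝ) × ℝ) + y • ((0, 1) : (P → ℝ) × ℝ) := by
      refine Prod.ext ?_ ?_
      · rw [Prod.fst_add, Prod.fst_sum]
        funext i
        simp [Finset.sum_apply, Pi.single_apply]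
      · rw [Prod.snd_add, Prod.snd_sum]
        simp
    rw [h1, map_add, map_sum]
    simp only [map_smul, smul_eq_mul, hs, hg]
    congr 1
    · exact Finset.sum_congr rfl fun p _ => mul_comm _ _
    · exact mul_comm _ _
  have ha0 : 0 < a := by
    have := hfa 0 ⟨0, ⟨le_rfl, fun e => G.cap_nonneg e⟩, map_zero A⟩
    simpa using this
  have hbm : b < s * (m + ε) := by
    have := hfb (0, m + ε) ⟨rfl, le_refl (m + ε)⟩
    rw [hf] at this
    simpa using this
  -- The zero flow gives `0 < a < b < s (m + ε)`, and `m + ε > 0`.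
  have hs0 : 0 < s := by
    by_contra h
    nlinarith [not_lt.1 h]
  refine ⟨fun p => g p / s, ?_⟩
  -- This vertex of the box maximizes the separating functional, whose value there is the sum of
  -- positive parts to be bounded.
  set β : E → ℝ := fun e => if 0 ≤ s * η e + (g (G.src e) - g (G.tgt e)) then G.cap e else 0
    with hβ
  have h1 := hfa (A β) ⟨β, ⟨fun e => by
      simp only [hβ, Pi.zero_apply]; split_ifs; exacts [G.cap_nonneg e, le_rfl], fun e => by
      simp only [hβ]; split_ifs; exacts [le_rfl, G.cap_nonneg e]⟩, rfl⟩
  rw [hA, hf, G.sum_mul_netFlow] at h1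
  have h2 : ∑ e, G.cap e * max (s * η e + (g (G.src e) - g (G.tgt e))) 0 =
      ∑ e, β e * (g (G.src e) - g (G.tgt e)) + s * ∑ e, β e * η e := by
    rw [Finset.mul_sum, ← Finset.sum_add_distrib]
    refine Finset.sum_congr rfl fun e _ => ?_
    simp only [hβ]
    split_ifs with h
    · rw [max_eq_left h]
      ring
    · rw [max_eq_right (not_le.1 h).le]
      ring
  have h3 : ∑ e, G.cap e * max (s * η e + (g (G.src e) - g (G.tgt e))) 0 =
      s * ∑ e, G.cap e * max (η e + (g (G.src e) / s - g (G.tgt e) / s)) 0 := by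
    rw [Finset.mul_sum]
    refine Finset.sum_congr rfl fun e _ => ?_
    have : s * η e + (g (G.src e) - g (G.tgt e)) =
        s * (η e + (g (G.src e) / s - g (G.tgt e) / s)) := by field_simp
    rw [this]
    nth_rewrite 1 [← mul_zero s]
    rw [← mul_max_of_nonneg _ _ hs0.le]
    ring
  refine le_of_mul_le_mul_left ?_ hs0
  rw [← h3, h2]
  linarith

end PeriodicGraph

/-! ### Linear images of sections of boxes -/

section Polytope

variable {E : Type*} (V : Submodule ℝ (E → ℝ)) (c : E → ℝ)

/-- The section of the box `∏ [0, c e]` by a subspace. -/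
def boxSection : Set (E → ℝ) := (V : Set (E → ℝ)) ∩ Set.univ.pi fun e => Set.Icc 0 (c e)

theorem convex_boxSection : Convex ℝ (boxSection V c) :=
  V.convex.inter (convex_pi fun _ _ => convex_Icc _ _)

variable [Fintype E]

theorem isCompact_boxSection : IsCompact (boxSection V c) :=
  (isCompact_univ_pi fun _ => isCompact_Icc).inter_left V.closed_of_finiteDimensional

/-- Which of the constraints `0 ≤ x e ≤ c e` are active. -/
def activePattern (x : E → ℝ) (e : E) : Fin 3 :=
  if x e = 0 then 0 else if x e = c e then 1 else 2

/-- If extreme points `x` and `y` have the same pattern, then wherever they differ the bounds are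
strict at `x`. So `x ± t (x - y)` stays in the section for small `t`, and extremality of `x` forces
`x = y`. -/
theorem injOn_activePattern :
    Set.InjOn (activePattern c) (Set.extremePoints ℝ (boxSection V c)) := by
  intro x hx y hy hxy
  have hxA := hx.1
  have hyA := hy.1
  have hev : ∀ e, ∀ᶠ t in 𝓝 (0 : ℝ), 0 ≤ x e + t * (x e - y e) ∧ x e + t * (x e - y e) ≤ c e := by
    intro e
    have hxe : 0 ≤ x e ∧ x e ≤ c e := hxA.2 e trivial
    have hpat := congrFun hxy e
    simp only [activePattern] at hpat
    by_cases h0 : x e = y e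
    · filter_upwards with t
      simpa [h0] using h0 ▸ hxe
    · have h1 : 0 < x e := by
        refine lt_of_le_of_ne hxe.1 fun h => ?_
        rw [if_pos h.symm] at hpat
        split_ifs at hpat with h2 h3 <;> simp_all
      have h2 : x e < c e := by
        refine lt_of_le_of_ne hxe.2 fun h => ?_
        rw [if_neg h1.ne', if_pos h] at hpat
        split_ifs at hpat with h2 h3 <;> simp_all
      have hc : Filter.Tendsto (fun t : ℝ => x e + t * (x e - y e)) (𝓝 0) (𝓝 (x e)) := by
        have : Continuous fun t : ℝ => x e + t * (x e - y e) := by fun_prop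
        simpa using this.tendsto 0
      filter_upwards [hc.eventually_const_lt h1, hc.eventually_lt_const h2] with t h3 h4
      exact ⟨h3.le, h4.le⟩
  obtain ⟨r, hr, hball⟩ := Metric.eventually_nhds_iff.1 (Filter.eventually_all.2 hev)
  have hmem : ∀ t : ℝ, |t| < r → x + t • (x - y) ∈ boxSection V c := by
    intro t ht
    refine ⟨V.add_mem hxA.1 (V.smul_mem t (V.sub_mem hxA.1 hyA.1)), fun e _ => ?_⟩
    have := hball (y := t) (by simpa [Real.dist_eq] using ht) e
    simpa using this
  have h1 := hmem (r / 2) (by rw [abs_of_pos (by positivity)]; linarith)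
  have h2 := hmem (-(r / 2)) (by rw [abs_neg, abs_of_pos (by positivity)]; linarith)
  have h3 : x + (r / 2) • (x - y) = x := by
    refine hx.2 h1 h2 ⟨1 / 2, 1 / 2, by norm_num, by norm_num, by norm_num, ?_⟩
    module
  have h4 : (r / 2) • (x - y) = 0 := by simpa using h3
  exact sub_eq_zero.1 ((smul_eq_zero.1 h4).resolve_left (by positivity))

theorem encard_extremePoints_boxSection_le :
    (Set.extremePoints ℝ (boxSection V c)).encard ≤ ((3 ^ Fintype.card E : ℕ) : ℕ∞) := by
  classical
  rw [← (injOn_activePattern V c).encard_image]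
  refine (Set.encard_le_encard (Set.subset_univ _)).trans ?_
  simp [Set.encard_univ]

/-- The fibre of `A` over an extreme point of the image is compact and extremal in `A`; by
Krein–Milman it has an extreme point, which is then extreme in `A`. -/
theorem extremePoints_image_subset {F G : Type*} [AddCommGroup F] [Module ℝ F]
    [TopologicalSpace F] [IsTopologicalAddGroup F] [ContinuousSMul ℝ F] [LocallyConvexSpace ℝ F]
    [T2Space F] [AddCommGroup G] [Module ℝ G] [TopologicalSpace G] [T1Space G] (f : F →ₗ[ℝ] G)
    (hf : Continuous f) {A : Set F} (hA : IsCompact A) :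
    Set.extremePoints ℝ (f '' A) ⊆ f '' Set.extremePoints ℝ A := by
  intro y hy
  obtain ⟨x₀, hx₀, hx₀y⟩ := hy.1
  have hcomp : IsCompact (A ∩ f ⁻¹' {y}) := hA.inter_right (isClosed_singleton.preimage hf)
  obtain ⟨x, hx⟩ := hcomp.extremePoints_nonempty ⟨x₀, hx₀, hx₀y⟩
  have hxy : f x = y := hx.1.2
  refine ⟨x, ⟨hx.1.1, fun x₁ hx₁ x₂ hx₂ hseg => ?_⟩, hxy⟩
  obtain ⟨a, b, ha, hb, hab, hxe⟩ := hseg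
  have hfseg : y ∈ openSegment ℝ (f x₁) (f x₂) := ⟨a, b, ha, hb, hab, by
    rw [← hxy, ← hxe, map_add, map_smul, map_smul]⟩
  have h1 : f x₁ = y := hy.2 ⟨x₁, hx₁, rfl⟩ ⟨x₂, hx₂, rfl⟩ hfseg
  have h2 : f x₂ = y := hy.2 ⟨x₂, hx₂, rfl⟩ ⟨x₁, hx₁, rfl⟩ (by
    rw [openSegment_symm]; exact hfseg)
  exact hx.2 ⟨hx₁, h1⟩ ⟨hx₂, h2⟩ ⟨a, b, ha, hb, hab, hxe⟩

theorem encard_extremePoints_image_boxSection_le (f : (E → ℝ) →ₗ[ℝ] Space n) :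
    (Set.extremePoints ℝ (f '' boxSection V c)).encard ≤ ((3 ^ Fintype.card E : ℕ) : ℕ∞) :=
  (Set.encard_le_encard (extremePoints_image_subset f
    (LinearMap.continuous_of_finiteDimensional f) (isCompact_boxSection V c))).trans
    ((Set.encard_image_le _ _).trans (encard_extremePoints_boxSection_le V c))

/-- Krein–Milman; no closure is needed because the convex hull of finitely many points is closed. -/
theorem isPolytope_image_boxSection (f : (E → ℝ) →ₗ[ℝ] Space n) :
    IsPolytope (f '' boxSection V c) := by
  have hfin : (Set.extremePoints ℝ (f '' boxSection V c)).Finite :=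
    Set.finite_of_encard_le_coe (encard_extremePoints_image_boxSection_le V c f)
  refine ⟨_, hfin, ?_⟩
  rw [← (hfin.isClosed_convexHull ℝ).closure_eq]
  exact (closure_convexHull_extremePoints
    ((isCompact_boxSection V c).image (LinearMap.continuous_of_finiteDimensional f))
    ((convex_boxSection V c).linear_image f)).symm

end Polytope

/-! ### Support functions -/

/-- The support function of a set. -/
def supportFunction (W : Set (Space n)) (ν : Space n) : ℝ := sSup ((fun ζ => inner ℝ ν ζ) '' W)

theorem isLUB_supportFunction {W : Set (Space n)} (hW : IsCompact W) (hne : W.Nonempty)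
    (ν : Space n) : IsLUB ((fun ζ => inner ℝ ν ζ) '' W) (supportFunction W ν) :=
  isLUB_csSup (hne.image _) (hW.image (by fun_prop)).bddAbove

theorem inner_le_supportFunction {W : Set (Space n)} (hW : IsCompact W) {ζ : Space n}
    (hζ : ζ ∈ W) (ν : Space n) : inner ℝ ν ζ ≤ supportFunction W ν :=
  (isLUB_supportFunction hW ⟨ζ, hζ⟩ ν).1 ⟨ζ, hζ, rfl⟩

theorem supportFunction_le {W : Set (Space n)} (hW : IsCompact W) (hne : W.Nonempty)
    {ν : Space n} {r : ℝ} (h : ∀ ζ ∈ W, inner ℝ ν ζ ≤ r) : supportFunction W ν ≤ r :=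
  (isLUB_supportFunction hW hne ν).2 (by rintro _ ⟨ζ, hζ, rfl⟩; exact h ζ hζ)

theorem convexOn_supportFunction {W : Set (Space n)} (hW : IsCompact W) (hne : W.Nonempty) :
    ConvexOn ℝ Set.univ (supportFunction W) := by
  refine ⟨convex_univ, fun x _ y _ a b ha hb _ => supportFunction_le hW hne fun ζ hζ => ?_⟩
  rw [inner_add_left, inner_smul_left, inner_smul_left]
  have h1 := mul_le_mul_of_nonneg_left (inner_le_supportFunction hW hζ x) ha
  have h2 := mul_le_mul_of_nonneg_left (inner_le_supportFunction hW hζ y) hb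
  simpa using add_le_add h1 h2

theorem supportFunction_smul {W : Set (Space n)} (hW : IsCompact W) (hne : W.Nonempty) {t : ℝ}
    (ht : 0 < t) (ν : Space n) : supportFunction W (t • ν) = t * supportFunction W ν := by
  refine le_antisymm (supportFunction_le hW hne fun ζ hζ => ?_) ?_
  · rw [inner_smul_left]
    exact mul_le_mul_of_nonneg_left (inner_le_supportFunction hW hζ ν) ht.le
  · rw [← le_div_iff₀' ht]
    refine supportFunction_le hW hne fun ζ hζ => ?_
    rw [le_div_iff₀' ht]
    have := inner_le_supportFunction hW hζ (t • ν)
    rwa [inner_smul_left] at this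

/-- A point outside `W` is strictly separated from it by a hyperplane, whose normal is nonzero as
`W` is nonempty and may be scaled to unit length by homogeneity. -/
theorem wulffSet_supportFunction {W : Set (Space n)} (hW : IsCompact W) (hconv : Convex ℝ W)
    (hne : W.Nonempty) : wulffSet (supportFunction W) = W := by
  refine Set.Subset.antisymm (fun ζ hζ => ?_) fun ζ hζ ν _ => ?_
  · by_contra hnot
    obtain ⟨f, u, hfu, huf⟩ := geometric_hahn_banach_closed_point hconv hW.isClosed hnot
    set ν := (InnerProductSpace.toDual ℝ (Space n)).symm f with hν
    have hf : ∀ x, f x = inner ℝ ν x := fun x => by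
      rw [hν, InnerProductSpace.toDual_symm_apply]
    have hν0 : ν ≠ 0 := by
      intro h0
      obtain ⟨w, hw⟩ := hne
      have := (hfu w hw).trans huf
      rw [hf, hf, h0] at this
      simp at this
    have hpos : 0 < ‖ν‖ := norm_pos_iff.2 hν0
    have h1 := hζ (‖ν‖⁻¹ • ν) (by rw [norm_smul, norm_inv, norm_norm, inv_mul_cancel₀ hpos.ne'])
    rw [supportFunction_smul hW hne (inv_pos.2 hpos), inner_smul_right, real_inner_comm] at h1
    have h2 := le_of_mul_le_mul_left h1 (inv_pos.2 hpos)
    have h3 : supportFunction W ν ≤ u := supportFunction_le hW hne fun w hw => by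
      rw [← hf]; exact (hfu w hw).le
    rw [hf] at huf
    linarith
  · rw [real_inner_comm]
    exact inner_le_supportFunction hW hζ ν

end LatticeEnergy

namespace LatticeEnergy

variable {n : ℕ} {T : ℕ} {L : Set (Space n)}

/-! ### Finiteness of the cell -/

/-- Finitely many balls of radius `r / 2` cover the bounded set, and each contains at most one point
of `L`. -/
theorem IsDiscreteSet.finite_inter (hL : IsDiscreteSet L) {A : Set (Space n)}
    (hA : Bornology.IsBounded A) : {i : L | (i : Space n) ∈ A}.Finite := by
  obtain ⟨r, hr, hsep⟩ := hL
  obtain ⟨t, -, htf, ht⟩ := Metric.finite_approx_of_totallyBounded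
    (hA.isCompact_closure.totallyBounded.subset subset_closure) (r / 2) (by positivity)
  have hex : ∀ i : L, (i : Space n) ∈ A → ∃ y ∈ t, dist (i : Space n) y < r / 2 := by
    intro i hi
    obtain ⟨y, hy, hiy⟩ := Set.mem_iUnion₂.1 (ht hi)
    exact ⟨y, hy, hiy⟩
  choose! f hf hf' using hex
  refine Set.Finite.of_finite_image (htf.subset ?_) (f := f) ?_
  · rintro _ ⟨i, hi, rfl⟩
    exact hf i hi
  · intro i hi j hj hij
    by_contra hne
    have h1 := hsep i i.2 j j.2 fun h => hne (Subtype.ext h)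
    have h2 := hf' i hi
    have h3 := hf' j hj
    rw [← hij] at h3
    have := dist_triangle_right (i : Space n) j (f i)
    linarith

theorem isBounded_cube (ρ : ℝ) : Bornology.IsBounded (cube n ρ) := by
  rw [← rotatedCube_refl]
  exact isBounded_rotatedCube _ _

theorem finite_cell (hL : IsDiscreteSet L) (T : ℕ) :
    Finite {i : L // (i : Space n) ∈ cube n T} :=
  (hL.finite_inter (isBounded_cube (T : ℝ))).to_subtype

theorem finite_edges (hL : IsDiscreteSet L) {c : L → L → ℝ≥0} (hc : HasFiniteRange c) (T : ℕ) :
    (edges T c).Finite := by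
  obtain ⟨R, hR1, hR⟩ := hc
  refine ((hL.finite_inter (isBounded_cube (T : ℝ))).prod (hL.finite_inter
    (Metric.isBounded_closedBall (x := (0 : Space n)) (r := (n + 1) * T + R)))).subset ?_
  rintro ⟨i, j⟩ ⟨h1, h2⟩
  refine ⟨h1, ?_⟩
  have h3 : dist (i : Space n) j < R := by
    by_contra h
    exact h2 (hR i j (not_lt.1 h))
  have h4 : ‖(i : Space n)‖ ≤ (n + 1) * T := norm_le_of_mem_cube h1
  have h5 := dist_triangle_left (j : Space n) 0 i
  rw [dist_zero_right (i : Space n)] at h5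
  simp only [Set.mem_ofPred_eq, Metric.mem_closedBall]
  linarith

/-! ### Translations of a periodic set -/

/-- The translate of a point of a periodic set by `T z`. -/
def translate (hL : IsPeriodicSet T L) (i : L) (z : Fin (n + 1) → ℤ) : L :=
  ⟨i + shift T z, by
    have h : (i : Space n) + shift T z ∈ (fun x => x + shift T z) '' L := ⟨i, i.2, rfl⟩
    rwa [hL z] at h⟩

variable (hL : IsPeriodicSet T L)

theorem coe_translate (i : L) (z : Fin (n + 1) → ℤ) :
    (translate hL i z : Space n) = i + shift T z := rfl

theorem translate_translate (i : L) (z w : Fin (n + 1) → ℤ) :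
    translate hL (translate hL i z) w = translate hL i (z + w) :=
  Subtype.ext (by simp only [coe_translate, shift_add, add_assoc])

theorem translate_zero (i : L) : translate hL i 0 = i :=
  Subtype.ext (by simp [coe_translate, shift_zero])

theorem IsPeriodicKernel.apply_translate {X : Type} {a : L → L → X} (ha : IsPeriodicKernel T a)
    (i j : L) (z : Fin (n + 1) → ℤ) :
    a (translate hL i z) (translate hL j z) = a i j := ha z i j _ _ rfl rfl

/-- The representative of `i` in the cell `L ∩ Q_T`. -/
def cellRep (hT : 0 < T) (i : L) : {i : L // (i : Space n) ∈ cube n T} :=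
  ⟨translate hL i (-cellIndex T (i : Space n)), by
    rw [coe_translate, shift_neg, ← sub_eq_add_neg]
    exact sub_shift_cellIndex_mem hT _⟩

theorem coe_cellRep (hT : 0 < T) (i : L) :
    (cellRep hL hT i : L) = translate hL i (-cellIndex T (i : Space n)) := rfl

theorem translate_cellRep (hT : 0 < T) (i : L) :
    translate hL (cellRep hL hT i : L) (cellIndex T (i : Space n)) = i := by
  rw [coe_cellRep, translate_translate, neg_add_cancel, translate_zero]

theorem cellIndex_translate (hT : 0 < T) (i : L) (z : Fin (n + 1) → ℤ) :
    cellIndex T (translate hL i z : Space n) = cellIndex T (i : Space n) + z :=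
  cellIndex_add_shift hT _ _

theorem cellRep_translate (hT : 0 < T) (i : L) (z : Fin (n + 1) → ℤ) :
    cellRep hL hT (translate hL i z) = cellRep hL hT i := by
  refine Subtype.ext ?_
  rw [coe_cellRep, coe_cellRep, translate_translate, cellIndex_translate hL hT]
  congr 1
  abel

theorem cellRep_coe (hT : 0 < T) (p : {i : L // (i : Space n) ∈ cube n T}) : cellRep hL hT p.1 = p := by
  refine Subtype.ext ?_
  rw [coe_cellRep, cellIndex_eq_zero hT p.2, neg_zero, translate_zero]

/-! ### The quotient graph -/

/-- The quotient of the interaction graph of `c` by the translations `T ℤ^d`. -/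
def quotientGraph (hT : 0 < T) (c : L → L → ℝ≥0) :
    PeriodicGraph n {i : L // (i : Space n) ∈ cube n T} (edges T c) where
  pos p := p.1
  src e := ⟨e.1.1, e.2.1⟩
  tgt e := cellRep hL hT e.1.2
  off e := cellIndex T (e.1.2 : Space n)
  cap e := c e.1.1 e.1.2
  cap_nonneg _ := NNReal.coe_nonneg _

variable {c : L → L → ℝ≥0}

theorem loc_quotientGraph (hT : 0 < T) (p : {i : L // (i : Space n) ∈ cube n T}) (z : Fin (n + 1) → ℤ) :
    (quotientGraph hL hT c).loc T p z = translate hL p.1 z := rfl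

theorem disp_quotientGraph (hT : 0 < T) (e : edges T c) :
    (quotientGraph hL hT c).disp T e = (e.1.1 : Space n) - e.1.2 := by
  have h : (e.1.2 : Space n) =
      (cellRep hL hT e.1.2 : Space n) + shift T (cellIndex T (e.1.2 : Space n)) := by
    rw [← coe_translate hL, translate_cellRep]
  simp only [PeriodicGraph.disp, quotientGraph]
  rw [sub_sub, ← h]

theorem norm_disp_le (hT : 0 < T) {R : ℝ} (hR : ∀ i j : L, R ≤ dist (i : Space n) (j : Space n) → c i j = 0)
    (e : edges T c) : ‖(quotientGraph hL hT c).disp T e‖ ≤ R := by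
  rw [disp_quotientGraph, ← dist_eq_norm]
  by_contra h
  exact e.2.2 (hR _ _ (not_le.1 h).le)

theorem diff_quotientGraph (hT : 0 < T) (u : L → ℝ) (e : edges T c) (z : Fin (n + 1) → ℤ) :
    (quotientGraph hL hT c).diff (fun p z => u (translate hL p.1 z)) e z =
      u (translate hL e.1.1 z) - u (translate hL e.1.2 z) := by
  simp only [PeriodicGraph.diff, quotientGraph]
  rw [add_comm z, ← translate_translate, translate_cellRep]

/-- The edge of the periodic graph with a given type and translation. -/
def edgeTranslate (x : edges T c × (Fin (n + 1) → ℤ)) : L × L :=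
  (translate hL x.1.1.1 x.2, translate hL x.1.1.2 x.2)

/-- The source of an edge lies in the base cell, so the cell index of the translated source recovers
the translation. With `exists_edgeTranslate` this parametrizes the interacting pairs bijectively. -/
theorem edgeTranslate_injective (hT : 0 < T) :
    Function.Injective (edgeTranslate hL : edges T c × (Fin (n + 1) → ℤ) → L × L) := by
  rintro ⟨e, z⟩ ⟨e', z'⟩ h
  have h1 : translate hL e.1.1 z = translate hL e'.1.1 z' := congrArg Prod.fst h
  have h2 : translate hL e.1.2 z = translate hL e'.1.2 z' := congrArg Prod.snd h
  have hz : z = z' := by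
    have h3 := cellIndex_translate hL hT e.1.1 z
    rw [h1, cellIndex_translate hL hT, cellIndex_eq_zero hT e.2.1, cellIndex_eq_zero hT e'.2.1,
      zero_add, zero_add] at h3
    exact h3.symm
  subst hz
  have hinj : ∀ i j : L, translate hL i z = translate hL j z → i = j := by
    intro i j hij
    have := congrArg (fun k => translate hL k (-z)) hij
    simpa [translate_translate, translate_zero] using this
  have h4 : e = e' := Subtype.ext (Prod.ext (hinj _ _ h1) (hinj _ _ h2))
  rw [h4]

theorem exists_edgeTranslate (hT : 0 < T) (hc : IsPeriodicKernel T c) {i j : L} (h : c i j ≠ 0) :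
    ∃ x : edges T c × (Fin (n + 1) → ℤ), edgeTranslate hL x = (i, j) := by
  refine ⟨(⟨(cellRep hL hT i, translate hL j (-cellIndex T (i : Space n))),
    (cellRep hL hT i).2, ?_⟩, cellIndex T (i : Space n)), ?_⟩
  · simp only [coe_cellRep]
    rwa [hc.apply_translate hL]
  · simp only [edgeTranslate, translate_cellRep, translate_translate, neg_add_cancel,
      translate_zero]

/-- The double sum is reindexed by edge type and translation; boundedness of `A` leaves finitely
many terms, so the `ℝ≥0∞` energy is a real number. -/
theorem energy_eq_graphEnergy (hT : 0 < T) [Fintype (edges T c)] (hc : IsPeriodicKernel T c) (u : L → ℝ)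
    {A : Set (Space n)} (hA : Bornology.IsBounded A) :
    energy c u A = ENNReal.ofReal
      ((quotientGraph hL hT c).graphEnergy T (fun p z => u (translate hL p.1 z)) A) := by
  classical
  set H : L × L → ℝ≥0∞ := fun x => if (x.1 : Space n) ∈ A then
    (c x.1 x.2 : ℝ≥0∞) * ENNReal.ofReal (u x.1 - u x.2) else 0 with hH
  have h1 : energy c u A = ∑' x : L × L, H x := by
    rw [ENNReal.tsum_prod', energy]
    refine (tsum_subtype {i : L | (i : Space n) ∈ A} fun i =>
      ∑' j : L, (c i j : ℝ≥0∞) * ENNReal.ofReal (u i - u j)).trans ?_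
    refine tsum_congr fun i => ?_
    by_cases hi : (i : Space n) ∈ A <;> simp [hH, hi]
  have h2 : Function.support H ⊆ Set.range
      (edgeTranslate hL : edges T c × (Fin (n + 1) → ℤ) → L × L) := by
    rintro ⟨i, j⟩ hij
    refine exists_edgeTranslate hL hT hc fun h0 => hij ?_
    simp [hH, h0]
  rw [h1, ← (edgeTranslate_injective hL hT).tsum_eq h2, ENNReal.tsum_prod', tsum_fintype,
    PeriodicGraph.graphEnergy, ENNReal.ofReal_sum_of_nonneg fun e _ => mul_nonneg
      ((quotientGraph hL hT c).cap_nonneg e) (Finset.sum_nonneg fun z _ => le_max_right _ _)]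
  refine Finset.sum_congr rfl fun e _ => ?_
  rw [ENNReal.ofReal_mul ((quotientGraph hL hT c).cap_nonneg e),
    ENNReal.ofReal_sum_of_nonneg fun z _ => le_max_right _ _, Finset.mul_sum]
  rw [tsum_eq_sum (s := latticePoints T A (e.1.1 : Space n))]
  · refine Finset.sum_congr rfl fun z hz => ?_
    have hz' : (translate hL e.1.1 z : Space n) ∈ A := (mem_latticePoints hT hA).1 hz
    simp only [hH, edgeTranslate, if_pos hz', hc.apply_translate hL, diff_quotientGraph]
    congr 1
    · simp [quotientGraph]
    · rw [ENNReal.ofReal_max, ENNReal.ofReal_zero, max_eq_left zero_le]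
  · intro z hz
    rw [mem_latticePoints hT hA] at hz
    exact if_neg hz

/-! ### Fluxes and circulations -/

theorem tsum_out (hT : 0 < T) [Fintype (edges T c)] {X : Type*} [AddCommMonoid X] [TopologicalSpace X]
    [DecidableEq {i : L // (i : Space n) ∈ cube n T}]
    {F : L → L → X} (hF : ∀ i j, c i j = 0 → F i j = 0)
    (p : {i : L // (i : Space n) ∈ cube n T}) :
    ∑' j : L, F p.1 j =
      ∑ e, if (quotientGraph hL hT c).src e = p then F e.1.1 e.1.2 else 0 := by
  have hinj : Function.Injective
      fun e : {e : edges T c // (quotientGraph hL hT c).src e = p} => (e.1.1.2 : L) := by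
    rintro ⟨e, he⟩ ⟨e', he'⟩ h
    have h1 : e.1.1 = e'.1.1 := congrArg Subtype.val (he.trans he'.symm)
    exact Subtype.ext (Subtype.ext (Prod.ext h1 h))
  have hsupp : Function.support (fun j : L => F p.1 j) ⊆ Set.range
      fun e : {e : edges T c // (quotientGraph hL hT c).src e = p} => (e.1.1.2 : L) := by
    intro j hj
    exact ⟨⟨⟨(p.1, j), p.2, fun h0 => hj (hF _ _ h0)⟩, rfl⟩, rfl⟩
  rw [← hinj.tsum_eq hsupp, tsum_fintype, ← Finset.sum_filter,
    ← Finset.sum_subtype_eq_sum_filter]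
  refine Finset.sum_bij (fun e _ => e) (by simp) (by simp) (by simp) ?_
  rintro ⟨e, he⟩ _
  have h1 : e.1.1 = p.1 := congrArg Subtype.val he
  simp [h1]

/-- The source of a pair ending at `p` need not lie in the base cell. Translating it there moves `p`
to another representative of the same node, and periodicity preserves the value of `α`. -/
theorem tsum_in (hT : 0 < T) [Fintype (edges T c)] (hc : IsPeriodicKernel T c)
    [DecidableEq {i : L // (i : Space n) ∈ cube n T}] {α : L → L → ℝ}
    (hα : IsPeriodicKernel T α) (hα0 : ∀ i j, c i j = 0 → α i j = 0)
    (p : {i : L // (i : Space n) ∈ cube n T}) :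
    ∑' j : L, α j p.1 =
      ∑ e, if (quotientGraph hL hT c).tgt e = p then α e.1.1 e.1.2 else 0 := by
  set g : {e : edges T c // (quotientGraph hL hT c).tgt e = p} → L := fun e =>
    translate hL e.1.1.1 (-cellIndex T (e.1.1.2 : Space n)) with hg
  have htgt : ∀ e : edges T c, (quotientGraph hL hT c).tgt e = p →
      e.1.2 = translate hL p.1 (cellIndex T (e.1.2 : Space n)) := by
    intro e he
    rw [← he]
    exact (translate_cellRep hL hT _).symm
  have hinj : Function.Injective g := by
    rintro ⟨e, he⟩ ⟨e', he'⟩ h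
    simp only [hg] at h
    have h1 := congrArg (fun k : L => cellIndex T (k : Space n)) h
    simp only [cellIndex_translate hL hT, cellIndex_eq_zero hT e.2.1,
      cellIndex_eq_zero hT e'.2.1, zero_add, neg_inj] at h1
    have h2 : e.1.2 = e'.1.2 := by rw [htgt e he, htgt e' he', h1]
    have h3 := congrArg (fun k : L => translate hL k (cellIndex T (e.1.2 : Space n))) h
    simp only [translate_translate, ← h1, neg_add_cancel, translate_zero] at h3
    exact Subtype.ext (Subtype.ext (Prod.ext h3 h2))
  have hsupp : Function.support (fun j : L => α j p.1) ⊆ Set.range g := by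
    intro j hj
    have hcj : c j p.1 ≠ 0 := fun h0 => hj (hα0 _ _ h0)
    refine ⟨⟨⟨(cellRep hL hT j, translate hL p.1 (-cellIndex T (j : Space n))),
      (cellRep hL hT j).2, ?_⟩, ?_⟩, ?_⟩
    · simp only [coe_cellRep]
      rwa [hc.apply_translate hL]
    · simp only [quotientGraph, cellRep_translate, cellRep_coe]
    · simp only [hg, cellIndex_translate hL hT, cellIndex_eq_zero hT p.2, zero_add, neg_neg,
        translate_cellRep]
  rw [← hinj.tsum_eq hsupp, tsum_fintype, ← Finset.sum_filter,
    ← Finset.sum_subtype_eq_sum_filter]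
  refine Finset.sum_bij (fun e _ => e) (by simp) (by simp) (by simp) ?_
  rintro ⟨e, he⟩ _
  have h1 := hα.apply_translate hL e.1.1 e.1.2 (-cellIndex T (e.1.2 : Space n))
  have h2 : translate hL e.1.2 (-cellIndex T (e.1.2 : Space n)) = p.1 := congrArg Subtype.val he
  rw [h2] at h1
  simp [hg, h1]

theorem summable_out [Finite (edges T c)] {α : L → L → ℝ} (hα0 : ∀ i j, c i j = 0 → α i j = 0)
    (p : {i : L // (i : Space n) ∈ cube n T}) : Summable fun j : L => α p.1 j := by
  refine summable_of_hasFiniteSupport ((Set.finite_range fun e : edges T c => e.1.2).subset ?_)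
  intro j hj
  exact ⟨⟨(p.1, j), p.2, fun h0 => hj (hα0 _ _ h0)⟩, rfl⟩

theorem summable_in (hL : IsPeriodicSet T L) (hT : 0 < T) [Finite (edges T c)]
    (hc : IsPeriodicKernel T c) {α : L → L → ℝ} (hα0 : ∀ i j, c i j = 0 → α i j = 0)
    (p : {i : L // (i : Space n) ∈ cube n T}) : Summable fun j : L => α j p.1 := by
  refine summable_of_hasFiniteSupport ((Set.finite_range fun e : edges T c =>
    translate hL e.1.1 (-cellIndex T (e.1.2 : Space n))).subset ?_)
  intro j hj
  have hcj : c j p.1 ≠ 0 := fun h0 => hj (hα0 _ _ h0)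
  refine ⟨⟨(cellRep hL hT j, translate hL p.1 (-cellIndex T (j : Space n))),
    (cellRep hL hT j).2, ?_⟩, ?_⟩
  · simp only [coe_cellRep]
    rwa [hc.apply_translate hL]
  · simp only [cellIndex_translate hL hT, cellIndex_eq_zero hT p.2, zero_add, neg_neg,
      translate_cellRep]

theorem isDivergenceFree_iff (hT : 0 < T) [Fintype (edges T c)]
    [Fintype {i : L // (i : Space n) ∈ cube n T}] (hc : IsPeriodicKernel T c)
    {α : L → L → ℝ} (hα : IsPeriodicKernel T α) (hα0 : ∀ i j, c i j = 0 → α i j = 0) :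
    IsDivergenceFree T α ↔
      (quotientGraph hL hT c).IsCirculation fun e => α e.1.1 e.1.2 := by
  classical
  rw [PeriodicGraph.isCirculation_iff, funext_iff]
  have h : ∀ p : {i : L // (i : Space n) ∈ cube n T}, ∑' j : L, (α j p.1 - α p.1 j) =
      -(quotientGraph hL hT c).netFlow (fun e => α e.1.1 e.1.2) p := by
    intro p
    rw [(summable_in hL hT hc hα0 p).tsum_sub (summable_out hα0 p), tsum_in hL hT hc hα hα0 p,
      tsum_out hL hT hα0 p, ← Finset.sum_sub_distrib]
    simp only [PeriodicGraph.netFlow, LinearMap.coe_mk, AddHom.coe_mk]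
    rw [← Finset.sum_neg_distrib]
    refine Finset.sum_congr rfl fun e _ => ?_
    split_ifs <;> ring
  constructor
  · intro hdiv p
    have := hdiv p.1 p.2
    rw [h p] at this
    simpa using this
  · intro hcirc i hi
    rw [h ⟨i, hi⟩, hcirc ⟨i, hi⟩]
    simp

theorem meanFlux_eq (hL : IsPeriodicSet T L) (hT : 0 < T) [Fintype (edges T c)]
    [Fintype {i : L // (i : Space n) ∈ cube n T}] {α : L → L → ℝ}
    (hα0 : ∀ i j, c i j = 0 → α i j = 0) :
    meanFlux T α = ((T : ℝ) ^ (n + 1))⁻¹ •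
      ∑ e : edges T c, α e.1.1 e.1.2 • ((e.1.1 : Space n) - e.1.2) := by
  classical
  rw [meanFlux, tsum_fintype]
  congr 1
  have h := fun p : {i : L // (i : Space n) ∈ cube n T} => tsum_out (c := c) hL hT
    (F := fun i j : L => α i j • ((i : Space n) - j)) (fun i j h0 => by simp [hα0 i j h0]) p
  rw [Finset.sum_congr rfl fun p _ => h p, Finset.sum_comm]
  simp

/-! ### Periodic extension of functions on the edges -/

open Classical in
/-- The periodic extension of a function on the edges, by zero where `c` vanishes. -/
def periodicExtension (hT : 0 < T) (hc : IsPeriodicKernel T c) (β : edges T c → ℝ) (i j : L) : ℝ :=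
  if h : c i j ≠ 0 then β ⟨(cellRep hL hT i, translate hL j (-cellIndex T (i : Space n))),
    (cellRep hL hT i).2, by
      simp only [coe_cellRep]
      rwa [hc.apply_translate hL]⟩
  else 0

theorem periodicExtension_of_eq_zero (hT : 0 < T) (hc : IsPeriodicKernel T c) (β : edges T c → ℝ)
    {i j : L} (h : c i j = 0) : periodicExtension hL hT hc β i j = 0 :=
  dif_neg (not_not.2 h)

theorem periodicExtension_edge (hT : 0 < T) (hc : IsPeriodicKernel T c) (β : edges T c → ℝ)
    (e : edges T c) : periodicExtension hL hT hc β e.1.1 e.1.2 = β e := by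
  rw [periodicExtension, dif_pos e.2.2]
  congr 1
  refine Subtype.ext (Prod.ext ?_ ?_)
  · exact congrArg Subtype.val (cellRep_coe hL hT ⟨e.1.1, e.2.1⟩)
  · simp [cellIndex_eq_zero hT e.2.1, translate_zero]

theorem isPeriodicKernel_periodicExtension (hT : 0 < T) (hc : IsPeriodicKernel T c)
    (β : edges T c → ℝ) : IsPeriodicKernel T (periodicExtension hL hT hc β) := by
  intro z i j i' j' hi hj
  obtain rfl : i' = translate hL i z := Subtype.ext hi
  obtain rfl : j' = translate hL j z := Subtype.ext hj
  by_cases h : c i j = 0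
  · rw [periodicExtension_of_eq_zero hL hT hc β h, periodicExtension_of_eq_zero hL hT hc β]
    rwa [hc.apply_translate hL]
  · rw [periodicExtension, periodicExtension, dif_pos h,
      dif_pos (by rwa [hc.apply_translate hL])]
    congr 1
    refine Subtype.ext (Prod.ext ?_ ?_)
    · simp only [cellRep_translate]
    · simp only [translate_translate, cellIndex_translate hL hT]
      congr 1
      abel

theorem mem_divergenceFreeVectors_iff (hT : 0 < T) [Fintype (edges T c)]
    [Fintype {i : L // (i : Space n) ∈ cube n T}] (hc : IsPeriodicKernel T c)
    {β : edges T c → ℝ} :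
    β ∈ divergenceFreeVectors T c ↔ (quotientGraph hL hT c).IsCirculation β := by
  constructor
  · rintro ⟨α, hα0, hα, hβ, hdiv⟩
    obtain rfl : β = fun e => α e.1.1 e.1.2 := funext hβ
    exact (isDivergenceFree_iff hL hT hc hα hα0).1 hdiv
  · intro h
    refine ⟨periodicExtension hL hT hc β, fun i j => periodicExtension_of_eq_zero hL hT hc β,
      isPeriodicKernel_periodicExtension hL hT hc β,
      fun e => (periodicExtension_edge hL hT hc β e).symm, ?_⟩
    rw [isDivergenceFree_iff hL hT hc (isPeriodicKernel_periodicExtension hL hT hc β)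
      (fun i j => periodicExtension_of_eq_zero hL hT hc β)]
    simpa only [periodicExtension_edge] using h

end LatticeEnergy

namespace LatticeEnergy

variable {n : ℕ} {T : ℕ} {L : Set (Space n)} {c : L → L → ℝ≥0}

/-! ### The homogenized density -/

variable (T c) in
/-- The linear map that sends a function on the edges to its mean flux. -/
def fluxMap [Fintype (edges T c)] : (edges T c → ℝ) →ₗ[ℝ] Space n :=
  ((T : ℝ) ^ (n + 1))⁻¹ • ∑ e : edges T c,
    (LinearMap.proj e : (edges T c → ℝ) →ₗ[ℝ] ℝ).smulRight ((e.1.1 : Space n) - e.1.2)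

theorem fluxMap_apply [Fintype (edges T c)] (β : edges T c → ℝ) :
    fluxMap T c β = ((T : ℝ) ^ (n + 1))⁻¹ •
      ∑ e : edges T c, β e • ((e.1.1 : Space n) - e.1.2) := by
  simp [fluxMap]

variable (hL : IsPeriodicSet T L)

/-- The mean fluxes of the circulations below the capacities. -/
def fluxSet (hT : 0 < T) (c : L → L → ℝ≥0) [Fintype (edges T c)] : Set (Space n) :=
  fluxMap T c '' boxSection (LinearMap.ker (quotientGraph hL hT c).netFlow)
    fun e => (c e.1.1 e.1.2 : ℝ)

theorem isCompact_fluxSet (hT : 0 < T) [Fintype (edges T c)] : IsCompact (fluxSet hL hT c) :=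
  (isCompact_boxSection _ _).image (LinearMap.continuous_of_finiteDimensional _)

theorem convex_fluxSet (hT : 0 < T) [Fintype (edges T c)] : Convex ℝ (fluxSet hL hT c) :=
  (convex_boxSection _ _).linear_image _

theorem zero_mem_fluxSet (hT : 0 < T) [Fintype (edges T c)] : 0 ∈ fluxSet hL hT c :=
  ⟨0, ⟨Submodule.zero_mem _, fun _ _ => ⟨le_rfl, NNReal.coe_nonneg _⟩⟩, map_zero _⟩

theorem inner_fluxMap [Fintype (edges T c)] (hT : 0 < T) {U : Space n ≃ₗᵢ[ℝ] Space n}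
    {ν : Space n} (hU : U (lastBasisVector n) = ν) (β : edges T c → ℝ) :
    inner ℝ ν (fluxMap T c β) = ((T : ℝ) ^ (n + 1))⁻¹ *
      ∑ e, β e * height U ((quotientGraph hL hT c).disp T e) := by
  rw [fluxMap_apply, inner_smul_right, inner_sum]
  congr 1
  refine Finset.sum_congr rfl fun e _ => ?_
  rw [inner_smul_right, height_eq_inner hU, disp_quotientGraph]

/-- The bounds `0 ≤ α ≤ c` force `α` to vanish where `c` does, so a flux is the periodic extension
of its restriction to the edges. -/
theorem image_meanFlux_admissibleFluxes (hT : 0 < T) [Fintype (edges T c)]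
    [Fintype {i : L // (i : Space n) ∈ cube n T}] (hc : IsPeriodicKernel T c) :
    meanFlux T '' admissibleFluxes T c = fluxSet hL hT c := by
  ext ζ
  constructor
  · rintro ⟨α, ⟨hα, hper, hdiv⟩, rfl⟩
    have hα0 : ∀ i j, c i j = 0 → α i j = 0 := by
      intro i j h0
      have := hα i j
      rw [h0] at this
      exact le_antisymm (by simpa using this.2) this.1
    refine ⟨fun e => α e.1.1 e.1.2, ⟨?_, fun e _ => hα _ _⟩, ?_⟩
    · exact (quotientGraph hL hT c).isCirculation_iff.1
        ((isDivergenceFree_iff hL hT hc hper hα0).1 hdiv)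
    · rw [fluxMap_apply, meanFlux_eq hL hT hα0]
  · rintro ⟨β, ⟨hβ, hβc⟩, rfl⟩
    have h0 : ∀ i j, c i j = 0 → periodicExtension hL hT hc β i j = 0 :=
      fun i j => periodicExtension_of_eq_zero hL hT hc β
    have hper := isPeriodicKernel_periodicExtension hL hT hc β
    refine ⟨periodicExtension hL hT hc β, ⟨fun i j => ?_, hper, ?_⟩, ?_⟩
    · by_cases h : c i j = 0
      · rw [h0 i j h]
        exact ⟨le_rfl, NNReal.coe_nonneg _⟩
      · obtain ⟨⟨e, z⟩, hx⟩ := exists_edgeTranslate hL hT hc h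
        obtain ⟨rfl, rfl⟩ := Prod.ext_iff.1 hx
        simp only [edgeTranslate]
        rw [hper.apply_translate hL, hc.apply_translate hL, periodicExtension_edge]
        exact hβc e trivial
    · rw [isDivergenceFree_iff hL hT hc hper h0]
      simp only [periodicExtension_edge]
      exact (quotientGraph hL hT c).isCirculation_iff.2 hβ
    · rw [fluxMap_apply, meanFlux_eq hL hT h0]
      simp only [periodicExtension_edge]

/-! ### Limits of the cell energies and uniqueness of the density -/

theorem tendsto_ofReal_of_eventually {ι : Type*} {f : ι → ℝ≥0∞} {F : Filter ι} {X : ℝ}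
    (hlow : ∀ ε > 0, ∀ᶠ S in F, ENNReal.ofReal (X - ε) ≤ f S)
    (hup : ∀ ε > 0, ∀ᶠ S in F, f S ≤ ENNReal.ofReal (X + ε)) :
    Filter.Tendsto f F (𝓝 (ENNReal.ofReal X)) := by
  have h1 : Filter.Tendsto (fun ε => ENNReal.ofReal (X - ε)) (𝓝[>] 0) (𝓝 (ENNReal.ofReal X)) := by
    have : Continuous fun ε => ENNReal.ofReal (X - ε) :=
      ENNReal.continuous_ofReal.comp (by fun_prop)
    simpa using (this.tendsto 0).mono_left nhdsWithin_le_nhds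
  have h2 : Filter.Tendsto (fun ε => ENNReal.ofReal (X + ε)) (𝓝[>] 0) (𝓝 (ENNReal.ofReal X)) := by
    have : Continuous fun ε => ENNReal.ofReal (X + ε) :=
      ENNReal.continuous_ofReal.comp (by fun_prop)
    simpa using (this.tendsto 0).mono_left nhdsWithin_le_nhds
  refine tendsto_order.2 ⟨fun a ha => ?_, fun a ha => ?_⟩
  · obtain ⟨ε, h3, hε⟩ := ((h1.eventually_const_lt ha).and self_mem_nhdsWithin).exists
    filter_upwards [hlow ε hε] with S hS
    exact h3.trans_le hS
  · obtain ⟨ε, h3, hε⟩ := ((h2.eventually_lt_const ha).and self_mem_nhdsWithin).exists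
    filter_upwards [hup ε hε] with S hS
    exact hS.trans_lt h3

theorem half_quotientGraph (hT : 0 < T) {U : Space n ≃ₗᵢ[ℝ] Space n} {ν : Space n}
    (hU : U (lastBasisVector n) = ν) (p : {i : L // (i : Space n) ∈ cube n T})
    (z : Fin (n + 1) → ℤ) :
    (quotientGraph hL hT c).half T U p z =
      halfSpaceIndicator ν (translate hL p.1 z : Space n) := by
  simp only [PeriodicGraph.half, halfSpaceIndicator, ← height_eq_inner hU, loc_quotientGraph]
  congr

theorem tendsto_cellEnergy (hT : 0 < T) [Fintype (edges T c)]
    [Fintype {i : L // (i : Space n) ∈ cube n T}] (hc : IsPeriodicKernel T c)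
    (hR : HasFiniteRange c) {U : Space n ≃ₗᵢ[ℝ] Space n} {ν : Space n}
    (hU : U (lastBasisVector n) = ν) {δ : ℝ} (hδ0 : 0 < δ) (hδ1 : δ < 1) :
    Filter.Tendsto (fun S => cellEnergy c U ν δ S) Filter.atTop
      (𝓝 (ENNReal.ofReal ((1 - δ) ^ n * supportFunction (fluxSet hL hT c) ν +
        (1 - (1 - δ) ^ n) * (quotientGraph hL hT c).halfDensity T U))) := by
  obtain ⟨R, hR1, hR⟩ := hR
  have hR0 : 0 < R := by linarith
  set G := quotientGraph hL hT c with hG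
  have hdisp : ∀ e, ‖G.disp T e‖ ≤ R := norm_disp_le hL hT hR
  set φ := supportFunction (fluxSet hL hT c) ν with hφ
  set ψ := G.halfDensity T U with hψ
  have hl0 : 0 < 1 - δ := by linarith
  have hl1 : 1 - δ < 1 := by linarith
  have hln : (1 - δ) ^ n ≤ 1 := pow_le_one₀ hl0.le hl1.le
  have hln0 : 0 < (1 - δ) ^ n := pow_pos hl0 n
  have hW := isCompact_fluxSet (c := c) hL hT
  have hlub := isLUB_supportFunction hW ⟨0, zero_mem_fluxSet hL hT⟩ ν
  refine tendsto_ofReal_of_eventually (fun ε hε => ?_) fun ε hε => ?_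
  -- Lower bound: half of `ε` is spent on a nearly optimal circulation, half on the asymptotics in
  -- `S`.
  · obtain ⟨_, ⟨_, ⟨β, hβ, rfl⟩, rfl⟩, hlt, -⟩ := hlub.exists_between
      (show φ - ε / 2 < φ by linarith)
    simp only [inner_fluxMap hL hT hU] at hlt
    filter_upwards [G.eventually_le_graphEnergy hT U hR0 hdisp (G.isCirculation_iff.2 hβ.1)
      (fun e => (hβ.2 e trivial).1) (fun e => (hβ.2 e trivial).2) hl0 hl1 (half_pos hε),
      Filter.eventually_gt_atTop 0] with S hS hS0
    have hSn : 0 < S ^ n := pow_pos hS0 n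
    rw [cellEnergy, ENNReal.le_div_iff_mul_le (Or.inl (by simpa using hSn))
      (Or.inl ENNReal.ofReal_ne_top), ← ENNReal.ofReal_mul' hSn.le]
    refine le_iInf₂ fun u hu => ?_
    rw [energy_eq_graphEnergy hL hT hc u (isBounded_rotatedCube U S)]
    refine ENNReal.ofReal_le_ofReal (le_trans ?_ (hS _ (fun p z => ?_) fun p z hz => ?_))
    · refine mul_le_mul_of_nonneg_right ?_ hSn.le
      have := mul_le_mul_of_nonneg_left hlt.le hln0.le
      nlinarith
    · rcases hu.1 (translate hL p.1 z) with h | h <;> rw [h] <;> norm_num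
    · rw [half_quotientGraph hL hT hU]
      exact hu.2 _ hz
  -- Upper bound: on the quotient graph the optimal gain is at most `T^d φ`, since mean fluxes carry
  -- the factor `T^{-d}`.
  · obtain ⟨q, hq⟩ := G.exists_potential (fun e => height U (G.disp T e))
      (m := (T : ℝ) ^ (n + 1) * φ) (ε := (T : ℝ) ^ (n + 1) * (ε / 2)) (by positivity)
      fun β hβ hβ0 hβc => by
        have h1 := inner_le_supportFunction hW (ζ := fluxMap T c β)
          ⟨β, ⟨G.isCirculation_iff.1 hβ, fun e _ => ⟨hβ0 e, hβc e⟩⟩, rfl⟩ ν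
        rw [inner_fluxMap hL hT hU, inv_mul_le_iff₀ (by positivity)] at h1
        exact h1
    have hC : ∀ p, |q p| ≤ ∑ p, |q p| := fun p =>
      Finset.single_le_sum (f := fun p => |q p|) (fun _ _ => abs_nonneg _) (Finset.mem_univ p)
    filter_upwards [G.eventually_graphEnergy_le hT U hR0 hdisp
      (Finset.sum_nonneg fun p _ => abs_nonneg (q p)) hC hl0 hl1 (half_pos hε),
      Filter.eventually_gt_atTop 0] with S hS hS0
    have hSn : 0 < S ^ n := pow_pos hS0 n
    obtain ⟨v, hv01, hv, hvE⟩ := hS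
    set u : L → ℝ := fun i => v (cellRep hL hT i) (cellIndex T (i : Space n)) with hu
    have huv : (fun (p : {i : L // (i : Space n) ∈ cube n T}) (z : Fin (n + 1) → ℤ) =>
        u (translate hL p.1 z)) = v := by
      funext p z
      simp only [hu, cellRep_translate, cellRep_coe, cellIndex_translate hL hT,
        cellIndex_eq_zero hT p.2, zero_add]
    have humem : u ∈ competitors L U ν δ S := by
      refine ⟨fun i => hv01 _ _, fun i hi => ?_⟩
      have h1 := hv (cellRep hL hT i) (cellIndex T (i : Space n)) (by
        rw [loc_quotientGraph, translate_cellRep]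
        exact hi)
      rw [half_quotientGraph hL hT hU, translate_cellRep] at h1
      exact h1
    rw [cellEnergy]
    refine ENNReal.div_le_of_le_mul ((iInf₂_le u humem).trans ?_)
    rw [energy_eq_graphEnergy hL hT hc u (isBounded_rotatedCube U S), huv,
      ← ENNReal.ofReal_mul' hSn.le]
    refine ENNReal.ofReal_le_ofReal (hvE.trans (mul_le_mul_of_nonneg_right ?_ hSn.le))
    have h2 : ((T : ℝ) ^ (n + 1))⁻¹ * ∑ e, G.cap e *
        max (height U (G.disp T e) + (q (G.src e) - q (G.tgt e))) 0 ≤ φ + ε / 2 := by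
      rw [inv_mul_le_iff₀ (by positivity)]
      linarith
    have h3 := mul_le_mul_of_nonneg_left h2 hln0.le
    nlinarith

/-- The inner limit is continuous in `δ`, and at `δ = 0` the contribution of the frame between the
two cubes has the factor `1 - 1^n = 0`. -/
theorem isHomogenizedDensity_supportFunction (hT : 0 < T) [Fintype (edges T c)]
    [Fintype {i : L // (i : Space n) ∈ cube n T}] (hc : IsPeriodicKernel T c)
    (hR : HasFiniteRange c) {rot : Space n → Space n ≃ₗᵢ[ℝ] Space n}
    (hrot : ∀ ν, ‖ν‖ = 1 → rot ν (lastBasisVector n) = ν) :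
    IsHomogenizedDensity c rot (supportFunction (fluxSet hL hT c)) where
  nonneg ν := by
    have := inner_le_supportFunction (isCompact_fluxSet (c := c) hL hT) (zero_mem_fluxSet hL hT) ν
    simpa using this
  convex := convexOn_supportFunction (isCompact_fluxSet hL hT) ⟨0, zero_mem_fluxSet hL hT⟩
  homogeneous t ν ht :=
    supportFunction_smul (isCompact_fluxSet hL hT) ⟨0, zero_mem_fluxSet hL hT⟩ ht ν
  cell_formula ν hν := by
    refine ⟨_, fun δ h0 h1 => tendsto_cellEnergy hL hT hc hR (hrot ν hν) h0 h1, ?_⟩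
    have hcont : Continuous fun δ : ℝ => ENNReal.ofReal ((1 - δ) ^ n *
        supportFunction (fluxSet hL hT c) ν +
        (1 - (1 - δ) ^ n) * (quotientGraph hL hT c).halfDensity T (rot ν)) :=
      ENNReal.continuous_ofReal.comp (by fun_prop)
    simpa using (hcont.tendsto 0).mono_left nhdsWithin_le_nhds

/-- Limits are unique and `ENNReal.ofReal` is injective on nonnegative numbers, so unit vectors
agree; homogeneity gives the rest, with `φ 0 = 2 φ 0` at the origin. -/
theorem IsHomogenizedDensity.eq {rot : Space n → Space n ≃ₗᵢ[ℝ] Space n} {φ φ' : Space n → ℝ}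
    (h : IsHomogenizedDensity c rot φ) (h' : IsHomogenizedDensity c rot φ') : φ = φ' := by
  have hunit : ∀ ν : Space n, ‖ν‖ = 1 → φ ν = φ' ν := by
    intro ν hν
    obtain ⟨g, hg, hgφ⟩ := h.cell_formula ν hν
    obtain ⟨g', hg', hgφ'⟩ := h'.cell_formula ν hν
    have heq : g =ᶠ[𝓝[>] 0] g' := by
      filter_upwards [Ioo_mem_nhdsGT (zero_lt_one (α := ℝ))] with δ hδ
      exact tendsto_nhds_unique (hg δ hδ.1 hδ.2) (hg' δ hδ.1 hδ.2)
    have := tendsto_nhds_unique (hgφ.congr' heq) hgφ'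
    exact (ENNReal.ofReal_eq_ofReal_iff (h.nonneg ν) (h'.nonneg ν)).1 this
  have hzero : ∀ {χ : Space n → ℝ}, IsHomogenizedDensity c rot χ → χ 0 = 0 := by
    intro χ hχ
    have := hχ.homogeneous 2 0 two_pos
    rw [smul_zero] at this
    linarith
  funext ν
  by_cases hν : ν = 0
  · rw [hν, hzero h, hzero h']
  · have hpos : 0 < ‖ν‖ := norm_pos_iff.2 hν
    have h1 : ν = ‖ν‖ • (‖ν‖⁻¹ • ν) := by rw [smul_smul, mul_inv_cancel₀ hpos.ne', one_smul]
    rw [h1, h.homogeneous _ _ hpos, h'.homogeneous _ _ hpos, hunit]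
    rw [norm_smul, norm_inv, norm_norm, inv_mul_cancel₀ hpos.ne']

end LatticeEnergy

end

/-! ### The main theorem -/

theorem theorem2p7 {n : ℕ} (T : ℕ) (hT : 0 < T)
    (L : Set (LatticeEnergy.Space n))
    (hL1 : LatticeEnergy.IsDiscreteSet L)
    (hL2 : LatticeEnergy.IsPeriodicSet T L)
    (c : L → L → ℝ≥0)
    (hH1 : LatticeEnergy.IsPeriodicKernel T c)
    (hH3 : LatticeEnergy.HasFiniteRange c)
    (rot : LatticeEnergy.Space n → LatticeEnergy.Space n ≃ₗᵢ[ℝ] LatticeEnergy.Space n)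
    (hrot : ∀ ν, ‖ν‖ = 1 → rot ν (LatticeEnergy.lastBasisVector n) = ν) :
    (∃! φ : LatticeEnergy.Space n → ℝ, LatticeEnergy.IsHomogenizedDensity c rot φ) ∧
    ∀ φ : LatticeEnergy.Space n → ℝ, LatticeEnergy.IsHomogenizedDensity c rot φ →
      LatticeEnergy.IsCrystalline φ ∧
      (LatticeEnergy.edges T c).Finite ∧
      (Set.extremePoints ℝ (LatticeEnergy.wulffSet φ)).encard
        ≤ ((3 ^ (LatticeEnergy.edges T c).ncard : ℕ) : ℕ∞) ∧
      (∀ ν, IsLUB ((fun α => inner ℝ ν (LatticeEnergy.meanFlux T α)) ''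
        LatticeEnergy.admissibleFluxes T c) (φ ν)) ∧
      ∃ (V : Submodule ℝ (LatticeEnergy.edges T c → ℝ))
        (Λ : (LatticeEnergy.edges T c → ℝ) →ₗ[ℝ] LatticeEnergy.Space n),
        (V : Set (LatticeEnergy.edges T c → ℝ)) = LatticeEnergy.divergenceFreeVectors T c ∧
        (∀ β, Λ β = ((T : ℝ) ^ (n + 1))⁻¹ • ∑ᶠ e : LatticeEnergy.edges T c,
          β e • ((e.1.1 : LatticeEnergy.Space n) - (e.1.2 : LatticeEnergy.Space n))) ∧
        LatticeEnergy.wulffSet φ =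
          Λ '' ((V : Set (LatticeEnergy.edges T c → ℝ)) ∩
            Set.univ.pi fun e => Set.Icc (0 : ℝ) (c e.1.1 e.1.2)) := by
  have hfin := LatticeEnergy.finite_edges hL1 hH3 T
  have : Fintype (LatticeEnergy.edges T c) := hfin.fintype
  have := LatticeEnergy.finite_cell hL1 T
  have : Fintype {i : L // (i : LatticeEnergy.Space n) ∈ LatticeEnergy.cube n T} :=
    Fintype.ofFinite _
  have hcomp := LatticeEnergy.isCompact_fluxSet (c := c) hL2 hT
  have hconv := LatticeEnergy.convex_fluxSet (c := c) hL2 hT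
  have hzero := LatticeEnergy.zero_mem_fluxSet (c := c) hL2 hT
  have hφ₀ := LatticeEnergy.isHomogenizedDensity_supportFunction hL2 hT hH1 hH3 hrot
  refine ⟨⟨_, hφ₀, fun φ hφ => hφ.eq hφ₀⟩, fun φ hφ => ?_⟩
  -- By uniqueness every claim may be checked for the support function of `fluxSet`.
  obtain rfl := hφ.eq hφ₀
  have hwulff := LatticeEnergy.wulffSet_supportFunction hcomp hconv ⟨0, hzero⟩
  refine ⟨?_, hfin, ?_, fun ν => ?_,
    LinearMap.ker (LatticeEnergy.quotientGraph hL2 hT c).netFlow, LatticeEnergy.fluxMap T c,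
    ?_, fun β => ?_, hwulff⟩
  · rw [LatticeEnergy.IsCrystalline, hwulff]
    exact LatticeEnergy.isPolytope_image_boxSection _ _ _
  · rw [hwulff, ← Nat.card_coe_set_eq, Nat.card_eq_fintype_card]
    exact LatticeEnergy.encard_extremePoints_image_boxSection_le _ _ _
  · have h := LatticeEnergy.isLUB_supportFunction hcomp ⟨0, hzero⟩ ν
    nth_rewrite 1 [← LatticeEnergy.image_meanFlux_admissibleFluxes hL2 hT hH1] at h
    rwa [Set.image_image] at h
  · ext β
    rw [LatticeEnergy.mem_divergenceFreeVectors_iff hL2 hT hH1,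
      LatticeEnergy.PeriodicGraph.isCirculation_iff]
    rfl
  · rw [LatticeEnergy.fluxMap_apply, finsum_eq_sum_of_fintype]
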